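/- **Conventions.** Let $0<q<1$, $a\in\mathbb R$ and $t=q^a-q^{-a}$. Algebras are unital over $\mathbb C$, and inner products are conjugate-linear in the first variable. * $\mathcal O_q(SU(2))$ is the $*$-algebra generated by the entries of $U=\begin{pmatrix}\alpha&\beta\\ \gamma&\delta\end{pmatrix}$ such that $U$ is unitary with $U^*=\begin{pmatrix}\delta&-q^{-1}\beta\\-q\gamma&\alpha\end{pmatrix}$, with $\Delta(U_{ij})=\sum_kU_{ik}\otimes U_{kj}$. * $U_q(\mathfrak{su}(2))$ is the $*$-algebra generated by $K^{\pm1},E,F$ with $KE=q^2EK$, $KF=q^{-2}FK$, $EF-FE=\frac{K-K^{-1}}{q-q^{-1}}$, $K^*=K$, $E^*=FK$, $F^*=K^{-1}E$, and with $\Delta(K)=K\otimes K$, $\Delta(E)=E\otimes1+K\otimes E$, $\Delta(F)=F\otimes K^{-1}+1\otimes F$. It is paired with $\mathcal O_q(SU(2))$ by the bilinear form $\tau$ with $\tau(fg,x)=\tau(f,x_{(1)})\tau(g,x_{(2)})$, $\tau(f,xy)=\tau(f_{(1)},x)\tau(f_{(2)},y)$, $\tau(1,x)=\varepsilon(x)$,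 $\tau(f,1)=\varepsilon(f)$ and $$\tau(U,K)=\begin{pmatrix}q&0\\0&q^{-1}\end{pmatrix},\quad \tau(U,E)=\begin{pmatrix}0&q^{1/2}\\0&0\end{pmatrix},\quad \tau(U,F)=\begin{pmatrix}0&0\\q^{-1/2}&0\end{pmatrix}.$$ * The Podleś sphere $B=\mathcal O_q(S_t^2)$ is the $*$-algebra generated by $X_t,Y_t,Z_t$ with $X_t^*=Y_t$, $Z_t^*=Z_t$, $X_tZ_t=q^2Z_tX_t$, $Y_tZ_t=q^{-2}Z_tY_t$, $X_tY_t=1-qtZ_t-q^2Z_t^2$, $Y_tX_t=1-q^{-1}tZ_t-q^{-2}Z_t^2$. Put $E_t=\begin{pmatrix}q^{-1}Z_t&Y_t\\X_t&-t-qZ_t\end{pmatrix}$. There is a homomorphism $j:B\to\mathcal O_q(SU(2))$ with $j(E_t)=U^*\begin{pmatrix}0&i\\-i&-t\end{pmatrix}U$, and a coaction $B\to B\otimes\mathcal O_q(SU(2))$, $b\mapsto b_{(1)}\otimes b_{(2)}$, which is the algebra homomorphism with $E_t\mapsto(1\otimes U)^*(E_t\otimes1)(1\otimes U)$. Then $U_q(\mathfrak{su}(2))$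 acts on $B$ by $x\rhd b=\tau(b_{(2)},x)\,b_{(1)}$. * The Heisenberg double $\mathcal H=\mathcal H(\mathcal O_q(S_t^2),U_q(\mathfrak{su}(2)))$ is the universal $*$-algebra generated by its $*$-subalgebras $B$ and $U_q(\mathfrak{su}(2))$ with $xb=(x_{(1)}\rhd b)\,x_{(2)}$. It acts on $B$ by the Heisenberg representation $\pi_{\mathrm{Heis}}(b)c=bc$, $\pi_{\mathrm{Heis}}(x)c=x\rhd c$. * Let $\mathcal H_\pm$ be a Hilbert space with orthonormal basis $(\xi_p^\pm)_{p\ge0}$, let $V_\pm$ be the linear span of this basis, and let $B$ act on $V_\pm$ by $$\pi_\pm(Z_t)\xi^\pm_p=\pm q^{2p\mp a+1}\xi^\pm_p,\qquad \pi_\pm(X_t)\xi_p^\pm=\sqrt{(1-q^{2p})(q^{\mp2a+2p}+1)}\,\xi^\pm_{p-1},\qquad \pi_\pm(Y_t)\xi_p^\pm=\sqrt{(1-q^{2p+2})(q^{\mp2a+2p+2}+1)}\,\xi^\pm_{p+1}.$$ Then $\pi_\pm(Z_t)$ is invertible on $V_\pm$. Put $W_\pm=V_\pm\otimes V_\pm$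 (algebraic tensor product). In $(\mathcal H_+\otimes\mathcal H_+)\oplus(\mathcal H_-\otimes\mathcal H_-)$ consider $$\xi_T=\Bigl(\tfrac{q^{-1}-q}{q^a+q^{-a}}\Bigr)^{1/2}\sum_{\pm}\sum_{p\ge0}q^{p\mp\frac{a\mp1}{2}}\,\xi_p^\pm\otimes\xi_p^\pm,\qquad \Lambda(b)=(\pi(b)\otimes1)\xi_T\quad(b\in B),\quad \pi=\pi_+\oplus\pi_-,$$ and $L^2_{q,0}(S_t^2)=\Lambda(B)$. **Theorem.** The map $\Lambda$ is the GNS map of $B$ for the Haar state: if $\Phi$ is a left and right invariant state of $\mathcal O_q(SU(2))$, then $\langle\Lambda(b),\Lambda(c)\rangle=\Phi(j(b^*c))$ for all $b,c\in B$. Moreover, for each choice of sign there is a unital $*$-representation $\widetilde\pi_\pm$ of $\mathcal H$ on $W_\pm$, that is, a unital homomorphism $\widetilde\pi_\pm:\mathcal H\to\mathrm{End}_{\mathbb C}(W_\pm)$ with $\langle\widetilde\pi_\pm(x)\eta,\zeta\rangle=\langle\eta,\widetilde\pi_\pm(x^*)\zeta\rangle$ for all $x\in\mathcal H$ and $\eta,\zeta\in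 W_\pm$, such that: 1. $\widetilde\pi_\pm(b)=\pi_\pm(b)\otimes1$ for $b\in B$; 2. writing $X_t,Y_t,Z_t$ for their images under $\pi_\pm$, $$\widetilde\pi_\pm(K)=Z_t^{-1}\otimes Z_t,$$ $$(q^{-1}-q)\,\widetilde\pi_\pm(E)=q^{-1/2}Z_t^{-1}X_t\otimes1-q^{1/2}Z_t^{-1}\otimes Y_t,$$ $$(q^{-1}-q)\,\widetilde\pi_\pm(F)=q^{-1/2}Y_t\otimes Z_t^{-1}-q^{1/2}\,1\otimes X_tZ_t^{-1};$$ 3. for all $x\in\mathcal H$, $\eta\in W_\pm$ and $b\in B$, $$\langle\widetilde\pi_\pm(x)\eta,\Lambda(b)\rangle=\langle\eta,\Lambda(\pi_{\mathrm{Heis}}(x^*)b)\rangle .$$ -/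

import Mathlib

open scoped TensorProduct

noncomputable section

set_option linter.unusedSimpArgs false
set_option linter.unnecessarySeqFocus false
set_option linter.unreachableTactic false
set_option linter.unusedTactic false

namespace QuantumSphere

/-- The deformation parameter `0 < q < 1`. -/
abbrev Param := Set.Ioo (0 : ℝ) 1

/-- `q` as a complex number. -/
def qc (q : Param) : ℂ := ((q : ℝ) : ℂ)

/-- `q ^ (1/2)` as a complex number. -/
def qh (q : Param) : ℂ := ((Real.sqrt (q : ℝ) : ℝ) : ℂ)

/-- `t = q ^ a - q ^ (-a)`. -/
def tpar (q : Param) (a : ℝ) : ℝ := (q : ℝ) ^ a - (q : ℝ) ^ (-a)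

/-- `t` as a complex number. -/
def tc (q : Param) (a : ℝ) : ℂ := ((tpar q a : ℝ) : ℂ)

theorem qc_ne (q : Param) : qc q ≠ 0 := by
  have := q.2.1
  simp only [qc, ne_eq, Complex.ofReal_eq_zero]
  exact ne_of_gt this

theorem qh_ne (q : Param) : qh q ≠ 0 := by
  have := Real.sqrt_pos.2 q.2.1
  simp only [qh, ne_eq, Complex.ofReal_eq_zero]
  exact ne_of_gt this

theorem qh_sq (q : Param) : qh q ^ 2 = qc q := by
  simp only [qh, qc]
  rw [← Complex.ofReal_pow, Real.sq_sqrt q.2.1.le]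

theorem qc_sub_ne (q : Param) : qc q - (qc q)⁻¹ ≠ 0 := by
  have h0 := q.2.1
  have h1 := q.2.2
  have : (1 : ℝ) < (q : ℝ)⁻¹ := (one_lt_inv₀ h0).2 h1
  simp only [qc]
  rw [← Complex.ofReal_inv, ← Complex.ofReal_sub, ne_eq, Complex.ofReal_eq_zero]
  have : (q : ℝ) - (q : ℝ)⁻¹ < 0 := by linarith
  exact ne_of_lt this

@[simp] theorem conj_qc (q : Param) : (starRingEnd ℂ) (qc q) = qc q := Complex.conj_ofReal _
@[simp] theorem conj_tc (q : Param) (a : ℝ) : (starRingEnd ℂ) (tc q a) = tc q a :=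
  Complex.conj_ofReal _

/-! ### Algebras given by generators and relations, and their star structures -/

section Presented

variable {X : Type} {T : Type} [Ring T] [Algebra ℂ T]

/-- The conjugate-linear anti-multiplicative extension to the free algebra
of a map on generators, as a ring homomorphism to the opposite ring. -/
def conjAntiHom (s : X → T) : FreeAlgebra ℂ X →+* Tᵐᵒᵖ :=
  letI : Algebra ℂ Tᵐᵒᵖ := Algebra.compHom Tᵐᵒᵖ (starRingEnd ℂ)
  (FreeAlgebra.lift ℂ (fun x => MulOpposite.op (s x)) : FreeAlgebra ℂ X →ₐ[ℂ] Tᵐᵒᵖ).toRingHom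

/-- The conjugate-linear anti-multiplicative extension to the free algebra
of a map on generators. -/
def conjAnti (s : X → T) (y : FreeAlgebra ℂ X) : T := (conjAntiHom s y).unop

theorem conjAnti_ι (s : X → T) (x : X) : conjAnti s (FreeAlgebra.ι ℂ x) = s x := by
  let _ : Algebra ℂ Tᵐᵒᵖ := Algebra.compHom Tᵐᵒᵖ (starRingEnd ℂ)
  exact congrArg MulOpposite.unop
    (FreeAlgebra.lift_ι_apply (A := Tᵐᵒᵖ) (fun x => MulOpposite.op (s x)) x)

theorem conjAnti_algebraMap (s : X → T) (c : ℂ) :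
    conjAnti s (algebraMap ℂ _ c) = algebraMap ℂ T ((starRingEnd ℂ) c) := by
  let _ : Algebra ℂ Tᵐᵒᵖ := Algebra.compHom Tᵐᵒᵖ (starRingEnd ℂ)
  exact congrArg MulOpposite.unop
    ((FreeAlgebra.lift ℂ (fun x => MulOpposite.op (s x)) : FreeAlgebra ℂ X →ₐ[ℂ] Tᵐᵒᵖ).commutes c)

theorem conjAnti_mul (s : X → T) (y z : FreeAlgebra ℂ X) :
    conjAnti s (y * z) = conjAnti s z * conjAnti s y := by simp [conjAnti]

theorem conjAnti_add (s : X → T) (y z : FreeAlgebra ℂ X) :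
    conjAnti s (y + z) = conjAnti s y + conjAnti s z := by simp [conjAnti]

theorem conjAnti_sub (s : X → T) (y z : FreeAlgebra ℂ X) :
    conjAnti s (y - z) = conjAnti s y - conjAnti s z := by simp [conjAnti]

theorem conjAnti_neg (s : X → T) (y : FreeAlgebra ℂ X) :
    conjAnti s (-y) = -conjAnti s y := by simp [conjAnti]

theorem conjAnti_zero (s : X → T) : conjAnti s 0 = 0 := by simp [conjAnti]

theorem conjAnti_one (s : X → T) : conjAnti s 1 = 1 := by simp [conjAnti]

theorem conjAnti_sum (s : X → T) {n : ℕ} (f : Fin n → FreeAlgebra ℂ X) :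
    conjAnti s (∑ i, f i) = ∑ i, conjAnti s (f i) := by simp [conjAnti]

theorem conjAnti_smul (s : X → T) (c : ℂ) (y : FreeAlgebra ℂ X) :
    conjAnti s (c • y) = (starRingEnd ℂ) c • conjAnti s y := by
  rw [Algebra.smul_def, conjAnti_mul, conjAnti_algebraMap, Algebra.smul_def, Algebra.commutes]

variable {r : FreeAlgebra ℂ X → FreeAlgebra ℂ X → Prop}

/-- The image of a generator in a presented algebra. -/
def gen (r : FreeAlgebra ℂ X → FreeAlgebra ℂ X → Prop) (x : X) : RingQuot r :=
  RingQuot.mkAlgHom ℂ r (FreeAlgebra.ι ℂ x)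

theorem presented_induction {P : RingQuot r → Prop}
    (hc : ∀ c : ℂ, P (algebraMap ℂ _ c)) (hg : ∀ x, P (gen r x))
    (ha : ∀ y z, P y → P z → P (y + z)) (hm : ∀ y z, P y → P z → P (y * z))
    (y : RingQuot r) : P y := by
  obtain ⟨y, rfl⟩ := RingQuot.mkAlgHom_surjective ℂ r y
  induction y using FreeAlgebra.induction with
  | grade0 c => simpa using hc c
  | grade1 x => exact hg x
  | mul y z hy hz => simpa using hm _ _ hy hz
  | add y z hy hz => simpa using ha _ _ hy hz

theorem presented_ext {S : Type} [Semiring S] [Algebra ℂ S] {f g : RingQuot r →ₐ[ℂ] S} (h : ∀ x, f (gen r x) = g (gen r x)) :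
    f = g := by
  ext x
  exact h x

/-- The universal property of a presented algebra. -/
def presentedLift (f : X → T)
    (h : ∀ ⦃x y⦄, r x y → FreeAlgebra.lift ℂ f x = FreeAlgebra.lift ℂ f y) :
    RingQuot r →ₐ[ℂ] T :=
  RingQuot.liftAlgHom ℂ ⟨FreeAlgebra.lift ℂ f, h⟩

@[simp] theorem presentedLift_gen (f : X → T)
    (h : ∀ ⦃x y⦄, r x y → FreeAlgebra.lift ℂ f x = FreeAlgebra.lift ℂ f y) (x : X) :
    presentedLift f h (gen r x) = f x := by
  unfold presentedLift gen
  exact (RingQuot.liftAlgHom_mkAlgHom_apply ℂ _ _ _).trans (by simp)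

/-- The conjugate-linear anti-homomorphism of a presented algebra
determined by its values on generators. -/
def presentedStar (s : X → RingQuot r) (h : ∀ ⦃x y⦄, r x y → conjAnti s x = conjAnti s y)
    (y : RingQuot r) : RingQuot r :=
  (RingQuot.lift ⟨conjAntiHom s, fun _ _ hr => MulOpposite.unop_injective (h hr)⟩ y).unop

section PStar

variable (s : X → RingQuot r) (h : ∀ ⦃x y⦄, r x y → conjAnti s x = conjAnti s y)

theorem presentedStar_mk (y : FreeAlgebra ℂ X) :
    presentedStar s h (RingQuot.mkAlgHom ℂ r y) = conjAnti s y := by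
  have : RingQuot.mkAlgHom ℂ r y = RingQuot.mkRingHom r y := by
    rw [← RingQuot.mkAlgHom_coe ℂ r]; rfl
  rw [this]
  exact congrArg MulOpposite.unop (RingQuot.lift_mkRingHom_apply _ _ y)

theorem presentedStar_gen (x : X) : presentedStar s h (gen r x) = s x := by
  rw [gen, presentedStar_mk, conjAnti_ι]

theorem presentedStar_algebraMap (c : ℂ) :
    presentedStar s h (algebraMap ℂ _ c) = algebraMap ℂ _ ((starRingEnd ℂ) c) := by
  rw [← (RingQuot.mkAlgHom ℂ r).commutes, presentedStar_mk, conjAnti_algebraMap]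

theorem presentedStar_mul (y z : RingQuot r) :
    presentedStar s h (y * z) = presentedStar s h z * presentedStar s h y := by
  simp [presentedStar]

theorem presentedStar_add (y z : RingQuot r) :
    presentedStar s h (y + z) = presentedStar s h y + presentedStar s h z := by
  simp [presentedStar]

theorem presentedStar_neg (y : RingQuot r) :
    presentedStar s h (-y) = -presentedStar s h y := by
  simp [presentedStar]

theorem presentedStar_smul (c : ℂ) (y : RingQuot r) :
    presentedStar s h (c • y) = (starRingEnd ℂ) c • presentedStar s h y := by
  rw [Algebra.smul_def, presentedStar_mul, presentedStar_algebraMap, Algebra.smul_def,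
    Algebra.commutes]

/-- The star ring structure of a presented algebra determined by its values on generators. -/
@[reducible] def starRingOfGen (hs : ∀ x, presentedStar s h (s x) = gen r x) :
    StarRing (RingQuot r) where
  star := presentedStar s h
  star_involutive := by
    intro y
    induction y using presented_induction with
    | hc c => simp [presentedStar_algebraMap]
    | hg x => simp [presentedStar_gen, hs]
    | ha y z hy hz => simp only [presentedStar_add, hy, hz]
    | hm y z hy hz => simp only [presentedStar_mul, hy, hz]
  star_mul := presentedStar_mul s h
  star_add := presentedStar_add s h

end PStar

end Presented

/-! ### The quantum group `O_q(SU(2))` -/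

section Adj

variable {T : Type} [Ring T] [Algebra ℂ T]

/-- The matrix `(δ, -q⁻¹β; -qγ, α)` associated to `(α, β; γ, δ)`. -/
def qadj (q : Param) (M : Matrix (Fin 2) (Fin 2) T) : Matrix (Fin 2) (Fin 2) T :=
  !![M 1 1, -((qc q)⁻¹ • M 0 1); -(qc q • M 1 0), M 0 0]

theorem qadj_map {T' : Type} [Ring T'] [Algebra ℂ T'] (q : Param) (f : T →ₐ[ℂ] T')
    (M : Matrix (Fin 2) (Fin 2) T) : qadj q (M.map f) = (qadj q M).map f := by
  ext i j; fin_cases i <;> fin_cases j <;> simp [qadj]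

theorem qadj_one (q : Param) : qadj q (1 : Matrix (Fin 2) (Fin 2) T) = 1 := by
  ext i j; fin_cases i <;> fin_cases j <;> simp [qadj]

theorem qadj_mul (q : Param) (M N : Matrix (Fin 2) (Fin 2) T)
    (h : ∀ i j k l, M i j * N k l = N k l * M i j) :
    qadj q (M * N) = qadj q N * qadj q M := by
  have h0 := qc_ne q
  ext i j; fin_cases i <;> fin_cases j <;>
    simp [qadj, Matrix.mul_apply, Fin.sum_univ_two, h, smul_smul, h0, add_comm]

theorem matrix_map_mul {S S' : Type} [Semiring S] [Algebra ℂ S] [Semiring S'] [Algebra ℂ S']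
    (f : S →ₐ[ℂ] S') (M N : Matrix (Fin 2) (Fin 2) S) : (M * N).map f = M.map f * N.map f :=
  Matrix.map_mul

theorem matrix_map_one {S S' : Type} [Semiring S] [Algebra ℂ S] [Semiring S'] [Algebra ℂ S']
    (f : S →ₐ[ℂ] S') :
    (1 : Matrix (Fin 2) (Fin 2) S).map f = 1 := by
  ext i j; fin_cases i <;> fin_cases j <;> simp

/-- The inclusion of the first factor of a tensor product. -/
def inL (A B : Type) [Ring A] [Algebra ℂ A] [Ring B] [Algebra ℂ B] : A →ₐ[ℂ] A ⊗[ℂ] B :=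
  Algebra.TensorProduct.includeLeft

/-- The inclusion of the second factor of a tensor product. -/
def inR (A B : Type) [Ring A] [Algebra ℂ A] [Ring B] [Algebra ℂ B] : B →ₐ[ℂ] A ⊗[ℂ] B :=
  Algebra.TensorProduct.includeRight

end Adj

/-- The generators of the free algebra on the matrix entries, as a matrix. -/
def SUFree : Matrix (Fin 2) (Fin 2) (FreeAlgebra ℂ (Fin 2 × Fin 2)) :=
  Matrix.of fun i j => FreeAlgebra.ι ℂ (i, j)

/-- The relations saying that `U = (α, β; γ, δ)` is invertible with inverse
`(δ, -q⁻¹β; -qγ, α)` (which is going to be `U^*`). -/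
inductive SURel (q : Param) :
    FreeAlgebra ℂ (Fin 2 × Fin 2) → FreeAlgebra ℂ (Fin 2 × Fin 2) → Prop
  | mul_adj (i j : Fin 2) : SURel q ((SUFree * qadj q SUFree) i j)
      ((1 : Matrix (Fin 2) (Fin 2) (FreeAlgebra ℂ (Fin 2 × Fin 2))) i j)
  | adj_mul (i j : Fin 2) : SURel q ((qadj q SUFree * SUFree) i j)
      ((1 : Matrix (Fin 2) (Fin 2) (FreeAlgebra ℂ (Fin 2 × Fin 2))) i j)

/-- The algebra `O_q(SU(2))`. -/
abbrev SUq (q : Param) : Type := RingQuot (SURel q)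

namespace SUq

variable (q : Param)

/-- The fundamental matrix `U = (α, β; γ, δ)`. -/
def U : Matrix (Fin 2) (Fin 2) (SUq q) := Matrix.of fun i j => gen (SURel q) (i, j)

/-- The quotient map from the free algebra. -/
def mk : FreeAlgebra ℂ (Fin 2 × Fin 2) →ₐ[ℂ] SUq q := RingQuot.mkAlgHom ℂ (SURel q)

theorem mk_map : SUFree.map (mk q) = U q := rfl

theorem U_mul_adj : U q * qadj q (U q) = 1 := by
  rw [← mk_map, qadj_map, ← matrix_map_mul, ← matrix_map_one (mk q)]
  ext i j
  exact RingQuot.mkAlgHom_rel ℂ (SURel.mul_adj i j)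

theorem adj_mul_U : qadj q (U q) * U q = 1 := by
  rw [← mk_map, qadj_map, ← matrix_map_mul, ← matrix_map_one (mk q)]
  ext i j
  exact RingQuot.mkAlgHom_rel ℂ (SURel.adj_mul i j)

variable {q}

theorem induction {P : SUq q → Prop}
    (hc : ∀ c : ℂ, P (algebraMap ℂ _ c)) (hg : ∀ i j, P (U q i j))
    (ha : ∀ y z, P y → P z → P (y + z)) (hm : ∀ y z, P y → P z → P (y * z))
    (y : SUq q) : P y :=
  presented_induction (r := SURel q) hc (fun x => hg x.1 x.2) ha hm y

section Lift

variable {T : Type} [Ring T] [Algebra ℂ T]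

/-- The universal property of `O_q(SU(2))`. -/
def lift (M : Matrix (Fin 2) (Fin 2) T) (h₁ : M * qadj q M = 1) (h₂ : qadj q M * M = 1) :
    SUq q →ₐ[ℂ] T :=
  presentedLift (fun x => M x.1 x.2) (by
    have hM : SUFree.map (FreeAlgebra.lift ℂ (fun x : Fin 2 × Fin 2 => M x.1 x.2)) = M := by
      ext i j; simp [SUFree]
    intro x y h
    induction h with
    | mul_adj i j =>
      have := congrFun (congrFun (matrix_map_mul (FreeAlgebra.lift ℂ
        (fun x : Fin 2 × Fin 2 => M x.1 x.2)) SUFree (qadj q SUFree)) i) j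
      rw [← qadj_map, hM, h₁, ← matrix_map_one (FreeAlgebra.lift ℂ
        (fun x : Fin 2 × Fin 2 => M x.1 x.2))] at this
      exact this
    | adj_mul i j =>
      have := congrFun (congrFun (matrix_map_mul (FreeAlgebra.lift ℂ
        (fun x : Fin 2 × Fin 2 => M x.1 x.2)) (qadj q SUFree) SUFree) i) j
      rw [← qadj_map, hM, h₂, ← matrix_map_one (FreeAlgebra.lift ℂ
        (fun x : Fin 2 × Fin 2 => M x.1 x.2))] at this
      exact this)

@[simp] theorem lift_U (M : Matrix (Fin 2) (Fin 2) T) (h₁ : M * qadj q M = 1)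
    (h₂ : qadj q M * M = 1) (i j : Fin 2) : lift M h₁ h₂ (U q i j) = M i j :=
  presentedLift_gen _ _ _

theorem algHom_ext {S : Type} [Semiring S] [Algebra ℂ S] {f g : SUq q →ₐ[ℂ] S}
    (h : ∀ i j, f (U q i j) = g (U q i j)) :
    f = g :=
  presented_ext fun x => h x.1 x.2

end Lift

section Star

/-- The adjoints of the generators. -/
def starGen (q : Param) (p : Fin 2 × Fin 2) : SUq q := qadj q (U q) p.2 p.1

theorem star_rel : ∀ ⦃x y⦄, SURel q x y →
    conjAnti (starGen q) x =
    conjAnti (starGen q) y := by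
  have h0 := qc_ne q
  have e1 : ∀ i j, conjAnti (starGen q) (SUFree i j) =
      qadj q (U q) j i := fun i j => conjAnti_ι _ _
  have e2 : ∀ i j, conjAnti (starGen q)
      (qadj q SUFree i j) = U q j i := by
    intro i j
    have h1 : (starRingEnd ℂ) (qc q)⁻¹ = (qc q)⁻¹ := by simp
    fin_cases i <;> fin_cases j
    · exact (e1 1 1)
    · change conjAnti (starGen q) (-((qc q)⁻¹ • SUFree 0 1)) = U q 1 0
      rw [conjAnti_neg, conjAnti_smul, e1, h1]
      simp [qadj, smul_smul, h0]
    · change conjAnti (starGen q) (-(qc q • SUFree 1 0)) = U q 0 1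
      rw [conjAnti_neg, conjAnti_smul, e1, conj_qc]
      simp [qadj, smul_smul, h0]
    · exact (e1 0 0)
  have e3 : ∀ i j, conjAnti (starGen q)
      ((1 : Matrix (Fin 2) (Fin 2) (FreeAlgebra ℂ (Fin 2 × Fin 2))) i j) =
      (1 : Matrix (Fin 2) (Fin 2) (SUq q)) j i := by
    intro i j
    fin_cases i <;> fin_cases j <;> simp [conjAnti_one, conjAnti_zero]
  intro x y h
  induction h with
  | mul_adj i j =>
    rw [e3, ← U_mul_adj]
    simp only [Matrix.mul_apply, conjAnti_add, conjAnti_mul, e1, e2, Fin.sum_univ_two]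
  | adj_mul i j =>
    rw [e3, ← adj_mul_U]
    simp only [Matrix.mul_apply, conjAnti_add, conjAnti_mul, e1, e2, Fin.sum_univ_two]

theorem star_inv (p : Fin 2 × Fin 2) :
    presentedStar _ (star_rel (q := q)) (starGen q p) = gen (SURel q) p := by
  have h0 := qc_ne q
  have e1 : ∀ i j, presentedStar _ (star_rel (q := q)) (U q i j) = qadj q (U q) j i :=
    fun i j => presentedStar_gen _ (star_rel (q := q)) (i, j)
  obtain ⟨i, j⟩ := p
  change presentedStar _ (star_rel (q := q)) (qadj q (U q) j i) = U q i j
  have h1 : (starRingEnd ℂ) (qc q)⁻¹ = (qc q)⁻¹ := by simp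
  fin_cases i <;> fin_cases j
  · exact e1 1 1
  · change presentedStar _ (star_rel (q := q)) (-(qc q • U q 1 0)) = U q 0 1
    rw [presentedStar_neg, presentedStar_smul, e1, conj_qc]
    simp [qadj, smul_smul, h0]
  · change presentedStar _ (star_rel (q := q)) (-((qc q)⁻¹ • U q 0 1)) = U q 1 0
    rw [presentedStar_neg, presentedStar_smul, e1, h1]
    simp [qadj, smul_smul, h0]
  · exact e1 0 0

/-- The star structure of `O_q(SU(2))`, determined by `U^* = (δ, -q⁻¹β; -qγ, α)`. -/
instance : StarRing (SUq q) := starRingOfGen _ star_rel star_inv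

instance : StarModule ℂ (SUq q) := ⟨presentedStar_smul _ star_rel⟩

theorem star_U (i j : Fin 2) : star (U q i j) = qadj q (U q) j i :=
  presentedStar_gen _ (star_rel (q := q)) (i, j)

end Star

section Coalgebra

/-- The matrix with entries `∑ k, U i k ⊗ U k j`. -/
def UU (q : Param) : Matrix (Fin 2) (Fin 2) (SUq q ⊗[ℂ] SUq q) :=
  (U q).map (inL (SUq q) (SUq q)) *
    (U q).map (inR (SUq q) (SUq q))

theorem UU_apply (i j : Fin 2) : UU q i j = ∑ k, U q i k ⊗ₜ[ℂ] U q k j := by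
  simp [UU, Matrix.mul_apply, inL, inR]

theorem qadj_UU : qadj q (UU q) =
    (qadj q (U q)).map (inR (SUq q) (SUq q)) *
    (qadj q (U q)).map (inL (SUq q) (SUq q)) := by
  rw [UU, qadj_mul, qadj_map, qadj_map]
  intro i j k l
  simp [inL, inR]

theorem UU_mul_adj : UU q * qadj q (UU q) = 1 := by
  have h : ∀ A B C D : Matrix (Fin 2) (Fin 2) (SUq q ⊗[ℂ] SUq q),
      A * B * (C * D) = A * (B * C) * D := fun A B C D => by simp only [Matrix.mul_assoc]
  rw [qadj_UU, UU, h, ← matrix_map_mul, U_mul_adj, matrix_map_one, Matrix.mul_one,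
    ← matrix_map_mul, U_mul_adj, matrix_map_one]

theorem adj_mul_UU : qadj q (UU q) * UU q = 1 := by
  have h : ∀ A B C D : Matrix (Fin 2) (Fin 2) (SUq q ⊗[ℂ] SUq q),
      A * B * (C * D) = A * (B * C) * D := fun A B C D => by simp only [Matrix.mul_assoc]
  rw [qadj_UU, UU, h, ← matrix_map_mul, adj_mul_U, matrix_map_one, Matrix.mul_one,
    ← matrix_map_mul, adj_mul_U, matrix_map_one]

/-- The bialgebra structure of `O_q(SU(2))` for which `U` is a corepresentation matrix. -/
instance : Bialgebra ℂ (SUq q) :=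
  Bialgebra.ofAlgHom (lift (UU q) UU_mul_adj adj_mul_UU)
    (lift 1 (by rw [qadj_one, Matrix.one_mul]) (by rw [qadj_one, Matrix.one_mul]))
    (by
      refine algHom_ext fun i j => ?_
      simp [UU_apply, TensorProduct.tmul_add, TensorProduct.add_tmul]
      abel)
    (by
      refine algHom_ext fun i j => ?_
      fin_cases i <;> fin_cases j <;> simp [UU_apply])
    (by
      refine algHom_ext fun i j => ?_
      fin_cases i <;> fin_cases j <;> simp [UU_apply])

theorem comul_U (i j : Fin 2) :
    Coalgebra.comul (R := ℂ) (U q i j) = ∑ k, U q i k ⊗ₜ[ℂ] U q k j :=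
  (lift_U (UU q) UU_mul_adj adj_mul_UU i j).trans (UU_apply i j)

theorem counit_U (i j : Fin 2) :
    Coalgebra.counit (R := ℂ) (U q i j) = (1 : Matrix (Fin 2) (Fin 2) ℂ) i j :=
  lift_U _ _ _ i j

end Coalgebra

end SUq

/-! ### The quantized enveloping algebra `U_q(su(2))` -/

/-- Names for the generators `K, K⁻¹, E, F`. -/
inductive UGen
  | K | Ki | E | F

/-- The defining relations of `U_q(su(2))`. -/
inductive URel (q : Param) : FreeAlgebra ℂ UGen → FreeAlgebra ℂ UGen → Prop
  | K_Ki : URel q (FreeAlgebra.ι ℂ UGen.K * FreeAlgebra.ι ℂ UGen.Ki) 1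
  | Ki_K : URel q (FreeAlgebra.ι ℂ UGen.Ki * FreeAlgebra.ι ℂ UGen.K) 1
  | K_E : URel q (FreeAlgebra.ι ℂ UGen.K * FreeAlgebra.ι ℂ UGen.E)
      (qc q ^ 2 • (FreeAlgebra.ι ℂ UGen.E * FreeAlgebra.ι ℂ UGen.K))
  | K_F : URel q (FreeAlgebra.ι ℂ UGen.K * FreeAlgebra.ι ℂ UGen.F)
      ((qc q ^ 2)⁻¹ • (FreeAlgebra.ι ℂ UGen.F * FreeAlgebra.ι ℂ UGen.K))
  | E_F : URel q (FreeAlgebra.ι ℂ UGen.E * FreeAlgebra.ι ℂ UGen.F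
        - FreeAlgebra.ι ℂ UGen.F * FreeAlgebra.ι ℂ UGen.E)
      ((qc q - (qc q)⁻¹)⁻¹ • (FreeAlgebra.ι ℂ UGen.K - FreeAlgebra.ι ℂ UGen.Ki))

/-- The algebra `U_q(su(2))`. -/
abbrev Uq (q : Param) : Type := RingQuot (URel q)

namespace Uq

variable (q : Param)

/-- The generator `K`. -/
def K : Uq q := gen (URel q) UGen.K
/-- The generator `K⁻¹`. -/
def Ki : Uq q := gen (URel q) UGen.Ki
/-- The generator `E`. -/
def E : Uq q := gen (URel q) UGen.E
/-- The generator `F`. -/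
def F : Uq q := gen (URel q) UGen.F

theorem K_Ki : K q * Ki q = 1 := by
  simpa [K, Ki, E, F, gen] using RingQuot.mkAlgHom_rel ℂ (URel.K_Ki (q := q))
theorem Ki_K : Ki q * K q = 1 := by
  simpa [K, Ki, E, F, gen] using RingQuot.mkAlgHom_rel ℂ (URel.Ki_K (q := q))
theorem K_E : K q * E q = qc q ^ 2 • (E q * K q) := by
  simpa [K, Ki, E, F, gen] using RingQuot.mkAlgHom_rel ℂ (URel.K_E (q := q))
theorem K_F : K q * F q = (qc q ^ 2)⁻¹ • (F q * K q) := by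
  simpa [K, Ki, E, F, gen] using RingQuot.mkAlgHom_rel ℂ (URel.K_F (q := q))
theorem E_F : E q * F q - F q * E q = (qc q - (qc q)⁻¹)⁻¹ • (K q - Ki q) := by
  simpa [K, Ki, E, F, gen] using RingQuot.mkAlgHom_rel ℂ (URel.E_F (q := q))

theorem Ki_E : Ki q * E q = (qc q ^ 2)⁻¹ • (E q * Ki q) := by
  have h0 := qc_ne q
  calc Ki q * E q = Ki q * (E q * K q) * Ki q := by
        rw [mul_assoc, mul_assoc, K_Ki, mul_one]
    _ = (qc q ^ 2)⁻¹ • (Ki q * (K q * E q) * Ki q) := by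
        rw [K_E, mul_smul_comm, smul_mul_assoc, smul_smul, inv_mul_cancel₀ (pow_ne_zero 2 h0),
          one_smul]
    _ = _ := by rw [← mul_assoc, Ki_K, one_mul]

theorem Ki_F : Ki q * F q = qc q ^ 2 • (F q * Ki q) := by
  have h0 := qc_ne q
  calc Ki q * F q = Ki q * (F q * K q) * Ki q := by
        rw [mul_assoc, mul_assoc, K_Ki, mul_one]
    _ = (qc q ^ 2) • (Ki q * (K q * F q) * Ki q) := by
        rw [K_F, mul_smul_comm, smul_mul_assoc, smul_smul, mul_inv_cancel₀ (pow_ne_zero 2 h0),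
          one_smul]
    _ = _ := by rw [← mul_assoc, Ki_K, one_mul]

variable {q}

theorem induction {P : Uq q → Prop}
    (hc : ∀ c : ℂ, P (algebraMap ℂ _ c)) (hK : P (K q)) (hKi : P (Ki q)) (hE : P (E q))
    (hF : P (F q)) (ha : ∀ y z, P y → P z → P (y + z)) (hm : ∀ y z, P y → P z → P (y * z))
    (y : Uq q) : P y :=
  presented_induction (r := URel q) hc (fun x => by cases x <;> assumption) ha hm y

section Lift

variable {T : Type} [Ring T] [Algebra ℂ T]

/-- The universal property of `U_q(su(2))`. -/
def lift (k ki e f : T) (h₁ : k * ki = 1) (h₂ : ki * k = 1)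
    (h₃ : k * e = qc q ^ 2 • (e * k)) (h₄ : k * f = (qc q ^ 2)⁻¹ • (f * k))
    (h₅ : e * f - f * e = (qc q - (qc q)⁻¹)⁻¹ • (k - ki)) : Uq q →ₐ[ℂ] T :=
  presentedLift (fun x => match x with
    | UGen.K => k
    | UGen.Ki => ki
    | UGen.E => e
    | UGen.F => f) (by
    intro x y h
    cases h <;> simpa)

variable (k ki e f : T) (h₁ : k * ki = 1) (h₂ : ki * k = 1)
    (h₃ : k * e = qc q ^ 2 • (e * k)) (h₄ : k * f = (qc q ^ 2)⁻¹ • (f * k))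
    (h₅ : e * f - f * e = (qc q - (qc q)⁻¹)⁻¹ • (k - ki))

@[simp] theorem lift_K : lift k ki e f h₁ h₂ h₃ h₄ h₅ (K q) = k := presentedLift_gen _ _ _
@[simp] theorem lift_Ki : lift k ki e f h₁ h₂ h₃ h₄ h₅ (Ki q) = ki := presentedLift_gen _ _ _
@[simp] theorem lift_E : lift k ki e f h₁ h₂ h₃ h₄ h₅ (E q) = e := presentedLift_gen _ _ _
@[simp] theorem lift_F : lift k ki e f h₁ h₂ h₃ h₄ h₅ (F q) = f := presentedLift_gen _ _ _

theorem algHom_ext {S : Type} [Semiring S] [Algebra ℂ S] {f g : Uq q →ₐ[ℂ] S}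
    (hK : f (K q) = g (K q)) (hKi : f (Ki q) = g (Ki q)) (hE : f (E q) = g (E q))
    (hF : f (F q) = g (F q)) : f = g :=
  presented_ext fun x => by cases x <;> assumption

end Lift

section Star

/-- The adjoints of the generators: `K^* = K`, `E^* = FK`, `F^* = K⁻¹E`. -/
def starGen (q : Param) : UGen → Uq q
  | UGen.K => K q
  | UGen.Ki => Ki q
  | UGen.E => F q * K q
  | UGen.F => Ki q * E q

theorem star_rel : ∀ ⦃x y⦄, URel q x y → conjAnti (starGen q) x = conjAnti (starGen q) y := by
  have h0 := qc_ne q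
  have h2 : qc q ^ 2 ≠ 0 := pow_ne_zero 2 h0
  intro x y h
  cases h <;>
    simp only [conjAnti_mul, conjAnti_sub, conjAnti_smul, conjAnti_one, conjAnti_ι, starGen,
      map_inv₀, map_pow, map_sub, conj_qc]
  · exact Ki_K q
  · exact K_Ki q
  · rw [← mul_assoc, K_F, smul_mul_assoc, smul_smul, mul_inv_cancel₀ h2, one_smul]
  · rw [← mul_assoc, K_Ki, one_mul, Ki_E, smul_mul_assoc, mul_assoc, Ki_K, mul_one]
  · have e1 : Ki q * E q * (F q * K q) = E q * F q := by
      rw [Ki_E, smul_mul_assoc, mul_assoc, ← mul_assoc (Ki q), Ki_F, smul_mul_assoc, mul_assoc,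
        Ki_K, mul_one, mul_smul_comm, smul_smul, inv_mul_cancel₀ h2, one_smul]
    have e2 : F q * K q * (Ki q * E q) = F q * E q := by
      rw [mul_assoc, ← mul_assoc (K q), K_Ki, one_mul]
    rw [e1, e2, E_F]

theorem star_inv (x : UGen) :
    presentedStar _ (star_rel (q := q)) (starGen q x) = gen (URel q) x := by
  have e : ∀ x, presentedStar _ (star_rel (q := q)) (gen (URel q) x) = starGen q x :=
    fun x => presentedStar_gen _ (star_rel (q := q)) x
  cases x
  · exact e _
  · exact e _
  · change presentedStar _ (star_rel (q := q)) (gen (URel q) UGen.F * gen (URel q) UGen.K) = E q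
    rw [presentedStar_mul, e, e]
    simp only [starGen]
    rw [← mul_assoc, K_Ki, one_mul]
  · change presentedStar _ (star_rel (q := q)) (gen (URel q) UGen.Ki * gen (URel q) UGen.E) = F q
    rw [presentedStar_mul, e, e]
    simp only [starGen]
    rw [mul_assoc, K_Ki, mul_one]

/-- The star structure of `U_q(su(2))`. -/
instance : StarRing (Uq q) := starRingOfGen _ star_rel star_inv

instance : StarModule ℂ (Uq q) := ⟨presentedStar_smul _ star_rel⟩

theorem star_K : star (K q) = K q := presentedStar_gen _ (star_rel (q := q)) UGen.K
theorem star_Ki : star (Ki q) = Ki q := presentedStar_gen _ (star_rel (q := q)) UGen.Ki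
theorem star_E : star (E q) = F q * K q := presentedStar_gen _ (star_rel (q := q)) UGen.E
theorem star_F : star (F q) = Ki q * E q := presentedStar_gen _ (star_rel (q := q)) UGen.F

end Star

section Coalgebra

theorem comul_rel_E_F :
    (E q ⊗ₜ[ℂ] (1 : Uq q) + K q ⊗ₜ[ℂ] E q) * (F q ⊗ₜ[ℂ] Ki q + (1 : Uq q) ⊗ₜ[ℂ] F q) -
      (F q ⊗ₜ[ℂ] Ki q + (1 : Uq q) ⊗ₜ[ℂ] F q) * (E q ⊗ₜ[ℂ] (1 : Uq q) + K q ⊗ₜ[ℂ] E q) =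
      (qc q - (qc q)⁻¹)⁻¹ • (K q ⊗ₜ[ℂ] K q - Ki q ⊗ₜ[ℂ] Ki q) := by
  have h0 : qc q ^ 2 ≠ 0 := pow_ne_zero 2 (qc_ne q)
  have h1 : (K q * F q) ⊗ₜ[ℂ] (E q * Ki q) = (F q * K q) ⊗ₜ[ℂ] (Ki q * E q) := by
    rw [K_F, Ki_E, TensorProduct.smul_tmul]
  have h2 : E q * F q = F q * E q + (qc q - (qc q)⁻¹)⁻¹ • (K q - Ki q) := by
    rw [← E_F]; abel
  simp only [mul_add, add_mul, Algebra.TensorProduct.tmul_mul_tmul, mul_one, one_mul, h1, h2,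
    TensorProduct.tmul_add, TensorProduct.add_tmul, smul_sub, TensorProduct.tmul_sub,
    TensorProduct.sub_tmul, TensorProduct.tmul_smul, ← TensorProduct.smul_tmul']
  abel

/-- The comultiplication of `U_q(su(2))`:
`Δ K = K ⊗ K`, `Δ E = E ⊗ 1 + K ⊗ E`, `Δ F = F ⊗ K⁻¹ + 1 ⊗ F`. -/
def comulHom (q : Param) : Uq q →ₐ[ℂ] Uq q ⊗[ℂ] Uq q :=
  lift (K q ⊗ₜ[ℂ] K q) (Ki q ⊗ₜ[ℂ] Ki q) (E q ⊗ₜ[ℂ] 1 + K q ⊗ₜ[ℂ] E q)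
    (F q ⊗ₜ[ℂ] Ki q + 1 ⊗ₜ[ℂ] F q)
    (by simp [K_Ki, Algebra.TensorProduct.one_def])
    (by simp [Ki_K, Algebra.TensorProduct.one_def])
    (by simp [mul_add, add_mul, K_E, TensorProduct.smul_tmul'])
    (by simp [mul_add, add_mul, K_F, K_Ki, Ki_K, TensorProduct.smul_tmul'])
    comul_rel_E_F

/-- The counit of `U_q(su(2))`. -/
def counitHom (q : Param) : Uq q →ₐ[ℂ] ℂ :=
  lift 1 1 0 0 (by simp) (by simp) (by simp) (by simp) (by simp)

/-- The bialgebra structure of `U_q(su(2))`. -/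
instance : Bialgebra ℂ (Uq q) :=
  Bialgebra.ofAlgHom (comulHom q) (counitHom q)
    (by
      apply algHom_ext <;> simp [comulHom, TensorProduct.tmul_add, TensorProduct.add_tmul,
        Algebra.TensorProduct.one_def, add_assoc])
    (by apply algHom_ext <;> simp [comulHom, counitHom])
    (by apply algHom_ext <;> simp [comulHom, counitHom])

theorem comul_K : Coalgebra.comul (R := ℂ) (K q) = K q ⊗ₜ[ℂ] K q := lift_K ..
theorem comul_Ki : Coalgebra.comul (R := ℂ) (Ki q) = Ki q ⊗ₜ[ℂ] Ki q := lift_Ki ..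
theorem comul_E : Coalgebra.comul (R := ℂ) (E q) = E q ⊗ₜ[ℂ] 1 + K q ⊗ₜ[ℂ] E q := lift_E ..
theorem comul_F : Coalgebra.comul (R := ℂ) (F q) = F q ⊗ₜ[ℂ] Ki q + 1 ⊗ₜ[ℂ] F q := lift_F ..
theorem counit_K : Coalgebra.counit (R := ℂ) (K q) = 1 := lift_K ..
theorem counit_Ki : Coalgebra.counit (R := ℂ) (Ki q) = 1 := lift_Ki ..
theorem counit_E : Coalgebra.counit (R := ℂ) (E q) = 0 := lift_E ..
theorem counit_F : Coalgebra.counit (R := ℂ) (F q) = 0 := lift_F ..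

end Coalgebra

section Spin

/-- The spin one-half representation of `U_q(su(2))`. -/
def spin (q : Param) : Uq q →ₐ[ℂ] Matrix (Fin 2) (Fin 2) ℂ :=
  lift !![qc q, 0; 0, (qc q)⁻¹] !![(qc q)⁻¹, 0; 0, qc q] !![0, qh q; 0, 0] !![0, 0; (qh q)⁻¹, 0]
    (by
      have h0 := qc_ne q
      ext i j; fin_cases i <;> fin_cases j <;> simp [h0])
    (by
      have h0 := qc_ne q
      ext i j; fin_cases i <;> fin_cases j <;> simp [h0])
    (by
      have h0 := qc_ne q
      ext i j; fin_cases i <;> fin_cases j <;> simp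
      field_simp)
    (by
      have h0 := qc_ne q
      have h1 := qh_ne q
      ext i j; fin_cases i <;> fin_cases j <;> simp
      field_simp)
    (by
      have h1 := qh_ne q
      have h2 := qc_sub_ne q
      ext i j; fin_cases i <;> fin_cases j <;> simp [h1]
      · rw [inv_mul_cancel₀ h2]
      · rw [← neg_sub (qc q), mul_neg, inv_mul_cancel₀ h2])

end Spin

end Uq

/-! ### The pairing of `O_q(SU(2))` and `U_q(su(2))` -/

section Pairing

variable {q : Param}

/-- The two-fold tensor product of the spin one-half representation, before composing with the
comultiplication. -/
def spinTwo (q : Param) : Uq q ⊗[ℂ] Uq q →ₐ[ℂ] Matrix (Fin 2 × Fin 2) (Fin 2 × Fin 2) ℂ :=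
  (Matrix.kroneckerAlgEquiv (Fin 2) (Fin 2) ℂ).toAlgHom.comp
    (Algebra.TensorProduct.map (Uq.spin q) (Uq.spin q))

theorem spinTwo_tmul (x y : Uq q) (i j k l : Fin 2) :
    spinTwo q (x ⊗ₜ y) (i, k) (j, l) = Uq.spin q x i j * Uq.spin q y k l := by
  simp [spinTwo]

/-- The matrix coefficients of the spin one-half representation, as elements of the convolution
algebra of functionals on `U_q(su(2))`. -/
def spinCoeff (q : Param) : Matrix (Fin 2) (Fin 2) (WithConv (Uq q →ₗ[ℂ] ℂ)) :=
  Matrix.of fun i j => WithConv.toConv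
    ((Matrix.entryLinearMap ℂ ℂ i j).comp (Uq.spin q).toLinearMap)

theorem spinCoeff_apply (i j : Fin 2) (x : Uq q) : spinCoeff q i j x = Uq.spin q x i j := rfl

theorem spinCoeff_mul (i j k l : Fin 2) (x : Uq q) :
    (spinCoeff q i j * spinCoeff q k l) x =
      spinTwo q (Coalgebra.comul (R := ℂ) x) (i, k) (j, l) := by
  rw [LinearMap.convMul_apply]
  induction Coalgebra.comul (R := ℂ) x using TensorProduct.induction_on with
  | zero => simp
  | tmul y z =>
    rw [spinTwo_tmul]
    rfl
  | add y z hy hz => simp only [map_add, hy, hz, Matrix.add_apply]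

/-- The quantum determinant vector. -/
def detVec (q : Param) : Fin 2 × Fin 2 → ℂ
  | (0, 1) => 1
  | (1, 0) => -qc q
  | _ => 0

/-- The quantum determinant covector. -/
def detCovec (q : Param) : Fin 2 × Fin 2 → ℂ
  | (1, 0) => 1
  | (0, 1) => -(qc q)⁻¹
  | _ => 0

theorem spinTwo_detVec (x : Uq q) :
    (spinTwo q (Coalgebra.comul (R := ℂ) x)).mulVec (detVec q) =
      Coalgebra.counit (R := ℂ) x • detVec q := by
  have h0 := qc_ne q
  have h1 := qh_ne q
  have h2 := qh_sq q
  induction x using Uq.induction with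
  | hc c => simp [Algebra.algebraMap_eq_smul_one, Matrix.smul_mulVec]
  | ha y z hy hz => simp [Matrix.add_mulVec, hy, hz, add_smul]
  | hm y z hy hz =>
    rw [Bialgebra.comul_mul, map_mul, ← Matrix.mulVec_mulVec, hz, Matrix.mulVec_smul, hy,
      Bialgebra.counit_mul, smul_smul, mul_comm]
  | hK =>
    rw [Uq.comul_K, Uq.counit_K]
    ext ⟨i, j⟩
    fin_cases i <;> fin_cases j <;>
      simp [Matrix.mulVec, dotProduct, Fintype.sum_prod_type, Fin.sum_univ_two, spinTwo_tmul,
        Uq.spin, detVec, h0]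
  | hKi =>
    rw [Uq.comul_Ki, Uq.counit_Ki]
    ext ⟨i, j⟩
    fin_cases i <;> fin_cases j <;>
      simp [Matrix.mulVec, dotProduct, Fintype.sum_prod_type, Fin.sum_univ_two, spinTwo_tmul,
        Uq.spin, detVec, h0]
  | hE =>
    rw [Uq.comul_E, Uq.counit_E]
    ext ⟨i, j⟩
    fin_cases i <;> fin_cases j <;>
      simp [Matrix.mulVec, dotProduct, Fintype.sum_prod_type, Fin.sum_univ_two, spinTwo_tmul,
        Uq.spin, detVec, h0]
    ring
  | hF =>
    rw [Uq.comul_F, Uq.counit_F]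
    ext ⟨i, j⟩
    fin_cases i <;> fin_cases j <;>
      simp [Matrix.mulVec, dotProduct, Fintype.sum_prod_type, Fin.sum_univ_two, spinTwo_tmul,
        Uq.spin, detVec, h0]

theorem spinTwo_detCovec (x : Uq q) :
    Matrix.vecMul (detCovec q) (spinTwo q (Coalgebra.comul (R := ℂ) x)) =
      Coalgebra.counit (R := ℂ) x • detCovec q := by
  have h0 := qc_ne q
  have h1 := qh_ne q
  have h2 := qh_sq q
  induction x using Uq.induction with
  | hc c => simp [Algebra.algebraMap_eq_smul_one, Matrix.vecMul_smul]
  | ha y z hy hz => simp [Matrix.vecMul_add, hy, hz, add_smul]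
  | hm y z hy hz =>
    rw [Bialgebra.comul_mul, map_mul, ← Matrix.vecMul_vecMul, hy, Matrix.smul_vecMul, hz,
      Bialgebra.counit_mul, smul_smul]
  | hK =>
    rw [Uq.comul_K, Uq.counit_K]
    ext ⟨i, j⟩
    fin_cases i <;> fin_cases j <;>
      simp [Matrix.vecMul, dotProduct, Fintype.sum_prod_type, Fin.sum_univ_two, spinTwo_tmul,
        Uq.spin, detCovec, h0]
  | hKi =>
    rw [Uq.comul_Ki, Uq.counit_Ki]
    ext ⟨i, j⟩
    fin_cases i <;> fin_cases j <;>
      simp [Matrix.vecMul, dotProduct, Fintype.sum_prod_type, Fin.sum_univ_two, spinTwo_tmul,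
        Uq.spin, detCovec, h0]
  | hE =>
    rw [Uq.comul_E, Uq.counit_E]
    ext ⟨i, j⟩
    fin_cases i <;> fin_cases j <;>
      simp [Matrix.vecMul, dotProduct, Fintype.sum_prod_type, Fin.sum_univ_two, spinTwo_tmul,
        Uq.spin, detCovec, h0]
  | hF =>
    rw [Uq.comul_F, Uq.counit_F]
    ext ⟨i, j⟩
    fin_cases i <;> fin_cases j <;>
      simp [Matrix.vecMul, dotProduct, Fintype.sum_prod_type, Fin.sum_univ_two, spinTwo_tmul,
        Uq.spin, detCovec, h0]
    ring

theorem conv_mul_neg_smul (c : ℂ) (f g : WithConv (Uq q →ₗ[ℂ] ℂ)) (x : Uq q) :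
    (f * -(c • g)) x = -(c * (f * g) x) := by
  have : (-(c • g)).ofConv = (-c) • g.ofConv := by ext y; simp
  rw [LinearMap.convMul_apply, LinearMap.convMul_apply, this, TensorProduct.map_smul_right]
  simp

theorem conv_neg_smul_mul (c : ℂ) (f g : WithConv (Uq q →ₗ[ℂ] ℂ)) (x : Uq q) :
    (-(c • f) * g) x = -(c * (f * g) x) := by
  have : (-(c • f)).ofConv = (-c) • f.ofConv := by ext y; simp
  rw [LinearMap.convMul_apply, LinearMap.convMul_apply, this, TensorProduct.map_smul_left]
  simp

theorem spinCoeff_mul_adj : spinCoeff q * qadj q (spinCoeff q) = 1 := by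
  have h0 := qc_ne q
  have h : ∀ (x : Uq q) i j, spinTwo q (Coalgebra.comul (R := ℂ) x) (i, j) (0, 1)
      - qc q * spinTwo q (Coalgebra.comul (R := ℂ) x) (i, j) (1, 0) =
      Coalgebra.counit (R := ℂ) x * detVec q (i, j) := fun x i j => by
    have := congrFun (spinTwo_detVec x) (i, j)
    rw [Pi.smul_apply, smul_eq_mul] at this
    rw [← this]
    simp [Matrix.mulVec, dotProduct, Fintype.sum_prod_type, Fin.sum_univ_two, detVec]
    ring
  ext i j x
  rw [Matrix.mul_apply, Fin.sum_univ_two]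
  fin_cases i <;> fin_cases j
  · change (spinCoeff q 0 0 * spinCoeff q 1 1) x + (spinCoeff q 0 1 * -(qc q • spinCoeff q 1 0)) x
      = Coalgebra.counit (R := ℂ) x
    rw [conv_mul_neg_smul, spinCoeff_mul, spinCoeff_mul]
    have := h x 0 1
    simp only [detVec, mul_one] at this
    linear_combination this
  · change (spinCoeff q 0 0 * -((qc q)⁻¹ • spinCoeff q 0 1)) x
      + (spinCoeff q 0 1 * spinCoeff q 0 0) x = 0
    rw [conv_mul_neg_smul, spinCoeff_mul, spinCoeff_mul]
    have := h x 0 0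
    simp only [detVec, mul_zero] at this
    field_simp
    linear_combination -this
  · change (spinCoeff q 1 0 * spinCoeff q 1 1) x + (spinCoeff q 1 1 * -(qc q • spinCoeff q 1 0)) x
      = 0
    rw [conv_mul_neg_smul, spinCoeff_mul, spinCoeff_mul]
    have := h x 1 1
    simp only [detVec, mul_zero] at this
    linear_combination this
  · change (spinCoeff q 1 0 * -((qc q)⁻¹ • spinCoeff q 0 1)) x
      + (spinCoeff q 1 1 * spinCoeff q 0 0) x = Coalgebra.counit (R := ℂ) x
    rw [conv_mul_neg_smul, spinCoeff_mul, spinCoeff_mul]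
    have := h x 1 0
    simp only [detVec] at this
    field_simp
    linear_combination -this

theorem adj_mul_spinCoeff : qadj q (spinCoeff q) * spinCoeff q = 1 := by
  have h0 := qc_ne q
  have h : ∀ (x : Uq q) i j, spinTwo q (Coalgebra.comul (R := ℂ) x) (1, 0) (i, j)
      - (qc q)⁻¹ * spinTwo q (Coalgebra.comul (R := ℂ) x) (0, 1) (i, j) =
      Coalgebra.counit (R := ℂ) x * detCovec q (i, j) := fun x i j => by
    have := congrFun (spinTwo_detCovec x) (i, j)
    rw [Pi.smul_apply, smul_eq_mul] at this
    rw [← this]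
    simp [Matrix.vecMul, dotProduct, Fintype.sum_prod_type, Fin.sum_univ_two, detCovec]
    ring
  ext i j x
  rw [Matrix.mul_apply, Fin.sum_univ_two]
  fin_cases i <;> fin_cases j
  · change (spinCoeff q 1 1 * spinCoeff q 0 0) x
      + (-((qc q)⁻¹ • spinCoeff q 0 1) * spinCoeff q 1 0) x = Coalgebra.counit (R := ℂ) x
    rw [conv_neg_smul_mul, spinCoeff_mul, spinCoeff_mul]
    have := h x 1 0
    simp only [detCovec, mul_one] at this
    linear_combination this
  · change (spinCoeff q 1 1 * spinCoeff q 0 1) x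
      + (-((qc q)⁻¹ • spinCoeff q 0 1) * spinCoeff q 1 1) x = 0
    rw [conv_neg_smul_mul, spinCoeff_mul, spinCoeff_mul]
    have := h x 1 1
    simp only [detCovec, mul_zero] at this
    linear_combination this
  · change (-(qc q • spinCoeff q 1 0) * spinCoeff q 0 0) x
      + (spinCoeff q 0 0 * spinCoeff q 1 0) x = 0
    rw [conv_neg_smul_mul, spinCoeff_mul, spinCoeff_mul]
    have := h x 0 0
    simp only [detCovec, mul_zero] at this
    field_simp at this
    linear_combination -this
  · change (-(qc q • spinCoeff q 1 0) * spinCoeff q 0 1) x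
      + (spinCoeff q 0 0 * spinCoeff q 1 1) x = Coalgebra.counit (R := ℂ) x
    rw [conv_neg_smul_mul, spinCoeff_mul, spinCoeff_mul]
    have := h x 0 1
    simp only [detCovec] at this
    field_simp at this
    linear_combination -this

/-- The pairing `τ`, as the homomorphism `f ↦ τ(f, -)` from `O_q(SU(2))` to the convolution algebra
of functionals on `U_q(su(2))`. -/
def pairHom (q : Param) : SUq q →ₐ[ℂ] WithConv (Uq q →ₗ[ℂ] ℂ) :=
  SUq.lift (spinCoeff q) spinCoeff_mul_adj adj_mul_spinCoeff

/-- The pairing `τ : O_q(SU(2)) × U_q(su(2)) → ℂ`, determined by the spin one-half representation. -/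
def pair (q : Param) : SUq q →ₗ[ℂ] Uq q →ₗ[ℂ] ℂ where
  toFun f := (pairHom q f).ofConv
  map_add' f g := by simp
  map_smul' c f := by simp

theorem pair_U (i j : Fin 2) (x : Uq q) : pair q (SUq.U q i j) x = Uq.spin q x i j :=
  congrArg (fun f : WithConv (Uq q →ₗ[ℂ] ℂ) => f.ofConv x)
    (SUq.lift_U (spinCoeff q) spinCoeff_mul_adj adj_mul_spinCoeff i j)

theorem pair_one (x : Uq q) : pair q 1 x = Coalgebra.counit (R := ℂ) x := by
  simp [pair]

/-- `τ(fg, x) = τ(f, x₁) τ(g, x₂)`. -/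
theorem pair_mul (f g : SUq q) (x : Uq q) :
    pair q (f * g) x = LinearMap.mul' ℂ ℂ
      (TensorProduct.map (pair q f) (pair q g) (Coalgebra.comul (R := ℂ) x)) := by
  simp [pair]

theorem pair_mul_repr (f g : SUq q) (x : Uq q) {ι : Type} (R : Coalgebra.Repr ℂ x ι) :
    pair q (f * g) x = ∑ i ∈ R.index, pair q f (R.left i) * pair q g (R.right i) := by
  rw [pair_mul, ← R.eq]
  simp

/-- `τ(f, xy) = τ(f₁, x) τ(f₂, y)`. -/
theorem pair_apply_mul (f : SUq q) (x y : Uq q) :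
    pair q f (x * y) = LinearMap.mul' ℂ ℂ
      (TensorProduct.map ((pair q).flip x) ((pair q).flip y) (Coalgebra.comul (R := ℂ) f)) := by
  induction f using SUq.induction generalizing x y with
  | hc c =>
    rw [Algebra.algebraMap_eq_smul_one]
    simp [pair_one, Algebra.TensorProduct.one_def]
  | hg i j =>
    rw [SUq.comul_U, pair_U, map_mul, Matrix.mul_apply]
    simp [pair_U]
  | ha f g hf hg => simp only [map_add, LinearMap.add_apply, hf, hg]
  | hm f g hf hg =>
    have Rx := Coalgebra.Repr.arbitrary ℂ x
    have Ry := Coalgebra.Repr.arbitrary ℂ y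
    have Rf := Coalgebra.Repr.arbitrary ℂ f
    have Rg := Coalgebra.Repr.arbitrary ℂ g
    rw [pair_mul, Bialgebra.comul_mul, Bialgebra.comul_mul, ← Rx.eq, ← Ry.eq, ← Rf.eq, ← Rg.eq]
    simp only [Finset.sum_mul_sum, Algebra.TensorProduct.tmul_mul_tmul, map_sum,
      TensorProduct.map_tmul, LinearMap.mul'_apply, hf, hg, LinearMap.flip_apply]
    simp only [← Rf.eq, ← Rg.eq, map_sum, TensorProduct.map_tmul, LinearMap.mul'_apply,
      LinearMap.flip_apply, pair_mul_repr _ _ x Rx, pair_mul_repr _ _ y Ry, Finset.sum_mul_sum]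
    have swap : ∀ (φ : Uq q × Uq q → Uq q × Uq q → SUq q × SUq q → SUq q × SUq q → ℂ),
        ∑ i ∈ Rx.index, ∑ j ∈ Ry.index, ∑ k ∈ Rf.index, ∑ l ∈ Rg.index, φ i j k l =
        ∑ k ∈ Rf.index, ∑ l ∈ Rg.index, ∑ i ∈ Rx.index, ∑ j ∈ Ry.index, φ i j k l := by
      intro φ
      have h1 := Finset.sum_comm (s := Rx.index ×ˢ Ry.index) (t := Rf.index ×ˢ Rg.index)
        (f := fun a b => φ a.1 a.2 b.1 b.2)
      simpa only [Finset.sum_product] using h1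
    rw [swap]
    refine Finset.sum_congr rfl fun k _ => Finset.sum_congr rfl fun l _ => Finset.sum_congr rfl
      fun i _ => Finset.sum_congr rfl fun j _ => by ring

/-- `τ(f, 1) = ε(f)`. -/
theorem pair_right_one (f : SUq q) : pair q f 1 = Coalgebra.counit (R := ℂ) f := by
  induction f using SUq.induction with
  | hc c =>
    rw [Algebra.algebraMap_eq_smul_one]
    simp [pair_one]
  | hg i j => rw [pair_U, map_one, SUq.counit_U]
  | ha f g hf hg => simp only [map_add, LinearMap.add_apply, hf, hg]
  | hm f g hf hg => simp [pair_mul, hf, hg, Algebra.TensorProduct.one_def]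

end Pairing

/-! ### The Podleś sphere `O_q(S_t²)` -/

/-- The generators of the Podleś sphere. -/
inductive PGen : Type
  | X | Y | Z

open FreeAlgebra in
/-- The defining relations of the Podleś sphere. -/
inductive PRel (q : Param) (a : ℝ) : FreeAlgebra ℂ PGen → FreeAlgebra ℂ PGen → Prop
  | XZ : PRel q a (ι ℂ PGen.X * ι ℂ PGen.Z) (qc q ^ 2 • (ι ℂ PGen.Z * ι ℂ PGen.X))
  | YZ : PRel q a (ι ℂ PGen.Y * ι ℂ PGen.Z) ((qc q)⁻¹ ^ 2 • (ι ℂ PGen.Z * ι ℂ PGen.Y))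
  | XY : PRel q a (ι ℂ PGen.X * ι ℂ PGen.Y)
      (1 - (qc q * tc q a) • ι ℂ PGen.Z - qc q ^ 2 • (ι ℂ PGen.Z * ι ℂ PGen.Z))
  | YX : PRel q a (ι ℂ PGen.Y * ι ℂ PGen.X)
      (1 - ((qc q)⁻¹ * tc q a) • ι ℂ PGen.Z - (qc q)⁻¹ ^ 2 • (ι ℂ PGen.Z * ι ℂ PGen.Z))

/-- The algebra `O_q(S_t²)` where `t = q ^ a - q ^ (-a)`. -/
abbrev Podles (q : Param) (a : ℝ) : Type := RingQuot (PRel q a)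

namespace Podles

/-- The generator `X_t`. -/
def X (q : Param) (a : ℝ) : Podles q a := gen (PRel q a) PGen.X
/-- The generator `Y_t`. -/
def Y (q : Param) (a : ℝ) : Podles q a := gen (PRel q a) PGen.Y
/-- The generator `Z_t`. -/
def Z (q : Param) (a : ℝ) : Podles q a := gen (PRel q a) PGen.Z

section Rel
variable (q : Param) (a : ℝ)

theorem X_mul_Z : X q a * Z q a = qc q ^ 2 • (Z q a * X q a) := by
  simpa [X, Z, gen] using RingQuot.mkAlgHom_rel ℂ (PRel.XZ (q := q) (a := a))

theorem Y_mul_Z : Y q a * Z q a = (qc q)⁻¹ ^ 2 • (Z q a * Y q a) := by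
  simpa [Y, Z, gen] using RingQuot.mkAlgHom_rel ℂ (PRel.YZ (q := q) (a := a))

theorem X_mul_Y : X q a * Y q a =
    1 - (qc q * tc q a) • Z q a - qc q ^ 2 • (Z q a * Z q a) := by
  simpa [X, Y, Z, gen] using RingQuot.mkAlgHom_rel ℂ (PRel.XY (q := q) (a := a))

theorem Y_mul_X : Y q a * X q a =
    1 - ((qc q)⁻¹ * tc q a) • Z q a - (qc q)⁻¹ ^ 2 • (Z q a * Z q a) := by
  simpa [X, Y, Z, gen] using RingQuot.mkAlgHom_rel ℂ (PRel.YX (q := q) (a := a))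

end Rel

variable {q : Param} {a : ℝ}

theorem induction {P : Podles q a → Prop} (hc : ∀ c : ℂ, P (algebraMap ℂ _ c))
    (hX : P (X q a)) (hY : P (Y q a)) (hZ : P (Z q a))
    (ha : ∀ y z, P y → P z → P (y + z)) (hm : ∀ y z, P y → P z → P (y * z))
    (y : Podles q a) : P y :=
  presented_induction (r := PRel q a) hc (fun x => by cases x <;> assumption) ha hm y

section Lift

variable {T : Type} [Ring T] [Algebra ℂ T]

/-- The universal property of the Podleś sphere. -/
def lift (x y z : T) (h₁ : x * z = qc q ^ 2 • (z * x)) (h₂ : y * z = (qc q)⁻¹ ^ 2 • (z * y))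
    (h₃ : x * y = 1 - (qc q * tc q a) • z - qc q ^ 2 • (z * z))
    (h₄ : y * x = 1 - ((qc q)⁻¹ * tc q a) • z - (qc q)⁻¹ ^ 2 • (z * z)) :
    Podles q a →ₐ[ℂ] T :=
  presentedLift (PGen.rec x y z) (by
    intro u v h
    induction h with
    | XZ => simpa using h₁
    | YZ => simpa using h₂
    | XY => simpa using h₃
    | YX => simpa using h₄)

section
variable (x y z : T) (h₁ : x * z = qc q ^ 2 • (z * x)) (h₂ : y * z = (qc q)⁻¹ ^ 2 • (z * y))
    (h₃ : x * y = 1 - (qc q * tc q a) • z - qc q ^ 2 • (z * z))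
    (h₄ : y * x = 1 - ((qc q)⁻¹ * tc q a) • z - (qc q)⁻¹ ^ 2 • (z * z))

@[simp] theorem lift_X : lift x y z h₁ h₂ h₃ h₄ (X q a) = x := presentedLift_gen _ _ _
@[simp] theorem lift_Y : lift x y z h₁ h₂ h₃ h₄ (Y q a) = y := presentedLift_gen _ _ _
@[simp] theorem lift_Z : lift x y z h₁ h₂ h₃ h₄ (Z q a) = z := presentedLift_gen _ _ _

end

theorem algHom_ext {S : Type} [Semiring S] [Algebra ℂ S] {f g : Podles q a →ₐ[ℂ] S}
    (hX : f (X q a) = g (X q a)) (hY : f (Y q a) = g (Y q a)) (hZ : f (Z q a) = g (Z q a)) :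
    f = g :=
  presented_ext fun x => by cases x <;> assumption

variable (q a) in
/-- The matrix `E_t = (q⁻¹Z, Y; X, -t - qZ)`. -/
def Et : Matrix (Fin 2) (Fin 2) (Podles q a) :=
  !![(qc q)⁻¹ • Z q a, Y q a; X q a, (-tc q a) • 1 - qc q • Z q a]

variable (q a) in
/-- The relations of the Podleś sphere for a matrix: `M² = 1 - tM` and
`q² M₀₀ + M₁₁ = -t`. -/
def MatRel (M : Matrix (Fin 2) (Fin 2) T) : Prop :=
  M * M = 1 - tc q a • M ∧ qc q ^ 2 • M 0 0 + M 1 1 = (-tc q a) • 1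

variable (q a) in
theorem matRel_Et : MatRel q a (Et q a) := by
  have h0 := qc_ne q
  constructor
  · ext i j
    fin_cases i <;> fin_cases j
    all_goals
      simp [Et, Matrix.mul_apply, Fin.sum_univ_two, Y_mul_X, X_mul_Y, X_mul_Z, Y_mul_Z,
        smul_smul, mul_sub, sub_mul]
      match_scalars <;> field_simp <;> ring
  · simp only [Et, Matrix.of_apply, Matrix.cons_val_zero, Matrix.cons_val_one, Matrix.cons_val',
      Matrix.cons_val_fin_one]
    match_scalars <;> field_simp <;> ring

theorem matRel_entry {M : Matrix (Fin 2) (Fin 2) T} (h : MatRel q a M) (i j : Fin 2) :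
    M i 0 * M 0 j + M i 1 * M 1 j = (1 : Matrix (Fin 2) (Fin 2) T) i j - tc q a • M i j := by
  have e := congrFun (congrFun h.1 i) j
  rw [Matrix.mul_apply, Fin.sum_univ_two] at e
  exact e

/-- The universal property of the Podleś sphere in matrix form. -/
def liftMatrix (M : Matrix (Fin 2) (Fin 2) T) (h : MatRel q a M) : Podles q a →ₐ[ℂ] T :=
  lift (M 1 0) (M 0 1) (qc q • M 0 0)
    (by
      have h2 : M 1 1 = (-tc q a) • 1 - qc q ^ 2 • M 0 0 := by rw [← h.2]; abel
      have e : M 1 0 * M 0 0 + M 1 1 * M 1 0 = 0 - tc q a • M 1 0 := matRel_entry h 1 0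
      simp only [h2, mul_sub, sub_mul, mul_smul_comm, smul_mul_assoc, one_mul, mul_one] at e
      simp only [mul_smul_comm, smul_mul_assoc]
      linear_combination (norm := skip) qc q • e
      match_scalars <;> ring)
    (by
      have h0 := qc_ne q
      have h2 : M 1 1 = (-tc q a) • 1 - qc q ^ 2 • M 0 0 := by rw [← h.2]; abel
      have e : M 0 0 * M 0 1 + M 0 1 * M 1 1 = 0 - tc q a • M 0 1 := matRel_entry h 0 1
      simp only [h2, mul_sub, sub_mul, mul_smul_comm, smul_mul_assoc, one_mul, mul_one] at e
      simp only [mul_smul_comm, smul_mul_assoc]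
      linear_combination (norm := skip) (-(qc q)⁻¹) • e
      match_scalars <;> field_simp <;> ring)
    (by
      have h2 : M 1 1 = (-tc q a) • 1 - qc q ^ 2 • M 0 0 := by rw [← h.2]; abel
      have e : M 1 0 * M 0 1 + M 1 1 * M 1 1 = 1 - tc q a • M 1 1 := matRel_entry h 1 1
      simp only [h2, mul_sub, sub_mul, mul_smul_comm, smul_mul_assoc, one_mul, mul_one] at e
      simp only [mul_smul_comm, smul_mul_assoc]
      linear_combination (norm := skip) e
      match_scalars <;> field_simp <;> ring)
    (by
      have h0 := qc_ne q
      have e : M 0 0 * M 0 0 + M 0 1 * M 1 0 = 1 - tc q a • M 0 0 := matRel_entry h 0 0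
      simp only [mul_smul_comm, smul_mul_assoc]
      linear_combination (norm := skip) e
      match_scalars <;> field_simp <;> ring)

theorem liftMatrix_Et (M : Matrix (Fin 2) (Fin 2) T) (h : MatRel q a M) :
    (Et q a).map (liftMatrix M h) = M := by
  have h0 := qc_ne q
  have h2 : M 1 1 = (-tc q a) • 1 - qc q ^ 2 • M 0 0 := by rw [← h.2]; abel
  ext i j
  fin_cases i <;> fin_cases j <;> simp [Et, liftMatrix, smul_smul, h0, h2, sq]

theorem algHom_ext_Et {S : Type} [Semiring S] [Algebra ℂ S] {f g : Podles q a →ₐ[ℂ] S}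
    (h : (Et q a).map f = (Et q a).map g) : f = g := by
  have h0 := qc_ne q
  refine algHom_ext (congrFun (congrFun h 1) 0) (congrFun (congrFun h 0) 1) ?_
  have hZ : Z q a = qc q • Et q a 0 0 := by simp [Et, smul_smul, h0]
  have h00 : f (Et q a 0 0) = g (Et q a 0 0) := congrFun (congrFun h 0) 0
  rw [hZ, map_smul, map_smul, h00]

theorem matRel_map {T' : Type} [Ring T'] [Algebra ℂ T'] (f : T →ₐ[ℂ] T')
    {M : Matrix (Fin 2) (Fin 2) T} (h : MatRel q a M) : MatRel q a (M.map f) := by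
  constructor
  · rw [← matrix_map_mul, h.1]
    ext i j
    fin_cases i <;> fin_cases j <;> simp
  · simpa using congrArg f h.2

theorem matRel_conj {M Q : Matrix (Fin 2) (Fin 2) T} (h : MatRel q a M)
    (hQ : Q * qadj q Q = 1) (hQ' : qadj q Q * Q = 1)
    (hc : ∀ i j k l, M i j * Q k l = Q k l * M i j) :
    MatRel q a (qadj q Q * M * Q) := by
  have h0 := qc_ne q
  constructor
  · calc qadj q Q * M * Q * (qadj q Q * M * Q)
        = qadj q Q * M * (Q * qadj q Q) * M * Q := by simp only [Matrix.mul_assoc]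
      _ = qadj q Q * (M * M) * Q := by rw [hQ, Matrix.mul_one]; simp only [Matrix.mul_assoc]
      _ = 1 - tc q a • (qadj q Q * M * Q) := by
        rw [h.1, Matrix.mul_sub, Matrix.sub_mul, Matrix.mul_one, hQ', Matrix.mul_smul,
          Matrix.smul_mul]
  · have e00 := congrFun (congrFun hQ 0) 0
    have e01 := congrFun (congrFun hQ 0) 1
    have e10 := congrFun (congrFun hQ 1) 0
    have e11 := congrFun (congrFun hQ 1) 1
    simp only [qadj, Matrix.mul_apply, Fin.sum_univ_two] at e00 e01 e10 e11
    simp at e00 e01 e10 e11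
    have h2 : M 1 1 = (-tc q a) • 1 - qc q ^ 2 • M 0 0 := by rw [← h.2]; abel
    have h3 : ∀ i j k l m n, Q i j * M k l * Q m n = M k l * (Q i j * Q m n) := by
      intro i j k l m n
      rw [← hc, mul_assoc]
    have f00 : M 1 1 * (Q 0 0 * Q 1 1 + -(qc q • (Q 0 1 * Q 1 0))) = M 1 1 := by
      rw [e00, mul_one]
    have f01 : M 1 0 * (-((qc q)⁻¹ • (Q 0 0 * Q 0 1)) + Q 0 1 * Q 0 0) = 0 := by
      rw [e01, mul_zero]
    have f10 : M 0 1 * (Q 1 0 * Q 1 1 + -(qc q • (Q 1 1 * Q 1 0))) = 0 := by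
      rw [e10, mul_zero]
    have f11 : M 0 0 * (-((qc q)⁻¹ • (Q 1 0 * Q 0 1)) + Q 1 1 * Q 0 0) = M 0 0 := by
      rw [e11, mul_one]
    simp only [mul_add, mul_neg, mul_smul_comm] at f00 f01 f10 f11
    rw [← h.2]
    simp only [Matrix.mul_apply, Fin.sum_univ_two, add_mul, qadj, Matrix.of_apply,
      Matrix.cons_val_zero, Matrix.cons_val_one, Matrix.cons_val', Matrix.cons_val_fin_one,
      neg_mul, smul_mul_assoc, h3]
    linear_combination (norm := skip) f00 - qc q • f01 - qc q • f10 + qc q ^ 2 • f11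
    match_scalars <;> field_simp <;> ring

end Lift

end Podles

namespace Podles

section Star

variable {q : Param} {a : ℝ}

/-- The adjoints of the generators. -/
def starGen (q : Param) (a : ℝ) : PGen → Podles q a
  | PGen.X => Y q a
  | PGen.Y => X q a
  | PGen.Z => Z q a

theorem star_rel : ∀ ⦃x y⦄, PRel q a x y →
    conjAnti (starGen q a) x = conjAnti (starGen q a) y := by
  have h0 := qc_ne q
  intro x y h
  induction h with
  | XZ =>
    simp only [conjAnti_mul, conjAnti_smul, conjAnti_ι, map_pow, conj_qc]
    change Z q a * Y q a = qc q ^ 2 • (Y q a * Z q a)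
    rw [Y_mul_Z, smul_smul, ← mul_pow, mul_inv_cancel₀ h0, one_pow, one_smul]
  | YZ =>
    simp only [conjAnti_mul, conjAnti_smul, conjAnti_ι, map_pow, map_inv₀, conj_qc]
    change Z q a * X q a = (qc q)⁻¹ ^ 2 • (X q a * Z q a)
    rw [X_mul_Z, smul_smul, ← mul_pow, inv_mul_cancel₀ h0, one_pow, one_smul]
  | XY =>
    simp only [conjAnti_mul, conjAnti_smul, conjAnti_ι, conjAnti_sub, conjAnti_one, map_pow,
      map_mul, conj_qc, conj_tc]
    exact X_mul_Y q a
  | YX =>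
    simp only [conjAnti_mul, conjAnti_smul, conjAnti_ι, conjAnti_sub, conjAnti_one, map_pow,
      map_mul, map_inv₀, conj_qc, conj_tc]
    exact Y_mul_X q a

theorem star_inv (x : PGen) :
    presentedStar _ (star_rel (q := q) (a := a)) (starGen q a x) = gen (PRel q a) x := by
  cases x
  · exact presentedStar_gen _ (star_rel (q := q) (a := a)) PGen.Y
  · exact presentedStar_gen _ (star_rel (q := q) (a := a)) PGen.X
  · exact presentedStar_gen _ (star_rel (q := q) (a := a)) PGen.Z

/-- The star structure of the Podleś sphere: `X^* = Y` and `Z^* = Z`. -/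
instance : StarRing (Podles q a) := starRingOfGen _ star_rel star_inv

instance : StarModule ℂ (Podles q a) := ⟨presentedStar_smul _ star_rel⟩

theorem star_X : star (X q a) = Y q a :=
  presentedStar_gen _ (star_rel (q := q) (a := a)) PGen.X
theorem star_Y : star (Y q a) = X q a :=
  presentedStar_gen _ (star_rel (q := q) (a := a)) PGen.Y
theorem star_Z : star (Z q a) = Z q a :=
  presentedStar_gen _ (star_rel (q := q) (a := a)) PGen.Z

end Star

section Coaction

variable (q : Param) (a : ℝ)

/-- The matrix `L_t = (0, i; -i, -t)`. -/
def Lt : Matrix (Fin 2) (Fin 2) ℂ := !![0, Complex.I; -Complex.I, -tc q a]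

/-- The matrix `L_t` with entries in an algebra. -/
def LtIn (T : Type) [Ring T] [Algebra ℂ T] : Matrix (Fin 2) (Fin 2) T :=
  (Lt q a).map (algebraMap ℂ T)

theorem matRel_Lt : MatRel q a (Lt q a) := by
  constructor
  · ext i j
    fin_cases i <;> fin_cases j <;> simp [Lt, Matrix.mul_apply, Fin.sum_univ_two, mul_comm]
  · simp [Lt]

theorem matRel_LtIn (T : Type) [Ring T] [Algebra ℂ T] : MatRel q a (LtIn q a T) :=
  matRel_map (Algebra.ofId ℂ T) (matRel_Lt q a)

theorem LtIn_comm (T : Type) [Ring T] [Algebra ℂ T] (i j : Fin 2) (x : T) :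
    LtIn q a T i j * x = x * LtIn q a T i j :=
  Algebra.commutes (Lt q a i j) x

theorem LtIn_map {T T' : Type} [Ring T] [Algebra ℂ T] [Ring T'] [Algebra ℂ T'] (f : T →ₐ[ℂ] T') :
    (LtIn q a T).map f = LtIn q a T' := by
  ext i j
  exact f.commutes _

/-- The embedding of the Podleś sphere in `O_q(SU(2))` as the algebra generated by the
entries of `U^* L_t U`. -/
def toSU : Podles q a →ₐ[ℂ] SUq q :=
  liftMatrix (qadj q (SUq.U q) * LtIn q a (SUq q) * SUq.U q)
    (matRel_conj (matRel_LtIn q a (SUq q)) (SUq.U_mul_adj q) (SUq.adj_mul_U q)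
      (fun i j k l => LtIn_comm q a (SUq q) i j (SUq.U q k l)))

theorem toSU_Et : (Et q a).map (toSU q a) = qadj q (SUq.U q) * LtIn q a (SUq q) * SUq.U q :=
  liftMatrix_Et _ _

/-- The right coaction `α` of `O_q(SU(2))` on the Podleś sphere, given by
`E_t ↦ (1 ⊗ U)^* (E_t ⊗ 1) (1 ⊗ U)`. -/
def coact : Podles q a →ₐ[ℂ] Podles q a ⊗[ℂ] SUq q :=
  liftMatrix (qadj q ((SUq.U q).map (inR (Podles q a) (SUq q))) *
      (Et q a).map (inL (Podles q a) (SUq q)) * (SUq.U q).map (inR (Podles q a) (SUq q)))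
    (matRel_conj (matRel_map _ (matRel_Et q a))
      (by rw [qadj_map, ← matrix_map_mul, SUq.U_mul_adj, matrix_map_one])
      (by rw [qadj_map, ← matrix_map_mul, SUq.adj_mul_U, matrix_map_one])
      (fun i j k l => by simp [inL, inR]))

theorem coact_Et : (Et q a).map (coact q a) =
    qadj q ((SUq.U q).map (inR (Podles q a) (SUq q))) *
      (Et q a).map (inL (Podles q a) (SUq q)) * (SUq.U q).map (inR (Podles q a) (SUq q)) :=
  liftMatrix_Et _ _

theorem map_comp {S T R : Type} [Semiring S] [Algebra ℂ S] [Semiring T] [Algebra ℂ T] [Semiring R]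
    [Algebra ℂ R] (f : S →ₐ[ℂ] T) (g : T →ₐ[ℂ] R) (M : Matrix (Fin 2) (Fin 2) S) :
    M.map (g.comp f) = (M.map f).map g := rfl

theorem U_map_comul : (SUq.U q).map (Bialgebra.comulAlgHom ℂ (SUq q)) = SUq.UU q := by
  ext i j
  rw [SUq.UU_apply]
  exact SUq.comul_U i j

theorem U_map_counit : (SUq.U q).map (Bialgebra.counitAlgHom ℂ (SUq q)) = 1 := by
  ext i j
  exact SUq.counit_U i j

/-- The map `α` is the restriction of the comultiplication. -/
theorem comul_toSU (b : Podles q a) : Coalgebra.comul (R := ℂ) (toSU q a b) =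
    Algebra.TensorProduct.map (toSU q a) (AlgHom.id ℂ (SUq q)) (coact q a b) := by
  have : (Bialgebra.comulAlgHom ℂ (SUq q)).comp (toSU q a) =
      (Algebra.TensorProduct.map (toSU q a) (AlgHom.id ℂ (SUq q))).comp (coact q a) := by
    refine algHom_ext_Et ?_
    have e1 : (Algebra.TensorProduct.map (toSU q a) (AlgHom.id ℂ (SUq q))).comp (inL _ _) =
        (inL (SUq q) (SUq q)).comp (toSU q a) := by
      refine AlgHom.ext fun x => ?_
      simp [inL]
    have e2 : (Algebra.TensorProduct.map (toSU q a) (AlgHom.id ℂ (SUq q))).comp (inR _ _) =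
        inR (SUq q) (SUq q) := by
      refine AlgHom.ext fun x => ?_
      simp [inR]
    have e3 : (qadj q (SUq.U q)).map (Bialgebra.comulAlgHom ℂ (SUq q)) = qadj q (SUq.UU q) := by
      rw [← U_map_comul]
      exact (qadj_map (T := SUq q) (T' := SUq q ⊗[ℂ] SUq q) q
        (Bialgebra.comulAlgHom ℂ (SUq q)) (SUq.U q)).symm
    have e4 : (LtIn q a (SUq q)).map (Bialgebra.comulAlgHom ℂ (SUq q)) =
        (LtIn q a (SUq q)).map (inL (SUq q) (SUq q)) :=
      (LtIn_map (T := SUq q) (T' := SUq q ⊗[ℂ] SUq q) q a (Bialgebra.comulAlgHom ℂ (SUq q))).trans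
        (LtIn_map q a (inL (SUq q) (SUq q))).symm
    rw [map_comp, map_comp, toSU_Et, coact_Et, qadj_map]
    simp only [matrix_map_mul, e3, e4, U_map_comul]
    simp only [← map_comp, e1, e2, SUq.qadj_UU]
    rw [map_comp, toSU_Et]
    simp only [matrix_map_mul, SUq.UU, Matrix.mul_assoc]
  exact DFunLike.congr_fun this b

theorem coact_Et_apply (i j : Fin 2) : coact q a (Et q a i j) =
    ∑ k, ∑ l, Et q a k l ⊗ₜ[ℂ] (qadj q (SUq.U q) i k * SUq.U q l j) := by
  have := congrFun (congrFun (coact_Et q a) i) j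
  rw [Matrix.map_apply, qadj_map] at this
  rw [this]
  simp only [Matrix.mul_apply, Matrix.map_apply, Fin.sum_univ_two, inL, inR, add_mul,
    Algebra.TensorProduct.includeLeft_apply, Algebra.TensorProduct.includeRight_apply,
    Algebra.TensorProduct.tmul_mul_tmul, one_mul, mul_one]
  abel

theorem comul_qadj_U (i j : Fin 2) : Coalgebra.comul (R := ℂ) (qadj q (SUq.U q) i j) =
    ∑ k, qadj q (SUq.U q) k j ⊗ₜ[ℂ] qadj q (SUq.U q) i k := by
  have e3 : (qadj q (SUq.U q)).map (Bialgebra.comulAlgHom ℂ (SUq q)) = qadj q (SUq.UU q) := by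
    rw [← U_map_comul]
    exact (qadj_map (T := SUq q) (T' := SUq q ⊗[ℂ] SUq q) q
      (Bialgebra.comulAlgHom ℂ (SUq q)) (SUq.U q)).symm
  have := congrFun (congrFun e3 i) j
  rw [SUq.qadj_UU] at this
  refine this.trans ?_
  simp [Matrix.mul_apply, inL, inR]

theorem coact_coassoc (b : Podles q a) :
    Algebra.TensorProduct.assoc ℂ ℂ ℂ _ _ _
      (Algebra.TensorProduct.map (coact q a) (AlgHom.id ℂ (SUq q)) (coact q a b)) =
    Algebra.TensorProduct.map (AlgHom.id ℂ (Podles q a)) (Bialgebra.comulAlgHom ℂ (SUq q))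
      (coact q a b) := by
  have : ((Algebra.TensorProduct.assoc ℂ ℂ ℂ _ _ _).toAlgHom.comp
      (Algebra.TensorProduct.map (coact q a) (AlgHom.id ℂ (SUq q)))).comp (coact q a) =
      (Algebra.TensorProduct.map (AlgHom.id ℂ (Podles q a))
        (Bialgebra.comulAlgHom ℂ (SUq q))).comp (coact q a) := by
    refine algHom_ext_Et ?_
    ext i j
    change Algebra.TensorProduct.assoc ℂ ℂ ℂ _ _ _ (Algebra.TensorProduct.map (coact q a)
      (AlgHom.id ℂ (SUq q)) (coact q a (Et q a i j))) = Algebra.TensorProduct.map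
      (AlgHom.id ℂ (Podles q a)) (Bialgebra.comulAlgHom ℂ (SUq q)) (coact q a (Et q a i j))
    simp only [coact_Et_apply, map_sum, Algebra.TensorProduct.map_tmul, TensorProduct.sum_tmul,
      Algebra.TensorProduct.assoc_tmul, AlgHom.id_apply, map_mul, Bialgebra.comulAlgHom_apply,
      comul_qadj_U, SUq.comul_U, Finset.sum_mul_sum, Algebra.TensorProduct.tmul_mul_tmul,
      TensorProduct.tmul_sum]
    simp only [Fin.sum_univ_two]
    abel
  exact DFunLike.congr_fun this b

theorem coact_counit (b : Podles q a) :
    Algebra.TensorProduct.rid ℂ ℂ _ (Algebra.TensorProduct.map (AlgHom.id ℂ (Podles q a))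
      (Bialgebra.counitAlgHom ℂ (SUq q)) (coact q a b)) = b := by
  have : ((Algebra.TensorProduct.rid ℂ ℂ _).toAlgHom.comp
      (Algebra.TensorProduct.map (AlgHom.id ℂ (Podles q a))
        (Bialgebra.counitAlgHom ℂ (SUq q)))).comp (coact q a) = AlgHom.id ℂ _ := by
    refine algHom_ext_Et ?_
    ext i j
    change Algebra.TensorProduct.rid ℂ ℂ _ (Algebra.TensorProduct.map (AlgHom.id ℂ (Podles q a))
      (Bialgebra.counitAlgHom ℂ (SUq q)) (coact q a (Et q a i j))) = Et q a i j
    have e : ∀ i j, Coalgebra.counit (R := ℂ) (qadj q (SUq.U q) i j) =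
        (1 : Matrix (Fin 2) (Fin 2) ℂ) i j := fun i j => by
      fin_cases i <;> fin_cases j <;> simp [qadj, SUq.counit_U]
    simp only [coact_Et_apply, Fin.sum_univ_two]
    fin_cases i <;> fin_cases j <;> simp [e, SUq.counit_U]
  exact DFunLike.congr_fun this b

end Coaction

section Action

variable (q : Param) (a : ℝ)

/-- The map `b ⊗ f ↦ τ(f, x) b`. -/
def slice (x : Uq q) : Podles q a ⊗[ℂ] SUq q →ₗ[ℂ] Podles q a :=
  (TensorProduct.rid ℂ (Podles q a)).toLinearMap ∘ₗ
    LinearMap.lTensor (Podles q a) ((pair q).flip x)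

theorem slice_tmul (x : Uq q) (b : Podles q a) (f : SUq q) :
    slice q a x (b ⊗ₜ f) = pair q f x • b := by
  simp [slice]

/-- The action `x ▷ b = τ(b₂, x) b₁` of `U_q(su(2))` on the Podleś sphere. -/
def act (x : Uq q) : Podles q a →ₗ[ℂ] Podles q a := slice q a x ∘ₗ (coact q a).toLinearMap

theorem act_apply (x : Uq q) (b : Podles q a) : act q a x b = slice q a x (coact q a b) := rfl

theorem slice_add_left (x y : Uq q) : slice q a (x + y) = slice q a x + slice q a y := by
  simp [slice, LinearMap.lTensor_add, LinearMap.comp_add]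

theorem slice_smul_left (c : ℂ) (x : Uq q) : slice q a (c • x) = c • slice q a x := by
  simp [slice, LinearMap.lTensor_smul, LinearMap.comp_smul]

theorem act_mul_left (x y : Uq q) (b : Podles q a) :
    act q a (x * y) b = act q a x (act q a y b) := by
  let G : (Podles q a ⊗[ℂ] SUq q) ⊗[ℂ] SUq q →ₗ[ℂ] Podles q a :=
    (TensorProduct.rid ℂ (Podles q a)).toLinearMap ∘ₗ
      TensorProduct.map (slice q a x) ((pair q).flip y)
  have hG : ∀ u f, G (u ⊗ₜ f) = pair q f y • slice q a x u := fun u f => by simp [G]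
  have h1 : ∀ w, act q a x (slice q a y w) =
      G (Algebra.TensorProduct.map (coact q a) (AlgHom.id ℂ (SUq q)) w) := fun w => by
    induction w using TensorProduct.induction_on with
    | zero => simp
    | tmul b f => simp [slice_tmul, act_apply, hG]
    | add u v hu hv => simp only [map_add, hu, hv]
  have h2 : ∀ w, slice q a (x * y) w = G ((Algebra.TensorProduct.assoc ℂ ℂ ℂ _ _ _).symm
      (Algebra.TensorProduct.map (AlgHom.id ℂ (Podles q a)) (Bialgebra.comulAlgHom ℂ (SUq q)) w)) :=
      fun w => by
    induction w using TensorProduct.induction_on with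
    | zero => simp
    | tmul b f =>
      simp only [slice_tmul, Algebra.TensorProduct.map_tmul, AlgHom.id_apply,
        Bialgebra.comulAlgHom_apply, pair_apply_mul]
      induction Coalgebra.comul (R := ℂ) f using TensorProduct.induction_on with
      | zero => simp
      | tmul f g => simp [hG, slice_tmul, smul_smul, mul_comm]
      | add u v hu hv => simp only [map_add, TensorProduct.tmul_add, add_smul, hu, hv]
    | add u v hu hv => simp only [map_add, hu, hv]
  rw [act_apply, act_apply q a y, h1, h2, ← coact_coassoc]
  simp

theorem act_one (b : Podles q a) : act q a 1 b = b := by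
  have h : ∀ w, slice q a 1 w = Algebra.TensorProduct.rid ℂ ℂ _ (Algebra.TensorProduct.map
      (AlgHom.id ℂ (Podles q a)) (Bialgebra.counitAlgHom ℂ (SUq q)) w) := fun w => by
    induction w using TensorProduct.induction_on with
    | zero => simp
    | tmul b f => simp [slice_tmul, pair_right_one]
    | add u v hu hv => simp only [map_add, hu, hv]
  rw [act_apply, h, coact_counit]

/-- The action of `U_q(su(2))` on the Podleś sphere, as a representation. -/
def actHom : Uq q →ₐ[ℂ] Module.End ℂ (Podles q a) :=
  AlgHom.ofLinearMap
    { toFun := act q a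
      map_add' := fun x y => by simp [act, slice_add_left, LinearMap.add_comp]
      map_smul' := fun c x => by simp [act, slice_smul_left, LinearMap.smul_comp] }
    (LinearMap.ext fun b => act_one q a b)
    (fun x y => LinearMap.ext fun b => act_mul_left q a x y b)

theorem actHom_apply (x : Uq q) (b : Podles q a) : actHom q a x b = act q a x b := rfl

theorem slice_mul (x : Uq q) (u v : Podles q a ⊗[ℂ] SUq q) {ι : Type} (R : Coalgebra.Repr ℂ x ι) :
    slice q a x (u * v) = ∑ i ∈ R.index, slice q a (R.left i) u * slice q a (R.right i) v := by
  induction u using TensorProduct.induction_on with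
  | zero => simp
  | add u u' hu hu' => simp only [add_mul, map_add, hu, hu', Finset.sum_add_distrib]
  | tmul b f =>
    induction v using TensorProduct.induction_on with
    | zero => simp
    | add u u' hu hu' => simp only [mul_add, map_add, hu, hu', Finset.sum_add_distrib]
    | tmul c g =>
      rw [Algebra.TensorProduct.tmul_mul_tmul, slice_tmul, pair_mul_repr f g x R, Finset.sum_smul]
      refine Finset.sum_congr rfl fun i _ => ?_
      rw [slice_tmul, slice_tmul, smul_mul_smul_comm]

/-- `x ▷ (bc) = (x₁ ▷ b)(x₂ ▷ c)`. -/
theorem act_mul (x : Uq q) (b c : Podles q a) {ι : Type} (R : Coalgebra.Repr ℂ x ι) :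
    act q a x (b * c) = ∑ i ∈ R.index, act q a (R.left i) b * act q a (R.right i) c := by
  simp only [act_apply, map_mul, slice_mul q a x _ _ R]

theorem act_algebra_one (x : Uq q) :
    act q a x 1 = Coalgebra.counit (R := ℂ) x • (1 : Podles q a) := by
  rw [act_apply, map_one, Algebra.TensorProduct.one_def, slice_tmul, pair_one]

theorem act_Et (x : Uq q) (i j : Fin 2) : act q a x (Et q a i j) =
    ∑ k, ∑ l, pair q (qadj q (SUq.U q) i k * SUq.U q l j) x • Et q a k l := by
  simp only [act_apply, coact_Et_apply, map_sum, slice_tmul]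

end Action

end Podles

namespace Podles

section ActionValues

variable {q : Param} {a : ℝ}

theorem mul_neg_add_neg_mul {T : Type} [Ring T] (x y z w : T) :
    x * -y + -z * w = -(z * w + x * y) := by
  noncomm_ring

theorem Z_eq : Z q a = qc q • Et q a 0 0 := by
  simp [Et, smul_smul, qc_ne q]

theorem act_K_Z : act q a (Uq.K q) (Z q a) = Z q a := by
  have h0 := qc_ne q
  rw [Z_eq, map_smul, act_Et]
  simp [Fin.sum_univ_two, pair_mul, Uq.comul_K, qadj, pair_U, Uq.spin, h0]

theorem act_K_Y : act q a (Uq.K q) (Y q a) = (qc q)⁻¹ ^ 2 • Y q a := by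
  have h0 := qc_ne q
  change act q a (Uq.K q) (Et q a 0 1) = _ • Et q a 0 1
  rw [act_Et]
  simp [Fin.sum_univ_two, pair_mul, Uq.comul_K, qadj, pair_U, Uq.spin, h0, sq]

theorem act_K_X : act q a (Uq.K q) (X q a) = qc q ^ 2 • X q a := by
  have h0 := qc_ne q
  change act q a (Uq.K q) (Et q a 1 0) = _ • Et q a 1 0
  rw [act_Et]
  simp [Fin.sum_univ_two, pair_mul, Uq.comul_K, qadj, pair_U, Uq.spin, h0, sq]

theorem act_K_Ki (b : Podles q a) : act q a (Uq.K q) (act q a (Uq.Ki q) b) = b := by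
  rw [← act_mul_left, Uq.K_Ki, act_one]

theorem act_Ki_K (b : Podles q a) : act q a (Uq.Ki q) (act q a (Uq.K q) b) = b := by
  rw [← act_mul_left, Uq.Ki_K, act_one]

theorem act_E_Z : act q a (Uq.E q) (Z q a) = -(qh q • X q a) := by
  have h0 := qc_ne q
  rw [Z_eq, map_smul, act_Et]
  simp [Fin.sum_univ_two, pair_mul, Uq.comul_E, qadj, pair_U, Uq.spin, h0, Et, smul_smul]

theorem act_E_X : act q a (Uq.E q) (X q a) = 0 := by
  change act q a (Uq.E q) (Et q a 1 0) = _
  rw [act_Et]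
  simp [Fin.sum_univ_two, pair_mul, Uq.comul_E, qadj, pair_U, Uq.spin]

theorem act_E_Y : act q a (Uq.E q) (Y q a) =
    (qh q)⁻¹ • (tc q a • 1 + (qc q + (qc q)⁻¹) • Z q a) := by
  have h0 := qc_ne q
  have h1 := qh_ne q
  change act q a (Uq.E q) (Et q a 0 1) = _
  rw [act_Et]
  simp [Fin.sum_univ_two, pair_mul, Uq.comul_E, qadj, pair_U, Uq.spin, h0, Et, smul_smul]
  rw [← qh_sq]
  match_scalars <;> field_simp <;> ring

theorem act_F_Z : act q a (Uq.F q) (Z q a) = qh q • Y q a := by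
  have h0 := qc_ne q
  have h1 := qh_ne q
  rw [Z_eq, map_smul, act_Et]
  simp [Fin.sum_univ_two, pair_mul, Uq.comul_F, qadj, pair_U, Uq.spin, h0, Et, smul_smul]
  rw [← qh_sq]
  match_scalars <;> field_simp <;> ring

theorem act_F_Y : act q a (Uq.F q) (Y q a) = 0 := by
  change act q a (Uq.F q) (Et q a 0 1) = _
  rw [act_Et]
  simp [Fin.sum_univ_two, pair_mul, Uq.comul_F, qadj, pair_U, Uq.spin]

theorem act_F_X : act q a (Uq.F q) (X q a) =
    -((qh q)⁻¹ • (tc q a • 1 + (qc q + (qc q)⁻¹) • Z q a)) := by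
  have h0 := qc_ne q
  have h1 := qh_ne q
  change act q a (Uq.F q) (Et q a 1 0) = _
  rw [act_Et]
  simp [Fin.sum_univ_two, pair_mul, Uq.comul_F, qadj, pair_U, Uq.spin, h0, Et, smul_smul]
  rw [← qh_sq]
  match_scalars <;> field_simp <;> ring

theorem act_K_mul (b c : Podles q a) :
    act q a (Uq.K q) (b * c) = act q a (Uq.K q) b * act q a (Uq.K q) c := by
  simpa using act_mul q a (Uq.K q) b c ⟨Finset.univ, fun _ : Unit => Uq.K q, fun _ => Uq.K q, by
    simp [Uq.comul_K]⟩

theorem act_Ki_mul (b c : Podles q a) :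
    act q a (Uq.Ki q) (b * c) = act q a (Uq.Ki q) b * act q a (Uq.Ki q) c := by
  simpa using act_mul q a (Uq.Ki q) b c ⟨Finset.univ, fun _ : Unit => Uq.Ki q, fun _ => Uq.Ki q, by
    simp [Uq.comul_Ki]⟩

theorem act_E_mul (b c : Podles q a) : act q a (Uq.E q) (b * c) =
    act q a (Uq.E q) b * c + act q a (Uq.K q) b * act q a (Uq.E q) c := by
  simpa [act_one, Fin.sum_univ_two] using act_mul q a (Uq.E q) b c
    ⟨Finset.univ, ![Uq.E q, Uq.K q], ![1, Uq.E q], by simp [Uq.comul_E, Fin.sum_univ_two]⟩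

theorem act_F_mul (b c : Podles q a) : act q a (Uq.F q) (b * c) =
    act q a (Uq.F q) b * act q a (Uq.Ki q) c + b * act q a (Uq.F q) c := by
  simpa [act_one, Fin.sum_univ_two] using act_mul q a (Uq.F q) b c
    ⟨Finset.univ, ![Uq.F q, 1], ![Uq.Ki q, Uq.F q], by simp [Uq.comul_F, Fin.sum_univ_two]⟩

theorem act_Ki_Z : act q a (Uq.Ki q) (Z q a) = Z q a := by
  have := act_Ki_K (Z q a)
  rwa [act_K_Z] at this

theorem act_Ki_Y : act q a (Uq.Ki q) (Y q a) = qc q ^ 2 • Y q a := by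
  have h0 := qc_ne q
  rw [← act_Ki_K (qc q ^ 2 • Y q a), map_smul _ _ (Y q a), act_K_Y]
  simp [smul_smul, h0]

theorem act_Ki_X : act q a (Uq.Ki q) (X q a) = (qc q)⁻¹ ^ 2 • X q a := by
  have h0 := qc_ne q
  rw [← act_Ki_K ((qc q)⁻¹ ^ 2 • X q a), map_smul _ _ (X q a), act_K_X]
  simp [smul_smul, h0]

theorem star_algebraMap (c : ℂ) : star (algebraMap ℂ (Podles q a) c) =
    algebraMap ℂ (Podles q a) (star c) := by
  rw [Algebra.algebraMap_eq_smul_one, star_smul, star_one, Algebra.algebraMap_eq_smul_one]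

theorem act_algebraMap (x : Uq q) (c : ℂ) : act q a x (algebraMap ℂ (Podles q a) c) =
    Coalgebra.counit (R := ℂ) x • algebraMap ℂ (Podles q a) c := by
  rw [Algebra.algebraMap_eq_smul_one, map_smul, act_algebra_one, smul_comm]

theorem star_act_K (b : Podles q a) : star (act q a (Uq.K q) b) = act q a (Uq.Ki q) (star b) := by
  induction b using Podles.induction with
  | hc c => simp [star_algebraMap, act_algebraMap, Uq.counit_K, Uq.counit_Ki]
  | hX => simp [act_K_X, act_Ki_Y, star_X]
  | hY => simp [act_K_Y, act_Ki_X, star_Y]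
  | hZ => simp [act_K_Z, act_Ki_Z, star_Z]
  | ha b c hb hc => simp only [map_add, star_add, hb, hc]
  | hm b c hb hc => rw [act_K_mul, star_mul, star_mul, act_Ki_mul, hb, hc]

theorem star_act_Ki (b : Podles q a) : star (act q a (Uq.Ki q) b) = act q a (Uq.K q) (star b) := by
  rw [← act_K_Ki (star (act q a (Uq.Ki q) b)), ← star_act_K, act_K_Ki]

theorem conj_qh (q : Param) : star (qh q) = qh q := Complex.conj_ofReal _

theorem star_act_E (b : Podles q a) : star (act q a (Uq.E q) b) = -act q a (Uq.F q) (star b) := by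
  have h1 : star (qc q) = qc q := conj_qc q
  have h2 : star (tc q a) = tc q a := conj_tc q a
  induction b using Podles.induction with
  | hc c => simp [star_algebraMap, act_algebraMap, Uq.counit_E, Uq.counit_F]
  | hX => simp [act_E_X, act_F_Y, star_X]
  | hY => simp [act_E_Y, act_F_X, star_Y, star_Z, conj_qh, h1, h2]
  | hZ => simp [act_E_Z, act_F_Z, star_Z, star_X, conj_qh]
  | ha b c hb hc => simp only [map_add, star_add, hb, hc, neg_add]
  | hm b c hb hc =>
    rw [act_E_mul, star_add, star_mul, star_mul, star_mul, act_F_mul, hb, hc, star_act_K]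
    exact mul_neg_add_neg_mul _ _ _ _

theorem star_act_F (b : Podles q a) : star (act q a (Uq.F q) b) = -act q a (Uq.E q) (star b) := by
  have := star_act_E (star b)
  rw [star_star] at this
  rw [← star_star (act q a (Uq.E q) (star b)), this, star_neg, neg_neg]

end ActionValues

end Podles

/-! ### The Heisenberg double -/

section HeisDefs

variable (q : Param) (a : ℝ)

/-- An element of `O_q(S_t²)` as a generator of the Heisenberg double. -/
def heisB (b : Podles q a) : FreeAlgebra ℂ (Podles q a ⊕ Uq q) := FreeAlgebra.ι ℂ (Sum.inl b)

/-- An element of `U_q(su(2))` as a generator of the Heisenberg double. -/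
def heisU (x : Uq q) : FreeAlgebra ℂ (Podles q a ⊕ Uq q) := FreeAlgebra.ι ℂ (Sum.inr x)

/-- The defining relations of the Heisenberg double: the generators coming from `O_q(S_t²)` and from
`U_q(su(2))` multiply and add as in these algebras, and `x b = (x₁ ▷ b) x₂`. -/
inductive HRel : FreeAlgebra ℂ (Podles q a ⊕ Uq q) → FreeAlgebra ℂ (Podles q a ⊕ Uq q) → Prop
  | B_algebraMap (c : ℂ) : HRel (heisB q a (algebraMap ℂ _ c)) (algebraMap ℂ _ c)
  | B_add (b c : Podles q a) : HRel (heisB q a (b + c)) (heisB q a b + heisB q a c)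
  | B_mul (b c : Podles q a) : HRel (heisB q a (b * c)) (heisB q a b * heisB q a c)
  | U_algebraMap (c : ℂ) : HRel (heisU q a (algebraMap ℂ _ c)) (algebraMap ℂ _ c)
  | U_add (x y : Uq q) : HRel (heisU q a (x + y)) (heisU q a x + heisU q a y)
  | U_mul (x y : Uq q) : HRel (heisU q a (x * y)) (heisU q a x * heisU q a y)
  | cross (x : Uq q) (b : Podles q a) (n : ℕ) (u v : Fin n → Uq q)
      (h : Coalgebra.comul (R := ℂ) x = ∑ i, u i ⊗ₜ[ℂ] v i) :
      HRel (heisU q a x * heisB q a b)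
        (∑ i, heisB q a (Podles.act q a (u i) b) * heisU q a (v i))

/-- The Heisenberg double `H(O_q(S_t²), U_q(su(2)))`. -/
abbrev Heis : Type := RingQuot (HRel q a)

end HeisDefs

namespace Heis

section Incl

variable (q : Param) (a : ℝ)

/-- The quotient map from the free algebra. -/
def mk : FreeAlgebra ℂ (Podles q a ⊕ Uq q) →ₐ[ℂ] Heis q a := RingQuot.mkAlgHom ℂ (HRel q a)

/-- The homomorphism from the Podleś sphere to the Heisenberg double. -/
def ofB : Podles q a →ₐ[ℂ] Heis q a where
  toFun b := mk q a (heisB q a b)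
  map_one' := by
    have := RingQuot.mkAlgHom_rel ℂ (HRel.B_algebraMap (q := q) (a := a) 1)
    simpa [mk] using this
  map_mul' b c := by
    have := RingQuot.mkAlgHom_rel ℂ (HRel.B_mul (q := q) (a := a) b c)
    simpa [mk] using this
  map_zero' := by
    have := RingQuot.mkAlgHom_rel ℂ (HRel.B_algebraMap (q := q) (a := a) 0)
    simpa [mk] using this
  map_add' b c := by
    have := RingQuot.mkAlgHom_rel ℂ (HRel.B_add (q := q) (a := a) b c)
    simpa [mk] using this
  commutes' c := by
    have := RingQuot.mkAlgHom_rel ℂ (HRel.B_algebraMap (q := q) (a := a) c)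
    simpa [mk] using this

/-- The homomorphism from `U_q(su(2))` to the Heisenberg double. -/
def ofU : Uq q →ₐ[ℂ] Heis q a where
  toFun x := mk q a (heisU q a x)
  map_one' := by
    have := RingQuot.mkAlgHom_rel ℂ (HRel.U_algebraMap (q := q) (a := a) 1)
    simpa [mk] using this
  map_mul' b c := by
    have := RingQuot.mkAlgHom_rel ℂ (HRel.U_mul (q := q) (a := a) b c)
    simpa [mk] using this
  map_zero' := by
    have := RingQuot.mkAlgHom_rel ℂ (HRel.U_algebraMap (q := q) (a := a) 0)
    simpa [mk] using this
  map_add' b c := by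
    have := RingQuot.mkAlgHom_rel ℂ (HRel.U_add (q := q) (a := a) b c)
    simpa [mk] using this
  commutes' c := by
    have := RingQuot.mkAlgHom_rel ℂ (HRel.U_algebraMap (q := q) (a := a) c)
    simpa [mk] using this

/-- The commutation rule `x b = (x₁ ▷ b) x₂`. -/
theorem ofU_mul_ofB (x : Uq q) (b : Podles q a) (n : ℕ) (u v : Fin n → Uq q)
    (h : Coalgebra.comul (R := ℂ) x = ∑ i, u i ⊗ₜ[ℂ] v i) :
    ofU q a x * ofB q a b = ∑ i, ofB q a (Podles.act q a (u i) b) * ofU q a (v i) := by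
  have := RingQuot.mkAlgHom_rel ℂ (HRel.cross (q := q) (a := a) x b n u v h)
  simp only [map_mul, map_sum] at this
  exact this

theorem ofU_K_mul (b : Podles q a) : ofU q a (Uq.K q) * ofB q a b =
    ofB q a (Podles.act q a (Uq.K q) b) * ofU q a (Uq.K q) := by
  simpa using ofU_mul_ofB q a (Uq.K q) b 1 ![Uq.K q] ![Uq.K q] (by simp [Uq.comul_K])

theorem ofU_Ki_mul (b : Podles q a) : ofU q a (Uq.Ki q) * ofB q a b =
    ofB q a (Podles.act q a (Uq.Ki q) b) * ofU q a (Uq.Ki q) := by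
  simpa using ofU_mul_ofB q a (Uq.Ki q) b 1 ![Uq.Ki q] ![Uq.Ki q] (by simp [Uq.comul_Ki])

theorem ofU_E_mul (b : Podles q a) : ofU q a (Uq.E q) * ofB q a b =
    ofB q a (Podles.act q a (Uq.E q) b) + ofB q a (Podles.act q a (Uq.K q) b) * ofU q a (Uq.E q) := by
  simpa [Fin.sum_univ_two] using ofU_mul_ofB q a (Uq.E q) b 2 ![Uq.E q, Uq.K q] ![1, Uq.E q]
    (by simp [Uq.comul_E, Fin.sum_univ_two])

theorem ofU_F_mul (b : Podles q a) : ofU q a (Uq.F q) * ofB q a b =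
    ofB q a (Podles.act q a (Uq.F q) b) * ofU q a (Uq.Ki q) + ofB q a b * ofU q a (Uq.F q) := by
  simpa [Fin.sum_univ_two, Podles.act_one] using
    ofU_mul_ofB q a (Uq.F q) b 2 ![Uq.F q, 1] ![Uq.Ki q, Uq.F q]
    (by simp [Uq.comul_F, Fin.sum_univ_two])

/-- The map `u ⊗ v ↦ v^* (u ▷ b)^*`. -/
def starCross (b : Podles q a) : Uq q ⊗[ℂ] Uq q →+ Heis q a :=
  TensorProduct.liftAddHom
    { toFun := fun u =>
        { toFun := fun v => ofU q a (star v) * ofB q a (star (Podles.actHom q a u b))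
          map_zero' := by simp
          map_add' := fun v w => by simp [add_mul] }
      map_zero' := by ext v; simp
      map_add' := fun u w => by ext v; simp [mul_add] }
    (fun c u v => by simp)

theorem starCross_tmul (b : Podles q a) (u v : Uq q) : starCross q a b (u ⊗ₜ v) =
    ofU q a (star v) * ofB q a (star (Podles.act q a u b)) := rfl

theorem starCross_comul (x : Uq q) (b : Podles q a) :
    starCross q a b (Coalgebra.comul (R := ℂ) x) = ofB q a (star b) * ofU q a (star x) := by
  have hneg : ∀ c : Podles q a, ofB q a (-c) + ofB q a c = 0 := fun c => by
    rw [← map_add, neg_add_cancel, map_zero]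
  induction x using Uq.induction generalizing b with
  | hc c =>
    have e : Coalgebra.comul (R := ℂ) (algebraMap ℂ (Uq q) c) = algebraMap ℂ (Uq q) c ⊗ₜ 1 := by
      simp
    have e1 : star (algebraMap ℂ (Uq q) c) = algebraMap ℂ (Uq q) (star c) := by
      rw [Algebra.algebraMap_eq_smul_one, star_smul, star_one, Algebra.algebraMap_eq_smul_one]
    rw [e, starCross_tmul, Algebra.algebraMap_eq_smul_one]
    rw [← Podles.actHom_apply, map_smul, map_one, LinearMap.smul_apply, Module.End.one_apply]
    simp
  | hK =>
    rw [Uq.comul_K, starCross_tmul, Podles.star_act_K, Uq.star_K, ofU_K_mul, Podles.act_K_Ki]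
  | hKi =>
    rw [Uq.comul_Ki, starCross_tmul, Podles.star_act_Ki, Uq.star_Ki, ofU_Ki_mul, Podles.act_Ki_K]
  | hE =>
    rw [Uq.comul_E, map_add, starCross_tmul, starCross_tmul, Podles.star_act_K, Podles.star_act_E,
      star_one, map_one, one_mul, Uq.star_E, map_mul, mul_assoc, ofU_K_mul, Podles.act_K_Ki,
      ← mul_assoc, ofU_F_mul, add_mul, mul_assoc, ← map_mul, Uq.Ki_K, map_one, mul_one, ← add_assoc,
      hneg, zero_add, mul_assoc]
  | hF =>
    rw [Uq.comul_F, map_add, starCross_tmul, starCross_tmul, Podles.star_act_F, Podles.act_one,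
      Uq.star_F, Uq.star_Ki, map_mul, mul_assoc, ofU_E_mul, mul_add, ← add_assoc, ← mul_add, hneg,
      mul_zero, zero_add, ← mul_assoc, ofU_Ki_mul, Podles.act_Ki_K, mul_assoc]
  | ha x y hx hy => simp only [map_add, star_add, mul_add, hx, hy]
  | hm x y hx hy =>
    have Rx := Coalgebra.Repr.arbitrary ℂ x
    have Ry := Coalgebra.Repr.arbitrary ℂ y
    have h : ∀ c, ∑ i ∈ Rx.index, ofU q a (star (Rx.right i)) *
        ofB q a (star (Podles.act q a (Rx.left i) c)) = ofB q a (star c) * ofU q a (star x) :=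
      fun c => by
        rw [← hx, ← Rx.eq, map_sum]
        exact Finset.sum_congr rfl fun i _ => (starCross_tmul q a c _ _).symm
    have h' : ∑ i ∈ Ry.index, ofU q a (star (Ry.right i)) *
        ofB q a (star (Podles.act q a (Ry.left i) b)) = ofB q a (star b) * ofU q a (star y) := by
      rw [← hy, ← Ry.eq, map_sum]
      exact Finset.sum_congr rfl fun i _ => (starCross_tmul q a b _ _).symm
    rw [Bialgebra.comul_mul, ← Rx.eq, ← Ry.eq, Finset.sum_mul_sum, Finset.sum_comm, star_mul,
      map_mul, ← mul_assoc, ← h', Finset.sum_mul, map_sum]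
    refine Finset.sum_congr rfl fun j _ => ?_
    rw [mul_assoc, ← h, Finset.mul_sum, map_sum]
    refine Finset.sum_congr rfl fun i _ => ?_
    rw [Algebra.TensorProduct.tmul_mul_tmul, starCross_tmul, star_mul, map_mul,
      Podles.act_mul_left, mul_assoc]

end Incl

section Star

variable {q : Param} {a : ℝ}

/-- The adjoints of the generators. -/
def starGen (q : Param) (a : ℝ) : Podles q a ⊕ Uq q → Heis q a :=
  Sum.elim (fun b => ofB q a (star b)) (fun x => ofU q a (star x))

theorem conjAnti_heisB (b : Podles q a) :
    conjAnti (starGen q a) (heisB q a b) = ofB q a (star b) := conjAnti_ι _ _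

theorem conjAnti_heisU (x : Uq q) :
    conjAnti (starGen q a) (heisU q a x) = ofU q a (star x) := conjAnti_ι _ _

theorem star_rel : ∀ ⦃x y⦄, HRel q a x y →
    conjAnti (starGen q a) x = conjAnti (starGen q a) y := by
  intro x y h
  induction h with
  | B_algebraMap c =>
    rw [conjAnti_heisB, conjAnti_algebraMap, Podles.star_algebraMap, AlgHom.commutes]
    rfl
  | B_add b c => simp only [conjAnti_add, conjAnti_heisB, star_add, map_add]
  | B_mul b c => simp only [conjAnti_mul, conjAnti_heisB, star_mul, map_mul]
  | U_algebraMap c =>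
    rw [conjAnti_heisU, conjAnti_algebraMap, Algebra.algebraMap_eq_smul_one, star_smul, star_one,
      map_smul, map_one, Algebra.algebraMap_eq_smul_one]
    rfl
  | U_add b c => simp only [conjAnti_add, conjAnti_heisU, star_add, map_add]
  | U_mul b c => simp only [conjAnti_mul, conjAnti_heisU, star_mul, map_mul]
  | cross x b n u v h =>
    simp only [conjAnti_sum, conjAnti_mul, conjAnti_heisB, conjAnti_heisU]
    rw [← starCross_comul, h, map_sum]
    rfl

theorem star_inv (x : Podles q a ⊕ Uq q) :
    presentedStar _ (star_rel (q := q) (a := a)) (starGen q a x) = gen (HRel q a) x := by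
  cases x with
  | inl b =>
    refine (presentedStar_gen _ (star_rel (q := q) (a := a)) (Sum.inl (star b))).trans ?_
    change ofB q a (star (star b)) = ofB q a b
    rw [star_star]
  | inr x =>
    refine (presentedStar_gen _ (star_rel (q := q) (a := a)) (Sum.inr (star x))).trans ?_
    change ofU q a (star (star x)) = ofU q a x
    rw [star_star]

/-- The star structure of the Heisenberg double, extending those of `O_q(S_t²)` and
`U_q(su(2))`. -/
instance : StarRing (Heis q a) := starRingOfGen _ star_rel star_inv

instance : StarModule ℂ (Heis q a) := ⟨presentedStar_smul _ star_rel⟩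

theorem star_ofB (b : Podles q a) : star (ofB q a b) = ofB q a (star b) :=
  presentedStar_gen _ (star_rel (q := q) (a := a)) (Sum.inl b)

theorem star_ofU (x : Uq q) : star (ofU q a x) = ofU q a (star x) :=
  presentedStar_gen _ (star_rel (q := q) (a := a)) (Sum.inr x)

end Star

section Repn

variable {q : Param} {a : ℝ}

theorem algHom_ext {S : Type} [Semiring S] [Algebra ℂ S] {f g : Heis q a →ₐ[ℂ] S}
    (hB : ∀ b, f (ofB q a b) = g (ofB q a b)) (hU : ∀ x, f (ofU q a x) = g (ofU q a x)) : f = g :=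
  presented_ext fun x => by
    cases x with
    | inl b => exact hB b
    | inr x => exact hU x

theorem induction {P : Heis q a → Prop} (hB : ∀ b, P (ofB q a b)) (hU : ∀ x, P (ofU q a x))
    (ha : ∀ y z, P y → P z → P (y + z)) (hm : ∀ y z, P y → P z → P (y * z))
    (y : Heis q a) : P y :=
  presented_induction (r := HRel q a) (fun c => by simpa using hB (algebraMap ℂ _ c))
    (fun x => by
      cases x with
      | inl b => exact hB b
      | inr x => exact hU x) ha hm y

/-- The universal property of the Heisenberg double. -/
def lift {T : Type} [Ring T] [Algebra ℂ T] (f : Podles q a →ₐ[ℂ] T) (g : Uq q →ₐ[ℂ] T)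
    (h : ∀ (x : Uq q) (b : Podles q a) (n : ℕ) (u v : Fin n → Uq q),
      Coalgebra.comul (R := ℂ) x = ∑ i, u i ⊗ₜ[ℂ] v i →
      g x * f b = ∑ i, f (Podles.act q a (u i) b) * g (v i)) : Heis q a →ₐ[ℂ] T :=
  presentedLift (Sum.elim f g) (by
    have hB : ∀ b, FreeAlgebra.lift ℂ (Sum.elim f g) (heisB q a b) = f b := fun b => by
      simp [heisB]
    have hU : ∀ x, FreeAlgebra.lift ℂ (Sum.elim f g) (heisU q a x) = g x := fun x => by
      simp [heisU]
    intro x y r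
    induction r with
    | cross x b n u v e => simpa [hB, hU] using h x b n u v e
    | _ => simp [hB, hU])

section

variable {T : Type} [Ring T] [Algebra ℂ T] (f : Podles q a →ₐ[ℂ] T) (g : Uq q →ₐ[ℂ] T)
    (h : ∀ (x : Uq q) (b : Podles q a) (n : ℕ) (u v : Fin n → Uq q),
      Coalgebra.comul (R := ℂ) x = ∑ i, u i ⊗ₜ[ℂ] v i →
      g x * f b = ∑ i, f (Podles.act q a (u i) b) * g (v i))

@[simp] theorem lift_ofB (b : Podles q a) : lift f g h (ofB q a b) = f b :=
  presentedLift_gen (r := HRel q a) (Sum.elim f g) _ (Sum.inl b)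

@[simp] theorem lift_ofU (x : Uq q) : lift f g h (ofU q a x) = g x :=
  presentedLift_gen (r := HRel q a) (Sum.elim f g) _ (Sum.inr x)

end

/-- The Heisenberg representation on `O_q(S_t²)`: `π(b) c = b c` and `π(x) c = x ▷ c`. -/
def rep (q : Param) (a : ℝ) : Heis q a →ₐ[ℂ] Module.End ℂ (Podles q a) :=
  lift (T := Module.End ℂ (Podles q a)) (Algebra.lmul ℂ (Podles q a)) (Podles.actHom q a) (by
    intro x b n u v h
    refine LinearMap.ext fun c => ?_
    have := Podles.act_mul q a x b c ⟨Finset.univ, u, v, h.symm⟩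
    simpa [Podles.actHom_apply] using this)

theorem rep_ofB (b c : Podles q a) : rep q a (ofB q a b) c = b * c := by
  rw [rep, lift_ofB]
  rfl

theorem rep_ofU (x : Uq q) (c : Podles q a) : rep q a (ofU q a x) c = Podles.act q a x c := by
  rw [rep, lift_ofU]
  rfl

end Repn

end Heis

/-! ### The representations `π_±` -/

section PiRep

/-- The two signs: `true` is `+` and `false` is `-`. -/
abbrev Sgn := Bool

/-- The sign as a real number. -/
def Sgn.val : Sgn → ℝ
  | true => 1
  | false => -1

/-- The vector space `V_±` with basis `ξ_p`, `p = 0, 1, 2, …`. -/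
def V : Type := ℕ →₀ ℂ

instance : AddCommGroup V := inferInstanceAs (AddCommGroup (ℕ →₀ ℂ))

instance : Module ℂ V := inferInstanceAs (Module ℂ (ℕ →₀ ℂ))

namespace V

/-- The basis vector `ξ_p`. -/
def basis (p : ℕ) : V := (Finsupp.single p 1 : ℕ →₀ ℂ)

/-- The coordinate of a vector at `ξ_p`. -/
def coord (p : ℕ) : V →ₗ[ℂ] ℂ := (Finsupp.lapply p : (ℕ →₀ ℂ) →ₗ[ℂ] ℂ)

/-- The finite set of the `p` with a non-zero coordinate at `ξ_p`. -/
def supp (v : V) : Finset ℕ := Finsupp.support (v : ℕ →₀ ℂ)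

/-- The linear map with given values on the basis. -/
def lift {M : Type} [AddCommMonoid M] [Module ℂ M] (f : ℕ → M) : V →ₗ[ℂ] M :=
  (Finsupp.linearCombination ℂ f : (ℕ →₀ ℂ) →ₗ[ℂ] M)

@[simp] theorem lift_basis {M : Type} [AddCommMonoid M] [Module ℂ M] (f : ℕ → M) (p : ℕ) :
    lift f (basis p) = f p :=
  (Finsupp.linearCombination_single ℂ 1 p).trans (one_smul ℂ (f p))

theorem coord_basis (p r : ℕ) : coord p (basis r) = if r = p then 1 else 0 :=
  Finsupp.single_apply

theorem sum_coord (v : V) : v = ∑ p ∈ v.supp, coord p v • basis p := by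
  refine (Finsupp.sum_single (v : ℕ →₀ ℂ)).symm.trans (Finset.sum_congr rfl fun p _ => ?_)
  exact (Finsupp.smul_single_one p (coord p v)).symm

theorem hom_ext {M : Type} [AddCommMonoid M] [Module ℂ M] {f g : V →ₗ[ℂ] M}
    (h : ∀ p, f (basis p) = g (basis p)) : f = g :=
  LinearMap.ext fun v => by
    rw [sum_coord v, map_sum, map_sum]
    exact Finset.sum_congr rfl fun p _ => by rw [map_smul, map_smul, h]

end V

variable (q : Param) (a : ℝ) (s : Sgn)

/-- The eigenvalue `± q ^ (2p ∓ a + 1)` of `Z_t` at `ξ_p`. -/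
def zval (p : ℕ) : ℝ := s.val * (q : ℝ) ^ (2 * (p : ℝ) - s.val * a + 1)

/-- The number `((1 - q ^ (2p)) (q ^ (∓2a + 2p) + 1)) ^ (1/2)`. -/
def uval (p : ℕ) : ℝ :=
  Real.sqrt ((1 - (q : ℝ) ^ (2 * (p : ℝ))) * ((q : ℝ) ^ (-(2 * (s.val * a)) + 2 * (p : ℝ)) + 1))

theorem zval_ne (p : ℕ) : zval q a s p ≠ 0 := by
  have h := Real.rpow_pos_of_pos q.2.1 (2 * (p : ℝ) - s.val * a + 1)
  cases s <;> simpa [zval, Sgn.val] using h.ne'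

theorem uval_zero : uval q a s 0 = 0 := by simp [uval]

theorem uval_sq (p : ℕ) : uval q a s p ^ 2 =
    (1 - (q : ℝ) ^ (2 * (p : ℝ))) * ((q : ℝ) ^ (-(2 * (s.val * a)) + 2 * (p : ℝ)) + 1) := by
  refine Real.sq_sqrt (mul_nonneg (sub_nonneg.2 ?_) ?_)
  · exact Real.rpow_le_one q.2.1.le q.2.2.le (by positivity)
  · have := Real.rpow_pos_of_pos q.2.1 (-(2 * (s.val * a)) + 2 * (p : ℝ))
    linarith

theorem zval_succ (p : ℕ) : zval q a s (p + 1) = (q : ℝ) ^ 2 * zval q a s p := by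
  have h : 2 * ((p + 1 : ℕ) : ℝ) - s.val * a + 1 = (2 * (p : ℝ) - s.val * a + 1) + (2 : ℕ) := by
    push_cast; ring
  rw [zval, h, Real.rpow_add_natCast q.2.1.ne', zval]
  ring

theorem uval_sq_eq (p : ℕ) : uval q a s p ^ 2 =
    1 - (q : ℝ)⁻¹ * tpar q a * zval q a s p - (q : ℝ)⁻¹ ^ 2 * (zval q a s p * zval q a s p) := by
  have h0 := q.2.1
  have hA := Real.rpow_pos_of_pos h0 a
  have e2 : (q : ℝ) ^ (2 * (p : ℝ)) = ((q : ℝ) ^ p) ^ 2 := by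
    rw [← pow_mul, ← Real.rpow_natCast]; push_cast; ring_nf
  have ez : (q : ℝ) ^ (2 * (p : ℝ) - s.val * a + 1) =
      ((q : ℝ) ^ p) ^ 2 * ((q : ℝ) ^ (s.val * a))⁻¹ * q := by
    rw [Real.rpow_add h0, Real.rpow_sub h0, Real.rpow_one, e2]; rfl
  have eu : (q : ℝ) ^ (-(2 * (s.val * a)) + 2 * (p : ℝ)) =
      ((q : ℝ) ^ (s.val * a))⁻¹ ^ 2 * ((q : ℝ) ^ p) ^ 2 := by
    rw [Real.rpow_add h0, e2, Real.rpow_neg h0.le, mul_comm 2 (s.val * a), Real.rpow_mul h0.le,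
      Real.rpow_two, inv_pow]
  rw [uval_sq, zval, ez, eu, e2, tpar, Real.rpow_neg h0.le]
  cases s
  · simp only [Sgn.val, neg_one_mul, Real.rpow_neg h0.le]
    field_simp
    ring
  · simp only [Sgn.val, one_mul]
    field_simp
    ring

theorem uval_succ_sq_eq (p : ℕ) : uval q a s (p + 1) ^ 2 =
    1 - (q : ℝ) * tpar q a * zval q a s p - (q : ℝ) ^ 2 * (zval q a s p * zval q a s p) := by
  have h0 := q.2.1
  rw [uval_sq_eq, zval_succ]
  field_simp

/-- The eigenvalue of `Z_t` at `ξ_p`, as a complex number. -/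
def zc (p : ℕ) : ℂ := ((zval q a s p : ℝ) : ℂ)

/-- The coefficient of `X_t` at `ξ_p`, as a complex number. -/
def uc (p : ℕ) : ℂ := ((uval q a s p : ℝ) : ℂ)

theorem zc_ne (p : ℕ) : zc q a s p ≠ 0 := Complex.ofReal_ne_zero.2 (zval_ne q a s p)

theorem uc_zero : uc q a s 0 = 0 := by simp [uc, uval_zero]

theorem zc_succ (p : ℕ) : zc q a s (p + 1) = qc q ^ 2 * zc q a s p := by
  simp [zc, zval_succ, qc]

theorem uc_sq_eq (p : ℕ) : uc q a s p ^ 2 =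
    1 - (qc q)⁻¹ * tc q a * zc q a s p - (qc q)⁻¹ ^ 2 * (zc q a s p * zc q a s p) := by
  simp only [uc, zc, qc, tc]
  exact_mod_cast uval_sq_eq q a s p

theorem uc_succ_sq_eq (p : ℕ) : uc q a s (p + 1) ^ 2 =
    1 - qc q * tc q a * zc q a s p - qc q ^ 2 * (zc q a s p * zc q a s p) := by
  simp only [uc, zc, qc, tc]
  exact_mod_cast uval_succ_sq_eq q a s p

/-- The operator `Z_t` on `V_±`. -/
def opZ : Module.End ℂ V :=
  V.lift fun p => zc q a s p • V.basis p

/-- The inverse of the operator `Z_t` on `V_±`. -/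
def opZinv : Module.End ℂ V :=
  V.lift fun p => (zc q a s p)⁻¹ • V.basis p

/-- The operator `X_t` on `V_±`. -/
def opX : Module.End ℂ V :=
  V.lift fun p => uc q a s p • V.basis (p - 1)

/-- The operator `Y_t` on `V_±`. -/
def opY : Module.End ℂ V :=
  V.lift fun p => uc q a s (p + 1) • V.basis (p + 1)

theorem opZ_basis (p : ℕ) : opZ q a s (V.basis p) = zc q a s p • V.basis p := by
  simp [opZ]
theorem opZinv_basis (p : ℕ) : opZinv q a s (V.basis p) = (zc q a s p)⁻¹ • V.basis p := by
  simp [opZinv]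
theorem opX_basis (p : ℕ) : opX q a s (V.basis p) = uc q a s p • V.basis (p - 1) := by
  simp [opX]
theorem opY_basis (p : ℕ) :
    opY q a s (V.basis p) = uc q a s (p + 1) • V.basis (p + 1) := by
  simp [opY]

theorem opZ_mul_opZinv : opZ q a s * opZinv q a s = 1 := by
  refine V.hom_ext fun p => ?_
  have := zc_ne q a s p
  simp [opZ_basis, opZinv_basis, smul_smul, this]

theorem opZinv_mul_opZ : opZinv q a s * opZ q a s = 1 := by
  refine V.hom_ext fun p => ?_
  have := zc_ne q a s p
  simp [opZ_basis, opZinv_basis, smul_smul, this]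

/-- The representation `π_±` of the Podleś sphere on `V_±`. -/
def piRep : Podles q a →ₐ[ℂ] Module.End ℂ V :=
  Podles.lift (opX q a s) (opY q a s) (opZ q a s)
    (by
      refine V.hom_ext fun p => ?_
      cases p with
      | zero => simp [opZ_basis, opX_basis, uc_zero]
      | succ p =>
        simp only [Module.End.mul_apply, LinearMap.smul_apply, opZ_basis, opX_basis, map_smul,
          smul_smul, zc_succ, Nat.add_sub_cancel]
        congr 1
        ring)
    (by
      have h0 := qc_ne q
      refine V.hom_ext fun p => ?_
      simp only [Module.End.mul_apply, LinearMap.smul_apply, opZ_basis, opY_basis, map_smul,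
        smul_smul, zc_succ]
      congr 1
      field_simp)
    (by
      refine V.hom_ext fun p => ?_
      have h := uc_succ_sq_eq q a s p
      simp only [Module.End.mul_apply, LinearMap.smul_apply, LinearMap.sub_apply,
        Module.End.one_apply, opZ_basis, opX_basis, opY_basis, map_smul, Nat.add_sub_cancel]
      linear_combination (norm := module) h • V.basis p)
    (by
      refine V.hom_ext fun p => ?_
      have h := uc_sq_eq q a s p
      have e : uc q a s p • uc q a s (p - 1 + 1) • V.basis (p - 1 + 1) =
          uc q a s p ^ 2 • V.basis p := by
        cases p with
        | zero => simp [uc_zero]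
        | succ p => rw [Nat.add_sub_cancel, smul_smul, sq]
      simp only [Module.End.mul_apply, LinearMap.smul_apply, LinearMap.sub_apply,
        Module.End.one_apply, opZ_basis, opX_basis, opY_basis, map_smul, e]
      linear_combination (norm := module) h • V.basis p)

theorem piRep_X : piRep q a s (Podles.X q a) = opX q a s := Podles.lift_X ..
theorem piRep_Y : piRep q a s (Podles.Y q a) = opY q a s := Podles.lift_Y ..
theorem piRep_Z : piRep q a s (Podles.Z q a) = opZ q a s := Podles.lift_Z ..

end PiRep

/-! ### The Hilbert space `(H_+ ⊗ H_+) ⊕ (H_- ⊗ H_-)` and the GNS vectors -/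

section Bounded

/-- The columns of the matrix of the operator `A` on `V` are bounded in `ℓ¹` by `C`. -/
def ColBound (A : Module.End ℂ V) (C : ℝ) : Prop :=
  ∀ (p : ℕ) (S : Finset ℕ), ∑ m ∈ S, ‖V.coord m (A (V.basis p))‖ ≤ C

theorem V.map_eq (A : Module.End ℂ V) (w : V) :
    A w = ∑ l ∈ w.supp, V.coord l w • A (V.basis l) := by
  conv_lhs => rw [V.sum_coord w]
  simp

theorem ColBound.add {A B : Module.End ℂ V} {C D : ℝ} (hA : ColBound A C) (hB : ColBound B D) :
    ColBound (A + B) (C + D) := fun p S => by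
  refine le_trans (Finset.sum_le_sum fun m _ => ?_)
    ((Finset.sum_add_distrib.trans_le (add_le_add (hA p S) (hB p S))))
  rw [LinearMap.add_apply, map_add]
  exact norm_add_le _ _

theorem ColBound.nonneg {A : Module.End ℂ V} {C : ℝ} (hA : ColBound A C) : 0 ≤ C := by
  simpa using hA 0 ∅

theorem ColBound.mul {A B : Module.End ℂ V} {C D : ℝ} (hA : ColBound A C) (hB : ColBound B D) :
    ColBound (A * B) (C * D) := fun p S => by
  have h0 := hA.nonneg
  have h : ∀ m, ‖V.coord m ((A * B) (V.basis p))‖ ≤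
      ∑ l ∈ (B (V.basis p)).supp, ‖V.coord l (B (V.basis p))‖ * ‖V.coord m (A (V.basis l))‖ := fun m => by
    rw [Module.End.mul_apply, V.map_eq A (B (V.basis p)), map_sum]
    refine (norm_sum_le _ _).trans (le_of_eq (Finset.sum_congr rfl fun l _ => ?_))
    simp
  calc ∑ m ∈ S, ‖V.coord m ((A * B) (V.basis p))‖
      ≤ ∑ m ∈ S, ∑ l ∈ (B (V.basis p)).supp, ‖V.coord l (B (V.basis p))‖ * ‖V.coord m (A (V.basis l))‖ :=
        Finset.sum_le_sum fun m _ => h m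
    _ = ∑ l ∈ (B (V.basis p)).supp, ‖V.coord l (B (V.basis p))‖ * ∑ m ∈ S, ‖V.coord m (A (V.basis l))‖ := by
        rw [Finset.sum_comm]
        simp only [Finset.mul_sum]
    _ ≤ ∑ l ∈ (B (V.basis p)).supp, ‖V.coord l (B (V.basis p))‖ * C :=
        Finset.sum_le_sum fun l _ => mul_le_mul_of_nonneg_left (hA l S) (norm_nonneg _)
    _ ≤ C * D := by
        rw [← Finset.sum_mul, mul_comm]
        exact mul_le_mul_of_nonneg_left (hB p _) h0

theorem colBound_of_basis {A : Module.End ℂ V} {C : ℝ} (c : ℕ → ℂ) (f : ℕ → ℕ)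
    (h : ∀ p, A (V.basis p) = c p • V.basis (f p)) (hC : 0 ≤ C) (hc : ∀ p, ‖c p‖ ≤ C) :
    ColBound A C := fun p S => by
  rw [h]
  calc ∑ m ∈ S, ‖V.coord m (c p • V.basis (f p))‖ = ∑ m ∈ S, if f p = m then ‖c p‖ else 0 := by
        refine Finset.sum_congr rfl fun m _ => ?_
        rw [map_smul, V.coord_basis]
        split <;> simp
    _ ≤ C := by
        rw [Finset.sum_ite_eq]
        split
        · exact hc p
        · exact hC

variable (q : Param) (a : ℝ)

theorem zval_eq (s : Sgn) (p : ℕ) : zval q a s p = ((q : ℝ) ^ 2) ^ p * zval q a s 0 := by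
  induction p with
  | zero => simp
  | succ p ih => rw [zval_succ, ih]; ring

theorem abs_zval_le (s : Sgn) (p : ℕ) : |zval q a s p| ≤ |zval q a s 0| := by
  rw [zval_eq, abs_mul, abs_of_nonneg (by positivity)]
  exact mul_le_of_le_one_left (abs_nonneg _)
    (pow_le_one₀ (by positivity) (pow_le_one₀ q.2.1.le q.2.2.le))

theorem uval_le (s : Sgn) (p : ℕ) :
    uval q a s p ≤ Real.sqrt ((q : ℝ) ^ (-(2 * (s.val * a))) + 1) := by
  have h0 := q.2.1
  refine Real.sqrt_le_sqrt ?_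
  have h1 : (q : ℝ) ^ (2 * (p : ℝ)) ≤ 1 :=
    Real.rpow_le_one h0.le q.2.2.le (by positivity)
  have h2 := Real.rpow_pos_of_pos h0 (2 * (p : ℝ))
  have h3 := Real.rpow_pos_of_pos h0 (-(2 * (s.val * a)))
  rw [Real.rpow_add h0]
  nlinarith [mul_nonneg h3.le h2.le, mul_nonneg h3.le (sub_nonneg.2 h1)]

theorem exists_colBound (b : Podles q a) : ∃ C, ∀ s, ColBound (piRep q a s b) C := by
  have key : ∀ b : Podles q a, (∀ s, ∃ C, ColBound (piRep q a s b) C) →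
      ∃ C, ∀ s, ColBound (piRep q a s b) C := fun b h => by
    choose C hC using h
    refine ⟨C true + C false, fun s p S => (hC s p S).trans ?_⟩
    have h1 := (hC true).nonneg
    have h2 := (hC false).nonneg
    cases s <;> linarith
  induction b using Podles.induction with
  | hc c =>
    refine ⟨‖c‖, fun s => colBound_of_basis (fun _ => c) id (fun p => ?_) (norm_nonneg _)
      (fun _ => le_rfl)⟩
    rw [AlgHom.commutes]
    rfl
  | hX =>
    refine key _ fun s => ⟨_, colBound_of_basis (uc q a s) (fun p => p - 1) (fun p => ?_)
      (Real.sqrt_nonneg ((q : ℝ) ^ (-(2 * (s.val * a))) + 1)) fun p => ?_⟩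
    · rw [piRep_X, opX_basis]
    · rw [uc, Complex.norm_real, uval, Real.norm_of_nonneg (Real.sqrt_nonneg _)]
      exact uval_le q a s p
  | hY =>
    refine key _ fun s => ⟨_, colBound_of_basis (fun p => uc q a s (p + 1)) (fun p => p + 1)
      (fun p => ?_) (Real.sqrt_nonneg ((q : ℝ) ^ (-(2 * (s.val * a))) + 1)) fun p => ?_⟩
    · rw [piRep_Y, opY_basis]
    · rw [uc, Complex.norm_real, uval, Real.norm_of_nonneg (Real.sqrt_nonneg _)]
      exact uval_le q a s (p + 1)
  | hZ =>
    refine key _ fun s => ⟨_, colBound_of_basis (zc q a s) id (fun p => ?_)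
      (abs_nonneg (zval q a s 0)) fun p => ?_⟩
    · rw [piRep_Z, opZ_basis]
      rfl
    · rw [zc, Complex.norm_real]
      exact abs_zval_le q a s p
  | ha b c hb hc =>
    obtain ⟨C, hC⟩ := hb
    obtain ⟨D, hD⟩ := hc
    exact ⟨C + D, fun s => by rw [map_add]; exact (hC s).add (hD s)⟩
  | hm b c hb hc =>
    obtain ⟨C, hC⟩ := hb
    obtain ⟨D, hD⟩ := hc
    exact ⟨C * D, fun s => by rw [map_mul]; exact (hC s).mul (hD s)⟩

end Bounded

section GNS

variable (q : Param) (a : ℝ)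

/-- The Hilbert space `(H_+ ⊗ H_+) ⊕ (H_- ⊗ H_-)` where `H_±` has orthonormal basis `ξ_p`,
realised on its orthonormal basis: the index `(s, m, n)` stands for `ξ_m ⊗ ξ_n` in the summand
with sign `s`. -/
abbrev L2 : Type := lp (fun _ : Sgn × ℕ × ℕ => ℂ) 2

/-- The inclusion of `W_± = V_± ⊗ V_±` in the Hilbert space. -/
def inclW (s : Sgn) : V ⊗[ℂ] V →ₗ[ℂ] L2 :=
  TensorProduct.lift <| V.lift fun m =>
    V.lift fun n => (lp.single 2 (s, m, n) (1 : ℂ) : L2)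

theorem inclW_basis (s : Sgn) (m n : ℕ) :
    inclW s (V.basis m ⊗ₜ V.basis n) = lp.single 2 (s, m, n) (1 : ℂ) := by
  simp [inclW]

/-- The operator `A ⊗ B` on `V ⊗ V`. -/
def tensorEnd (A B : Module.End ℂ V) : Module.End ℂ (V ⊗[ℂ] V) := TensorProduct.map A B

/-- The eigenvalue of the positive operator `T = (q⁻¹ - q) / (q ^ a + q ^ (-a)) |Z_t|` at `ξ_p`. -/
def tval (s : Sgn) (p : ℕ) : ℝ :=
  ((q : ℝ)⁻¹ - q) / ((q : ℝ) ^ a + (q : ℝ) ^ (-a)) * |zval q a s p|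

/-- The coefficients of the GNS vector `(π(b) ⊗ 1) ξ_T` where
`ξ_T = ∑ (T ξ_n, ξ_n) ^ (1/2) ξ_n ⊗ ξ_n`. -/
def gnsFun (b : Podles q a) (i : Sgn × ℕ × ℕ) : ℂ :=
  ((Real.sqrt (tval q a i.1 i.2.2) : ℝ) : ℂ) * V.coord i.2.1 (piRep q a i.1 b (V.basis i.2.2))

theorem sqrt_tval_eq (s : Sgn) (p : ℕ) :
    Real.sqrt (tval q a s p) = (q : ℝ) ^ p * Real.sqrt (tval q a s 0) := by
  have h0 := q.2.1
  rw [tval, zval_eq, abs_mul, abs_of_nonneg (by positivity), mul_left_comm, ← pow_mul, mul_comm 2 p,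
    pow_mul, Real.sqrt_mul (by positivity), Real.sqrt_sq (by positivity)]
  rfl

theorem gnsFun_mem (b : Podles q a) : Memℓp (gnsFun q a b) 2 := by
  obtain ⟨C, hC⟩ := exists_colBound q a b
  have hC0 := (hC true).nonneg
  have h0 := q.2.1
  have h1 := q.2.2
  set M := Real.sqrt (tval q a true 0) + Real.sqrt (tval q a false 0) with hM
  have hM0 : 0 ≤ M := by positivity
  have hc : ∀ s p, Real.sqrt (tval q a s p) ≤ (q : ℝ) ^ p * M := fun s p => by
    rw [sqrt_tval_eq]
    refine mul_le_mul_of_nonneg_left ?_ (by positivity)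
    have h1 := Real.sqrt_nonneg (tval q a true 0)
    have h2 := Real.sqrt_nonneg (tval q a false 0)
    cases s <;> simp only [hM] <;> linarith
  refine Memℓp.of_exponent_ge (q := 1) ?_ (by norm_num)
  refine memℓp_gen' (C := 2 * ((1 - (q : ℝ))⁻¹ * (M * C))) fun S => ?_
  let S₁ := (S.image fun i => i.2.1)
  let S₂ := (S.image fun i => i.2.2)
  have hS : S ⊆ Finset.univ ×ˢ S₁ ×ˢ S₂ := fun i hi => by
    simp only [Finset.mem_product, Finset.mem_univ, true_and]
    exact ⟨Finset.mem_image_of_mem _ hi, Finset.mem_image_of_mem _ hi⟩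
  have hterm : ∀ s n, ∑ m ∈ S₁, ‖gnsFun q a b (s, m, n)‖ ≤ (q : ℝ) ^ n * (M * C) := fun s n => by
    have : ∀ m, ‖gnsFun q a b (s, m, n)‖ =
        Real.sqrt (tval q a s n) * ‖V.coord m (piRep q a s b (V.basis n))‖ := fun m => by
      rw [gnsFun, norm_mul, Complex.norm_real, Real.norm_of_nonneg (Real.sqrt_nonneg _)]
    simp only [this]
    rw [← Finset.mul_sum, ← mul_assoc]
    exact mul_le_mul (hc s n) (hC s n S₁) (Finset.sum_nonneg fun _ _ => norm_nonneg _)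
      (by positivity)
  have hgeo : ∑ n ∈ S₂, (q : ℝ) ^ n ≤ (1 - (q : ℝ))⁻¹ := by
    rw [← tsum_geometric_of_lt_one h0.le h1]
    exact (summable_geometric_of_lt_one h0.le h1).sum_le_tsum _ fun n _ => by positivity
  calc ∑ i ∈ S, ‖gnsFun q a b i‖ ^ (1 : ENNReal).toReal
      ≤ ∑ i ∈ Finset.univ ×ˢ S₁ ×ˢ S₂, ‖gnsFun q a b i‖ := by
        simp only [ENNReal.toReal_one, Real.rpow_one]
        exact Finset.sum_le_sum_of_subset_of_nonneg hS fun _ _ _ => norm_nonneg _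
    _ = ∑ s : Sgn, ∑ n ∈ S₂, ∑ m ∈ S₁, ‖gnsFun q a b (s, m, n)‖ := by
        rw [Finset.sum_product]
        refine Finset.sum_congr rfl fun s _ => ?_
        rw [Finset.sum_product_right]
    _ ≤ ∑ s : Sgn, (1 - (q : ℝ))⁻¹ * (M * C) := by
        refine Finset.sum_le_sum fun s _ => ?_
        refine (Finset.sum_le_sum fun n _ => hterm s n).trans ?_
        rw [← Finset.sum_mul]
        exact mul_le_mul_of_nonneg_right hgeo (by positivity)
    _ = 2 * ((1 - (q : ℝ))⁻¹ * (M * C)) := by simp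

/-- The GNS map `b ↦ (π(b) ⊗ 1) ξ_T`, with range `L²_{q,0}(S_t²)`. -/
def gns : Podles q a →ₗ[ℂ] L2 where
  toFun b := ⟨gnsFun q a b, gnsFun_mem q a b⟩
  map_add' b c := by
    ext i
    change gnsFun q a (b + c) i = gnsFun q a b i + gnsFun q a c i
    simp [gnsFun, mul_add]
  map_smul' c b := by
    ext i
    change gnsFun q a (c • b) i = c * gnsFun q a b i
    simp [gnsFun, mul_left_comm]

theorem gns_apply (b : Podles q a) (i : Sgn × ℕ × ℕ) : gns q a b i = gnsFun q a b i := rfl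

/-- An invariant state of `O_q(SU(2))`. -/
structure IsInvariantState (Φ : SUq q →ₗ[ℂ] ℂ) : Prop where
  map_one : Φ 1 = 1
  nonneg : ∀ f, 0 ≤ (Φ (star f * f)).re ∧ (Φ (star f * f)).im = 0
  left_inv : ∀ f, TensorProduct.lid ℂ (SUq q)
    (LinearMap.rTensor (SUq q) Φ (Coalgebra.comul (R := ℂ) f)) = Φ f • 1
  right_inv : ∀ f, TensorProduct.rid ℂ (SUq q)
    (LinearMap.lTensor (SUq q) Φ (Coalgebra.comul (R := ℂ) f)) = Φ f • 1

end GNS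

end QuantumSphere

end

open QuantumSphere

noncomputable section

namespace QuantumSphere

/-! ### Commutation relations of X, Y, Z and Z⁻¹ on V_±. -/

section Operators

variable (q : Param) (a : ℝ) (s : Sgn)

/-! On V_± the action of U_q(su(2)) on B is implemented by the operators of B themselves: K ▷ b
becomes Z⁻¹ b Z, while (q⁻¹ - q) E ▷ b and (q⁻¹ - q) F ▷ b become q^{-1/2} Z⁻¹ [X, b] and q^{-1/2}
[Y, b] Z⁻¹ (`piRep_act_K`, `smul_piRep_act_E`, `smul_piRep_act_F`). Both sides agree on X, Y, Z and
obey the same twisted Leibniz rule, the one read off from the coproduct.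

Regard a vector with coordinates (m, n) as a matrix. Then Λ(b) is the Hilbert-Schmidt operator π(b)
T^{1/2}, where T is a multiple of |Z|. Left multiplication is an operator on the first tensor leg,
and right multiplication is the transposed operator on the second. The two products in each
commutator thus become the two summands of E and of F. The eigenvalues of T^{1/2} form a geometric
sequence of ratio q, so X T^{1/2} = q T^{1/2} X, and moving X across T^{1/2} turns q^{-1/2} into
q^{1/2}. This is where the formulas for K, E, F on W_± come from. They satisfy the relations of
U_q(su(2)) by direct computation (`scaledE_mul_scaledF_sub` is the substantial one). They satisfy
the cross relation with π(b) ⊗ 1 because second legs commute with π(b) ⊗ 1, which leaves only the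
implementing formulas (`repU_mul_repB`). Both adjointness statements (`wAdj_repW`, `gnsAdj_repW`)
are additive and reverse products, so they reduce to generators and basis vectors.

For the Haar state, ⟨Λ(b), Λ(c)⟩ is the trace of T π(b* c) (`inner_gns`, `hasSum_vectorState`), so
it remains to identify the functional b ↦ Tr(T π(b)) with the Haar state on B. A functional on B
that is invariant under K and F is determined by its value at 1 (`eq_zero_of_invariant`): the
K-weights kill every monomial except Z^n, and F ▷ (Z^n X) is a polynomial in Z of degree n + 1,
which determines the values at the powers of Z recursively. Left invariance of Φ gives the
invariance of its restriction (`invariant_act`). For the trace, K-invariance is conjugation by a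
diagonal operator. For F, the factor Z in T = const · (±Z) cancels the Z⁻¹ of the commutator
formula, so the trace telescopes (`smul_diag_act_F`). What survives is a boundary term at infinity,
the same for both signs except for the factor ±1, so that it cancels in the sum over H_+ and H_-
(`vectorState_act_F`). -/

theorem opX_mul_opZ : opX q a s * opZ q a s = qc q ^ 2 • (opZ q a s * opX q a s) := by
  simpa [piRep_X, piRep_Z] using congrArg (piRep q a s) (Podles.X_mul_Z q a)

theorem opY_mul_opZ : opY q a s * opZ q a s = (qc q)⁻¹ ^ 2 • (opZ q a s * opY q a s) := by
  simpa [piRep_Y, piRep_Z] using congrArg (piRep q a s) (Podles.Y_mul_Z q a)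

theorem opX_mul_opY : opX q a s * opY q a s =
    1 - (qc q * tc q a) • opZ q a s - qc q ^ 2 • (opZ q a s * opZ q a s) := by
  simpa [piRep_X, piRep_Y, piRep_Z] using congrArg (piRep q a s) (Podles.X_mul_Y q a)

theorem opY_mul_opX : opY q a s * opX q a s =
    1 - ((qc q)⁻¹ * tc q a) • opZ q a s - (qc q)⁻¹ ^ 2 • (opZ q a s * opZ q a s) := by
  simpa [piRep_X, piRep_Y, piRep_Z] using congrArg (piRep q a s) (Podles.Y_mul_X q a)

theorem opZ_mul_opY : opZ q a s * opY q a s = qc q ^ 2 • (opY q a s * opZ q a s) := by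
  rw [opY_mul_opZ, smul_smul, ← mul_pow, mul_inv_cancel₀ (qc_ne q), one_pow, one_smul]

theorem opX_mul_opZinv :
    opX q a s * opZinv q a s = (qc q)⁻¹ ^ 2 • (opZinv q a s * opX q a s) := by
  have h0 := qc_ne q
  calc opX q a s * opZinv q a s
      = opZinv q a s * opZ q a s * (opX q a s * opZinv q a s) := by
        rw [opZinv_mul_opZ, one_mul]
    _ = (qc q)⁻¹ ^ 2 • (opZinv q a s * (qc q ^ 2 • (opZ q a s * opX q a s)) * opZinv q a s) := by
        rw [mul_smul_comm, smul_mul_assoc, smul_smul, ← mul_pow, inv_mul_cancel₀ h0, one_pow,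
          one_smul]
        simp only [mul_assoc]
    _ = _ := by rw [← opX_mul_opZ, mul_assoc, mul_assoc, opZ_mul_opZinv, mul_one]

theorem opY_mul_opZinv : opY q a s * opZinv q a s = qc q ^ 2 • (opZinv q a s * opY q a s) := by
  have h0 := qc_ne q
  calc opY q a s * opZinv q a s
      = opZinv q a s * opZ q a s * (opY q a s * opZinv q a s) := by
        rw [opZinv_mul_opZ, one_mul]
    _ = qc q ^ 2 • (opZinv q a s * ((qc q)⁻¹ ^ 2 • (opZ q a s * opY q a s)) * opZinv q a s) := by
        rw [mul_smul_comm, smul_mul_assoc, smul_smul, ← mul_pow, mul_inv_cancel₀ h0, one_pow,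
          one_smul]
        simp only [mul_assoc]
    _ = _ := by rw [← opY_mul_opZ, mul_assoc, mul_assoc, opZ_mul_opZinv, mul_one]

theorem inv_qc_sub_ne : (qc q)⁻¹ - qc q ≠ 0 := by
  rw [← neg_sub]
  exact neg_ne_zero.2 (qc_sub_ne q)

/-! ### The action of U_q(su(2)) on B implemented by operators on V_±. -/

/-- K is group-like, so both sides are multiplicative in b and the generators suffice; there it is
the commutation of X and Y with Z. -/
theorem piRep_act_K (b : Podles q a) : piRep q a s (Podles.act q a (Uq.K q) b) =
    opZinv q a s * piRep q a s b * opZ q a s := by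
  have h0 := qc_ne q
  induction b using Podles.induction with
  | hc c =>
    rw [Podles.act_algebraMap, Uq.counit_K, one_smul, AlgHom.commutes, ← Algebra.commutes,
      mul_assoc, opZinv_mul_opZ, mul_one]
  | hX =>
    rw [Podles.act_K_X, map_smul, piRep_X, mul_assoc, opX_mul_opZ, mul_smul_comm, ← mul_assoc,
      opZinv_mul_opZ, one_mul]
  | hY =>
    rw [Podles.act_K_Y, map_smul, piRep_Y, mul_assoc, opY_mul_opZ, mul_smul_comm, ← mul_assoc,
      opZinv_mul_opZ, one_mul]
  | hZ => rw [Podles.act_K_Z, piRep_Z, opZinv_mul_opZ, one_mul]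
  | ha b c hb hc => simp only [map_add, hb, hc, mul_add, add_mul]
  | hm b c hb hc =>
    rw [Podles.act_K_mul, map_mul, map_mul, hb, hc]
    calc opZinv q a s * piRep q a s b * opZ q a s * (opZinv q a s * piRep q a s c * opZ q a s)
        = opZinv q a s * piRep q a s b * (opZ q a s * opZinv q a s) * piRep q a s c * opZ q a s := by
          simp only [mul_assoc]
      _ = _ := by rw [opZ_mul_opZinv, mul_one]; simp only [mul_assoc]

theorem piRep_act_Ki (b : Podles q a) : piRep q a s (Podles.act q a (Uq.Ki q) b) =
    opZ q a s * piRep q a s b * opZinv q a s := by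
  have h := piRep_act_K q a s (Podles.act q a (Uq.Ki q) b)
  rw [Podles.act_K_Ki] at h
  rw [h]
  calc _ = 1 * piRep q a s (Podles.act q a (Uq.Ki q) b) * 1 := by rw [one_mul, mul_one]
    _ = _ := by rw [← opZ_mul_opZinv q a s]; simp only [mul_assoc]

/-- The map D(b) = Z⁻¹ [X, b] satisfies D(bc) = D(b) c + (Z⁻¹ b Z) D(c). Since Z⁻¹ b Z implements K
▷ b, this is the Leibniz rule coming from Δ(E) = E ⊗ 1 + K ⊗ E, and agreement on generators is
enough. -/
theorem smul_piRep_act_E (b : Podles q a) :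
    ((qc q)⁻¹ - qc q) • piRep q a s (Podles.act q a (Uq.E q) b) =
      (qh q)⁻¹ • (opZinv q a s * (opX q a s * piRep q a s b - piRep q a s b * opX q a s)) := by
  have h0 := qc_ne q
  have h1 := qh_ne q
  have h2 := qh_sq q
  induction b using Podles.induction with
  | hc c => rw [Podles.act_algebraMap, Uq.counit_E, AlgHom.commutes, Algebra.commutes]; simp
  | hX => simp [Podles.act_E_X, piRep_X]
  | hY =>
    simp only [Podles.act_E_Y, map_smul, map_add, map_one, piRep_Y, piRep_Z, opX_mul_opY,
      opY_mul_opX, mul_sub, mul_smul_comm, ← mul_assoc, opZinv_mul_opZ, one_mul, mul_one]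
    match_scalars <;> field_simp <;> ring
  | hZ =>
    simp only [Podles.act_E_Z, map_smul, map_neg, piRep_X, piRep_Z, opX_mul_opZ, mul_sub,
      mul_smul_comm, ← mul_assoc, opZinv_mul_opZ, one_mul]
    rw [← h2]
    match_scalars
    field_simp
    ring
  | ha b c hb hc =>
    simp only [map_add, smul_add, hb, hc, mul_add, add_mul, mul_sub]
    module
  | hm b c hb hc =>
    rw [Podles.act_E_mul, map_add, map_mul, map_mul, map_mul, piRep_act_K, smul_add,
      ← smul_mul_assoc, hb, ← mul_smul_comm ((qc q)⁻¹ - qc q), hc]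
    simp only [smul_mul_assoc, mul_smul_comm, ← smul_add]
    congr 1
    -- The Z supplied by K ▷ b meets the Z⁻¹ in front of the second commutator; after it cancels,
    -- the inner terms b X c cancel too.
    calc _ = opZinv q a s * (opX q a s * piRep q a s b - piRep q a s b * opX q a s) * piRep q a s c +
          opZinv q a s * piRep q a s b * (opZ q a s * opZinv q a s) *
            (opX q a s * piRep q a s c - piRep q a s c * opX q a s) := by
          simp only [mul_assoc]
      _ = _ := by rw [opZ_mul_opZinv]; noncomm_ring

/-- Mirror image of the formula for E: D(b) = [Y, b] Z⁻¹ satisfies D(bc) = D(b) (Z c Z⁻¹) + b D(c),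
and Z c Z⁻¹ implements K⁻¹ ▷ c, which matches Δ(F) = F ⊗ K⁻¹ + 1 ⊗ F. -/
theorem smul_piRep_act_F (b : Podles q a) :
    ((qc q)⁻¹ - qc q) • piRep q a s (Podles.act q a (Uq.F q) b) =
      (qh q)⁻¹ • ((opY q a s * piRep q a s b - piRep q a s b * opY q a s) * opZinv q a s) := by
  have h0 := qc_ne q
  have h1 := qh_ne q
  have h2 := qh_sq q
  induction b using Podles.induction with
  | hc c => rw [Podles.act_algebraMap, Uq.counit_F, AlgHom.commutes, Algebra.commutes]; simp
  | hY => simp [Podles.act_F_Y, piRep_Y]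
  | hX =>
    simp only [Podles.act_F_X, map_smul, map_add, map_one, map_neg, piRep_X, piRep_Z, opX_mul_opY,
      opY_mul_opX, sub_mul, smul_mul_assoc, mul_assoc, opZ_mul_opZinv, one_mul, mul_one]
    match_scalars <;> field_simp <;> ring
  | hZ =>
    simp only [Podles.act_F_Z, map_smul, piRep_Y, piRep_Z, opZ_mul_opY, sub_mul, smul_mul_assoc,
      mul_assoc, opZ_mul_opZinv, mul_one]
    rw [← h2]
    match_scalars
    field_simp
  | ha b c hb hc =>
    simp only [map_add, smul_add, hb, hc, mul_add, add_mul, sub_mul]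
    module
  | hm b c hb hc =>
    rw [Podles.act_F_mul, map_add, map_mul, map_mul, map_mul, piRep_act_Ki, smul_add,
      ← smul_mul_assoc, hb, ← mul_smul_comm ((qc q)⁻¹ - qc q), hc]
    simp only [smul_mul_assoc, mul_smul_comm, ← smul_add]
    congr 1
    calc _ = (opY q a s * piRep q a s b - piRep q a s b * opY q a s) * (opZinv q a s * opZ q a s) *
            piRep q a s c * opZinv q a s +
          piRep q a s b * (opY q a s * piRep q a s c - piRep q a s c * opY q a s) *
            opZinv q a s := by
          simp only [mul_assoc]
      _ = _ := by rw [opZinv_mul_opZ]; noncomm_ring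

/-! ### The representation of the Heisenberg double on V_± ⊗ V_±. -/

theorem tensorEnd_mul (A B C D : Module.End ℂ V) :
    tensorEnd A B * tensorEnd C D = tensorEnd (A * C) (B * D) :=
  (TensorProduct.map_mul A C B D).symm

theorem tensorEnd_one : tensorEnd 1 1 = 1 := TensorProduct.map_one

theorem tensorEnd_add_left (A A' B : Module.End ℂ V) :
    tensorEnd (A + A') B = tensorEnd A B + tensorEnd A' B := TensorProduct.map_add_left A A' B

theorem tensorEnd_add_right (A B B' : Module.End ℂ V) :
    tensorEnd A (B + B') = tensorEnd A B + tensorEnd A B' := TensorProduct.map_add_right A B B'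

theorem tensorEnd_smul_left (c : ℂ) (A B : Module.End ℂ V) :
    tensorEnd (c • A) B = c • tensorEnd A B := TensorProduct.map_smul_left c A B

theorem tensorEnd_smul_right (c : ℂ) (A B : Module.End ℂ V) :
    tensorEnd A (c • B) = c • tensorEnd A B := TensorProduct.map_smul_right c A B

theorem tensorEnd_sub_left (A A' B : Module.End ℂ V) :
    tensorEnd (A - A') B = tensorEnd A B - tensorEnd A' B := by
  rw [eq_sub_iff_add_eq, ← tensorEnd_add_left, sub_add_cancel]

theorem tensorEnd_sub_right (A B B' : Module.End ℂ V) :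
    tensorEnd A (B - B') = tensorEnd A B - tensorEnd A B' := by
  rw [eq_sub_iff_add_eq, ← tensorEnd_add_right, sub_add_cancel]

/-- The representation of the Podleś sphere on the first factor of `V_± ⊗ V_±`. -/
def repB : Podles q a →ₐ[ℂ] Module.End ℂ (V ⊗[ℂ] V) :=
  AlgHom.ofLinearMap
    { toFun := fun b => tensorEnd (piRep q a s b) 1
      map_add' := fun b c => by rw [map_add, tensorEnd_add_left]
      map_smul' := fun c b => by rw [map_smul, tensorEnd_smul_left, RingHom.id_apply] }
    (by simp [tensorEnd_one])
    (fun b c => by simp [tensorEnd_mul])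

theorem repB_apply (b : Podles q a) : repB q a s b = tensorEnd (piRep q a s b) 1 := rfl

/-- The operator `(q⁻¹ - q) E` on `V_± ⊗ V_±`. -/
def scaledE : Module.End ℂ (V ⊗[ℂ] V) :=
  (qh q)⁻¹ • tensorEnd (opZinv q a s * opX q a s) 1 - qh q • tensorEnd (opZinv q a s) (opY q a s)

/-- The operator `(q⁻¹ - q) F` on `V_± ⊗ V_±`. -/
def scaledF : Module.End ℂ (V ⊗[ℂ] V) :=
  (qh q)⁻¹ • tensorEnd (opY q a s) (opZinv q a s) - qh q • tensorEnd 1 (opX q a s * opZinv q a s)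

theorem opZinv_mul_opZ_assoc (A : Module.End ℂ V) : opZinv q a s * (opZ q a s * A) = A := by
  rw [← mul_assoc, opZinv_mul_opZ, one_mul]

theorem opZ_mul_opZinv_assoc (A : Module.End ℂ V) : opZ q a s * (opZinv q a s * A) = A := by
  rw [← mul_assoc, opZ_mul_opZinv, one_mul]

/-- Each summand of E has weight q² under conjugation by Z⁻¹ ⊗ Z: the first because Z⁻¹ X Z = q² X,
the second because Z Y Z⁻¹ = q² Y. -/
theorem tensorEnd_K_mul_scaledE : tensorEnd (opZinv q a s) (opZ q a s) * scaledE q a s =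
    qc q ^ 2 • (scaledE q a s * tensorEnd (opZinv q a s) (opZ q a s)) := by
  have h0 := qc_ne q
  simp only [scaledE, mul_sub, sub_mul, mul_smul_comm, smul_mul_assoc, tensorEnd_mul, mul_one,
    one_mul, mul_assoc, opX_mul_opZinv, opZ_mul_opY, tensorEnd_smul_left, tensorEnd_smul_right]
  match_scalars <;> field_simp

theorem tensorEnd_K_mul_scaledF : tensorEnd (opZinv q a s) (opZ q a s) * scaledF q a s =
    (qc q ^ 2)⁻¹ • (scaledF q a s * tensorEnd (opZinv q a s) (opZ q a s)) := by
  have h0 := qc_ne q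
  simp only [scaledF, mul_sub, sub_mul, mul_smul_comm, smul_mul_assoc, tensorEnd_mul, mul_one,
    one_mul, mul_assoc, opX_mul_opZinv, opY_mul_opZinv, opZ_mul_opZinv, opZinv_mul_opZ,
    opZ_mul_opZinv_assoc, opX_mul_opZ, opZinv_mul_opZ_assoc, tensorEnd_smul_left,
    tensorEnd_smul_right]
  match_scalars <;> field_simp

/-- Two of the four commutators vanish: Z⁻¹X ⊗ 1 and 1 ⊗ XZ⁻¹ act on different legs, and for Z⁻¹ ⊗ Y
and Y ⊗ Z⁻¹ the factors q² of the two legs balance. In the other two the terms with t drop out,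
leaving multiples of (Z + Z⁻¹) ⊗ Z⁻¹ and Z⁻¹ ⊗ (Z + Z⁻¹) with opposite coefficients, so Z⁻¹ ⊗ Z⁻¹
cancels. -/
theorem scaledE_mul_scaledF_sub : scaledE q a s * scaledF q a s - scaledF q a s * scaledE q a s =
    ((qc q)⁻¹ - qc q) • (tensorEnd (opZ q a s) (opZinv q a s) -
      tensorEnd (opZinv q a s) (opZ q a s)) := by
  have h0 := qc_ne q
  have h1 := qh_ne q
  have h2 := qh_sq q
  have e1 : opY q a s * (opZinv q a s * opX q a s) =
      qc q ^ 2 • (opZinv q a s * (opY q a s * opX q a s)) := by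
    rw [← mul_assoc, opY_mul_opZinv, smul_mul_assoc, mul_assoc]
  simp only [scaledE, scaledF, mul_sub, sub_mul, mul_smul_comm, smul_mul_assoc, tensorEnd_mul,
    mul_one, one_mul, mul_assoc, e1, opX_mul_opY, opY_mul_opX, opZinv_mul_opZ_assoc,
    opZinv_mul_opZ, opY_mul_opZinv, tensorEnd_smul_left, tensorEnd_smul_right,
    tensorEnd_sub_left, tensorEnd_sub_right, smul_sub, opX_mul_opZinv]
  rw [← h2]
  match_scalars <;> field_simp <;> ring

/-- The representation of `U_q(su(2))` on `V_± ⊗ V_±`. -/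
def repU : Uq q →ₐ[ℂ] Module.End ℂ (V ⊗[ℂ] V) :=
  Uq.lift (tensorEnd (opZinv q a s) (opZ q a s)) (tensorEnd (opZ q a s) (opZinv q a s))
    (((qc q)⁻¹ - qc q)⁻¹ • scaledE q a s) (((qc q)⁻¹ - qc q)⁻¹ • scaledF q a s)
    (by rw [tensorEnd_mul, opZ_mul_opZinv, opZinv_mul_opZ, tensorEnd_one])
    (by rw [tensorEnd_mul, opZ_mul_opZinv, opZinv_mul_opZ, tensorEnd_one])
    (by rw [mul_smul_comm, tensorEnd_K_mul_scaledE, smul_mul_assoc, smul_comm])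
    (by rw [mul_smul_comm, tensorEnd_K_mul_scaledF, smul_mul_assoc, smul_comm])
    (by
      have h := inv_qc_sub_ne q
      have e := scaledE_mul_scaledF_sub q a s
      rw [← neg_sub (qc q)⁻¹, smul_mul_smul_comm, smul_mul_smul_comm]
      -- Only d ≠ 0 matters from here: the scaled commutator identity is divided by d², one factor
      -- each for E and F.
      generalize (qc q)⁻¹ - qc q = d at h e
      linear_combination (norm := skip) (d⁻¹ * d⁻¹) • e
      match_scalars <;> field_simp <;> ring)

theorem repU_K : repU q a s (Uq.K q) = tensorEnd (opZinv q a s) (opZ q a s) := Uq.lift_K ..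
theorem repU_Ki : repU q a s (Uq.Ki q) = tensorEnd (opZ q a s) (opZinv q a s) := Uq.lift_Ki ..
theorem smul_repU_E : ((qc q)⁻¹ - qc q) • repU q a s (Uq.E q) = scaledE q a s := by
  rw [repU, Uq.lift_E, smul_inv_smul₀ (inv_qc_sub_ne q)]
theorem smul_repU_F : ((qc q)⁻¹ - qc q) • repU q a s (Uq.F q) = scaledF q a s := by
  rw [repU, Uq.lift_F, smul_inv_smul₀ (inv_qc_sub_ne q)]

/-- The map `u ⊗ v ↦ (u ▷ b) v` in the representation on `V_± ⊗ V_±`. -/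
def crossMap (b : Podles q a) : Uq q ⊗[ℂ] Uq q →ₗ[ℂ] Module.End ℂ (V ⊗[ℂ] V) :=
  TensorProduct.lift ((LinearMap.mul ℂ (Module.End ℂ (V ⊗[ℂ] V))).compl₁₂
    ((repB q a s).toLinearMap ∘ₗ (Podles.actHom q a).toLinearMap.flip b) (repU q a s).toLinearMap)

theorem crossMap_tmul (b : Podles q a) (u v : Uq q) : crossMap q a s b (u ⊗ₜ v) =
    repB q a s (Podles.act q a u b) * repU q a s v := rfl

/-- Operators on the second leg commute with π(b) ⊗ 1, so for K, E, F the cross relation only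
compares first legs, where it is the implementing formula for the action. For products, x (y b) = x
(y₁ ▷ b) y₂ = (x₁ y₁ ▷ b) x₂ y₂. -/
theorem repU_mul_repB (x : Uq q) (b : Podles q a) :
    repU q a s x * repB q a s b = crossMap q a s b (Coalgebra.comul (R := ℂ) x) := by
  have h0 := inv_qc_sub_ne q
  -- The product case applies the claim for x to y₁ ▷ b, so b has to vary.
  induction x using Uq.induction generalizing b with
  | hc c =>
    have e : Coalgebra.comul (R := ℂ) (algebraMap ℂ (Uq q) c) = algebraMap ℂ (Uq q) c ⊗ₜ 1 := by
      simp
    rw [e, crossMap_tmul, map_one, mul_one, AlgHom.commutes, Algebra.algebraMap_eq_smul_one,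
      Algebra.algebraMap_eq_smul_one, ← Podles.actHom_apply, map_smul, map_one,
      LinearMap.smul_apply, Module.End.one_apply, map_smul, smul_mul_assoc, one_mul]
  | hK =>
    rw [Uq.comul_K, crossMap_tmul, repU_K, repB_apply, repB_apply, tensorEnd_mul, tensorEnd_mul,
      piRep_act_K, mul_assoc, opZ_mul_opZinv, mul_one, mul_one, one_mul]
  | hKi =>
    rw [Uq.comul_Ki, crossMap_tmul, repU_Ki, repB_apply, repB_apply, tensorEnd_mul, tensorEnd_mul,
      piRep_act_Ki, mul_assoc, opZinv_mul_opZ, mul_one, mul_one, one_mul]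
  | hE =>
    -- Multiplying by q⁻¹ - q ≠ 0 replaces E by its explicit scaled form and the action of E by a
    -- commutator.
    refine smul_right_injective _ h0 ?_
    change ((qc q)⁻¹ - qc q) • _ = ((qc q)⁻¹ - qc q) • _
    rw [Uq.comul_E, map_add, crossMap_tmul, crossMap_tmul, map_one, mul_one, smul_add,
      ← smul_mul_assoc, ← mul_smul_comm, smul_repU_E]
    simp only [repB_apply, piRep_act_K]
    rw [← tensorEnd_smul_left, smul_piRep_act_E]
    simp only [scaledE, mul_sub, sub_mul, smul_mul_assoc, mul_smul_comm, tensorEnd_mul,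
      tensorEnd_smul_left, tensorEnd_sub_left, smul_sub, mul_one, one_mul, mul_assoc,
      opZ_mul_opZinv, opZ_mul_opZinv_assoc]
    module
  | hF =>
    refine smul_right_injective _ h0 ?_
    change ((qc q)⁻¹ - qc q) • _ = ((qc q)⁻¹ - qc q) • _
    rw [Uq.comul_F, map_add, crossMap_tmul, crossMap_tmul, Podles.act_one, smul_add,
      ← smul_mul_assoc, ← smul_mul_assoc, ← mul_smul_comm, smul_repU_F, repU_Ki]
    simp only [repB_apply]
    rw [← tensorEnd_smul_left, smul_piRep_act_F]
    simp only [scaledF, mul_sub, sub_mul, smul_mul_assoc, mul_smul_comm, tensorEnd_mul,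
      tensorEnd_smul_left, tensorEnd_sub_left, smul_sub, mul_one, one_mul, mul_assoc,
      opZinv_mul_opZ]
    module
  | ha x y hx hy => simp only [map_add, add_mul, hx, hy]
  | hm x y hx hy =>
    have Rx := Coalgebra.Repr.arbitrary ℂ x
    have Ry := Coalgebra.Repr.arbitrary ℂ y
    have h : ∀ c, repU q a s x * repB q a s c = ∑ i ∈ Rx.index,
        repB q a s (Podles.act q a (Rx.left i) c) * repU q a s (Rx.right i) := fun c => by
      rw [hx, ← Rx.eq, map_sum]
      exact Finset.sum_congr rfl fun i _ => crossMap_tmul ..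
    have h' : repU q a s y * repB q a s b = ∑ i ∈ Ry.index,
        repB q a s (Podles.act q a (Ry.left i) b) * repU q a s (Ry.right i) := by
      rw [hy, ← Ry.eq, map_sum]
      exact Finset.sum_congr rfl fun i _ => crossMap_tmul ..
    rw [Bialgebra.comul_mul, ← Rx.eq, ← Ry.eq, Finset.sum_mul_sum, Finset.sum_comm, map_mul,
      mul_assoc, h', Finset.mul_sum, map_sum]
    refine Finset.sum_congr rfl fun j _ => ?_
    rw [← mul_assoc, h, Finset.sum_mul, map_sum]
    refine Finset.sum_congr rfl fun i _ => ?_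
    rw [Algebra.TensorProduct.tmul_mul_tmul, crossMap_tmul, map_mul, Podles.act_mul_left,
      mul_assoc]

/-- The representation `π̃_±` of the Heisenberg double on `V_± ⊗ V_±`. -/
def repW : Heis q a →ₐ[ℂ] Module.End ℂ (V ⊗[ℂ] V) :=
  Heis.lift (repB q a s) (repU q a s) fun x b n u v h => by
    rw [repU_mul_repB, h, map_sum]
    exact Finset.sum_congr rfl fun i _ => crossMap_tmul ..

theorem repW_ofB (b : Podles q a) : repW q a s (Heis.ofB q a b) = repB q a s b := Heis.lift_ofB ..
theorem repW_ofU (x : Uq q) : repW q a s (Heis.ofU q a x) = repU q a s x := Heis.lift_ofU ..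

end Operators

/-! ### Formal adjoints: the representation on V_± ⊗ V_± respects the star. -/

section Adjoint

theorem W_hom_ext {M : Type} [AddCommMonoid M] [Module ℂ M] {f g : V ⊗[ℂ] V →ₗ[ℂ] M}
    (h : ∀ m n, f (V.basis m ⊗ₜ V.basis n) = g (V.basis m ⊗ₜ V.basis n)) : f = g :=
  TensorProduct.ext <| V.hom_ext fun m => V.hom_ext fun n => h m n

theorem inclW_tmul_apply (s : Sgn) (v w : V) (m n : ℕ) :
    inclW s (v ⊗ₜ w) (s, m, n) = V.coord m v * V.coord n w := by
  let ev : L2 →ₗ[ℂ] ℂ :=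
    { toFun := fun f => f (s, m, n), map_add' := fun f g => rfl, map_smul' := fun c f => rfl }
  have h : ev ∘ₗ inclW s = LinearMap.mul' ℂ ℂ ∘ₗ TensorProduct.map (V.coord m) (V.coord n) := by
    refine W_hom_ext fun k l => ?_
    change inclW s (V.basis k ⊗ₜ V.basis l) (s, m, n) = V.coord m (V.basis k) * V.coord n (V.basis l)
    rw [inclW_basis, V.coord_basis, V.coord_basis, lp.single_apply]
    by_cases hk : k = m <;> by_cases hl : l = n <;>
      simp [hk, hl, Prod.mk.injEq, Ne.symm]
  exact LinearMap.congr_fun h (v ⊗ₜ w)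

/-- Pairing with an orthonormal basis vector reads off a coordinate; this holds for every f in the
Hilbert space, in particular for the infinite sums Λ(b). -/
theorem inner_inclW_basis (s : Sgn) (m n : ℕ) (f : L2) :
    inner ℂ (inclW s (V.basis m ⊗ₜ V.basis n)) f = f (s, m, n) := by
  rw [inclW_basis, lp.inner_single_left]
  simp

theorem inner_inclW_tmul_basis (s : Sgn) (v w : V) (m n : ℕ) :
    inner ℂ (inclW s (v ⊗ₜ w)) (inclW s (V.basis m ⊗ₜ V.basis n)) =
      star (V.coord m v * V.coord n w) := by
  rw [← inner_conj_symm, inner_inclW_basis, inclW_tmul_apply]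
  rfl

/-- Two conjugate-linear functionals `⟨inclW s (A η), f⟩` and `⟨inclW s η, g⟩` agree when they agree
on the basis. -/
theorem inner_inclW_ext {s : Sgn} {A : Module.End ℂ (V ⊗[ℂ] V)} {f g : L2}
    (h : ∀ m n, inner ℂ (inclW s (A (V.basis m ⊗ₜ V.basis n))) f =
      inner ℂ (inclW s (V.basis m ⊗ₜ V.basis n)) g) (η : V ⊗[ℂ] V) :
    inner ℂ (inclW s (A η)) f = inner ℂ (inclW s η) g := by
  -- Both sides are conjugate-linear in η. Exchanging the arguments of the inner product conjugates
  -- them into linear maps, to which extensionality on the basis applies.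
  have e : (innerSL ℂ f).toLinearMap ∘ₗ inclW s ∘ₗ A = (innerSL ℂ g).toLinearMap ∘ₗ inclW s :=
    W_hom_ext fun m n => by
      have := congrArg star (h m n)
      simpa using this
  have := congrArg star (LinearMap.congr_fun e η)
  simpa using this

/-- The operators `A` and `A'` on `V` have adjoint matrices. -/
def VAdj (A A' : Module.End ℂ V) : Prop :=
  ∀ m n, star (V.coord n (A (V.basis m))) = V.coord m (A' (V.basis n))

/-- The operators `A` and `A'` on `V ⊗ V` are formally adjoint. -/
def WAdj (s : Sgn) (A A' : Module.End ℂ (V ⊗[ℂ] V)) : Prop :=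
  ∀ η ζ, inner ℂ (inclW s (A η)) (inclW s ζ) = inner ℂ (inclW s η) (inclW s (A' ζ))

namespace VAdj

variable {A A' B B' : Module.End ℂ V}

theorem symm (h : VAdj A A') : VAdj A' A := fun m n => by rw [← h, star_star]

theorem add (h : VAdj A A') (k : VAdj B B') : VAdj (A + B) (A' + B') := fun m n => by
  simp only [LinearMap.add_apply, map_add, star_add, h m n, k m n]

theorem algebraMap (c : ℂ) : VAdj (algebraMap ℂ _ c) (algebraMap ℂ _ (star c)) := fun m n => by
  rw [Module.algebraMap_end_apply, Module.algebraMap_end_apply, map_smul, map_smul, V.coord_basis,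
    V.coord_basis]
  by_cases h : m = n <;> simp [h, eq_comm]

theorem coord_eq_sum (h : VAdj A A') (m : ℕ) (v : V) :
    V.coord m (A' v) = ∑ p ∈ v.supp, star (V.coord p (A (V.basis m))) * V.coord p v := by
  rw [V.map_eq, map_sum]
  refine Finset.sum_congr rfl fun p _ => ?_
  rw [map_smul, h m p, smul_eq_mul, mul_comm]

/-- The summand vanishes unless p lies in the supports of both v and A ξ_m, so either support may
index the sum. The second choice makes the two expansions in the product rule run over one finite
set. -/
theorem coord_eq_sum' (h : VAdj A A') (m : ℕ) (v : V) :
    V.coord m (A' v) =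
      ∑ p ∈ (A (V.basis m)).supp, star (V.coord p (A (V.basis m))) * V.coord p v := by
  have h0 : ∀ (w : V) p, p ∉ w.supp → V.coord p w = 0 := fun w p hp =>
    Finsupp.notMem_support_iff.1 hp
  rw [h.coord_eq_sum]
  trans ∑ p ∈ v.supp ∪ (A (V.basis m)).supp, star (V.coord p (A (V.basis m))) * V.coord p v
  · refine Finset.sum_subset Finset.subset_union_left fun p _ hp => ?_
    rw [h0 _ p hp, mul_zero]
  · refine (Finset.sum_subset Finset.subset_union_right fun p _ hp => ?_).symm
    rw [h0 _ p hp, star_zero, zero_mul]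

theorem mul (h : VAdj A A') (k : VAdj B B') : VAdj (A * B) (B' * A') := fun m n => by
  -- Both coefficients are expanded over the support of B ξ_m, after which they agree term by term.
  rw [Module.End.mul_apply, Module.End.mul_apply, k.coord_eq_sum', h.symm.coord_eq_sum, star_sum]
  refine Finset.sum_congr rfl fun p _ => ?_
  rw [star_mul', star_star, mul_comm]

/-- On elementary basis tensors both inner products factor into the matrix coefficients of the two
legs. The reduction to basis tensors is made first in η and then in ζ. -/
theorem tensorEnd (h : VAdj A A') (k : VAdj B B') (s : Sgn) :
    WAdj s (tensorEnd A B) (QuantumSphere.tensorEnd A' B') := by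
  intro η ζ
  refine inner_inclW_ext (A := QuantumSphere.tensorEnd A B) (fun m n => ?_) η
  rw [inner_inclW_basis]
  change inner ℂ (inclW s (A (V.basis m) ⊗ₜ B (V.basis n))) (inclW s ζ) = _
  let ev : L2 →ₗ[ℂ] ℂ :=
    { toFun := fun f => f (s, m, n), map_add' := fun f g => rfl, map_smul' := fun c f => rfl }
  have e : (innerSL ℂ (inclW s (A (V.basis m) ⊗ₜ B (V.basis n)))).toLinearMap ∘ₗ inclW s =
      ev ∘ₗ inclW s ∘ₗ QuantumSphere.tensorEnd A' B' := by
    refine W_hom_ext fun i j => ?_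
    change inner ℂ (inclW s (A (V.basis m) ⊗ₜ B (V.basis n)))
      (inclW s (V.basis i ⊗ₜ V.basis j)) =
      inclW s (A' (V.basis i) ⊗ₜ B' (V.basis j)) (s, m, n)
    rw [inner_inclW_tmul_basis, inclW_tmul_apply, ← h, ← k, star_mul']
  exact LinearMap.congr_fun e ζ

end VAdj

namespace WAdj

variable {s : Sgn} {A A' B B' : Module.End ℂ (V ⊗[ℂ] V)}

theorem add (h : WAdj s A A') (k : WAdj s B B') : WAdj s (A + B) (A' + B') := fun η ζ => by
  simp only [LinearMap.add_apply, map_add, inner_add_left, inner_add_right, h η ζ, k η ζ]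

theorem smul (c : ℂ) (h : WAdj s A A') : WAdj s (c • A) (star c • A') := fun η ζ => by
  simp only [LinearMap.smul_apply, map_smul, inner_smul_left, inner_smul_right, h η ζ]
  rfl

theorem sub (h : WAdj s A A') (k : WAdj s B B') : WAdj s (A - B) (A' - B') := fun η ζ => by
  simp only [LinearMap.sub_apply, map_sub, inner_sub_left, inner_sub_right, h η ζ, k η ζ]

theorem mul (h : WAdj s A A') (k : WAdj s B B') : WAdj s (A * B) (B' * A') := fun η ζ => by
  rw [Module.End.mul_apply, h, k, Module.End.mul_apply]

theorem algebraMap (c : ℂ) : WAdj s (algebraMap ℂ _ c) (algebraMap ℂ _ (star c)) := fun η ζ => by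
  simp only [Module.algebraMap_end_apply, map_smul, inner_smul_left, inner_smul_right]
  rfl

/-- Allows adjointness of E and F to be checked on their multiples by the real number q⁻¹ - q. -/
theorem of_smul {c : ℂ} (hc : c ≠ 0) (h : WAdj s (c • A) (star c • A')) : WAdj s A A' := by
  have := h.smul c⁻¹
  rwa [inv_smul_smul₀ hc, star_inv₀, inv_smul_smul₀ (star_ne_zero.2 hc)] at this

end WAdj

variable (q : Param) (a : ℝ) (s : Sgn)

theorem vAdj_opZ : VAdj (opZ q a s) (opZ q a s) := fun m n => by
  rw [opZ_basis, opZ_basis, map_smul, map_smul, V.coord_basis, V.coord_basis]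
  by_cases h : m = n
  · simp [h, zc]
  · simp [h, Ne.symm h]

theorem vAdj_opZinv : VAdj (opZinv q a s) (opZinv q a s) := fun m n => by
  rw [opZinv_basis, opZinv_basis, map_smul, map_smul, V.coord_basis, V.coord_basis]
  by_cases h : m = n
  · simp [h, zc]
  · simp [h, Ne.symm h]

theorem vAdj_opY : VAdj (opY q a s) (opX q a s) := fun m n => by
  rw [opX_basis, opY_basis, map_smul, map_smul, V.coord_basis, V.coord_basis]
  cases n with
  -- Truncated subtraction sends X ξ_0 to a multiple of ξ_0, but the coefficient u_0 is 0, as the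
  -- annihilation of ξ_0 requires.
  | zero => simp [uc_zero]
  | succ n =>
    by_cases h : m = n
    · simp [h, uc]
    · simp [h, Ne.symm h]

theorem vAdj_opX : VAdj (opX q a s) (opY q a s) := (vAdj_opY q a s).symm

theorem vAdj_one : VAdj 1 1 := by simpa using VAdj.algebraMap 1

theorem vAdj_piRep (b : Podles q a) : VAdj (piRep q a s b) (piRep q a s (star b)) := by
  induction b using Podles.induction with
  | hc c =>
    rw [Podles.star_algebraMap, AlgHom.commutes, AlgHom.commutes]
    exact VAdj.algebraMap c
  | hX => rw [Podles.star_X, piRep_X, piRep_Y]; exact vAdj_opX q a s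
  | hY => rw [Podles.star_Y, piRep_X, piRep_Y]; exact vAdj_opY q a s
  | hZ => rw [Podles.star_Z, piRep_Z]; exact vAdj_opZ q a s
  | ha b c hb hc => rw [star_add, map_add, map_add]; exact hb.add hc
  | hm b c hb hc => rw [star_mul, map_mul, map_mul]; exact hb.mul hc

theorem star_inv_qh : star (qh q)⁻¹ = (qh q)⁻¹ := by rw [star_inv₀, Podles.conj_qh]

theorem star_qc : star (qc q) = qc q := conj_qc q

theorem star_inv_qc_sub : star ((qc q)⁻¹ - qc q) = (qc q)⁻¹ - qc q := by
  rw [star_sub, star_inv₀, star_qc]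

/-- E* = FK. The Z of K on the second leg cancels the Z⁻¹ there, leaving the legwise adjoint of the
formula for E. -/
theorem smul_repU_F_mul_K : ((qc q)⁻¹ - qc q) • repU q a s (Uq.F q * Uq.K q) =
    (qh q)⁻¹ • tensorEnd (opY q a s * opZinv q a s) 1 -
      qh q • tensorEnd (opZinv q a s) (opX q a s) := by
  rw [map_mul, ← smul_mul_assoc, smul_repU_F, repU_K, scaledF]
  simp only [sub_mul, smul_mul_assoc, tensorEnd_mul, opZinv_mul_opZ, mul_assoc, one_mul, mul_one]

/-- F* = K⁻¹E. The Z of K⁻¹ on the first leg cancels the Z⁻¹ there, leaving the legwise adjoint of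
the formula for F. -/
theorem smul_repU_Ki_mul_E : ((qc q)⁻¹ - qc q) • repU q a s (Uq.Ki q * Uq.E q) =
    (qh q)⁻¹ • tensorEnd (opX q a s) (opZinv q a s) -
      qh q • tensorEnd 1 (opZinv q a s * opY q a s) := by
  rw [map_mul, ← mul_smul_comm, smul_repU_E, repU_Ki, scaledE]
  simp only [mul_sub, mul_smul_comm, tensorEnd_mul, opZ_mul_opZinv, opZ_mul_opZinv_assoc,
    mul_one]

/-- Adjoints are taken leg by leg, with Z self-adjoint and X* = Y; the scalars q^{±1/2} are real.
Products reverse on both sides, so generators suffice. -/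
theorem wAdj_repU (x : Uq q) : WAdj s (repU q a s x) (repU q a s (star x)) := by
  have h0 := inv_qc_sub_ne q
  induction x using Uq.induction with
  | hc c =>
    rw [Algebra.algebraMap_eq_smul_one, star_smul, star_one, ← Algebra.algebraMap_eq_smul_one,
      ← Algebra.algebraMap_eq_smul_one, AlgHom.commutes, AlgHom.commutes]
    exact WAdj.algebraMap c
  | hK => rw [Uq.star_K, repU_K]; exact (vAdj_opZinv q a s).tensorEnd (vAdj_opZ q a s) s
  | hKi => rw [Uq.star_Ki, repU_Ki]; exact (vAdj_opZ q a s).tensorEnd (vAdj_opZinv q a s) s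
  | hE =>
    refine WAdj.of_smul h0 ?_
    rw [star_inv_qc_sub, Uq.star_E, smul_repU_F_mul_K, smul_repU_E]
    have e := ((((vAdj_opZinv q a s).mul (vAdj_opX q a s)).tensorEnd vAdj_one s).smul (qh q)⁻¹).sub
      (((vAdj_opZinv q a s).tensorEnd (vAdj_opY q a s) s).smul (qh q))
    rwa [star_inv_qh, Podles.conj_qh] at e
  | hF =>
    refine WAdj.of_smul h0 ?_
    rw [star_inv_qc_sub, Uq.star_F, smul_repU_Ki_mul_E, smul_repU_F]
    have e := ((((vAdj_opY q a s).tensorEnd (vAdj_opZinv q a s) s).smul (qh q)⁻¹).sub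
      ((vAdj_one.tensorEnd ((vAdj_opX q a s).mul (vAdj_opZinv q a s)) s).smul (qh q)))
    rwa [star_inv_qh, Podles.conj_qh] at e
  | ha x y hx hy => rw [star_add, map_add, map_add]; exact hx.add hy
  | hm x y hx hy => rw [star_mul, map_mul, map_mul]; exact hx.mul hy

theorem wAdj_repW (x : Heis q a) : WAdj s (repW q a s x) (repW q a s (star x)) := by
  induction x using Heis.induction with
  | hB b =>
    rw [Heis.star_ofB, repW_ofB, repW_ofB]
    exact (vAdj_piRep q a s b).tensorEnd vAdj_one s
  | hU x => rw [Heis.star_ofU, repW_ofU, repW_ofU]; exact wAdj_repU q a s x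
  | ha x y hx hy => rw [star_add, map_add, map_add]; exact hx.add hy
  | hm x y hx hy => rw [star_mul, map_mul, map_mul]; exact hx.mul hy

end Adjoint

/-! ### Adjointness between the representation on V_± ⊗ V_± and the Heisenberg representation. -/

section GNSAdjoint

variable (q : Param) (a : ℝ) (s : Sgn)

/-- T is a multiple of |Z|, whose eigenvalues have ratio q², so T^{1/2} has ratio q. This factor
reconciles the coefficients q^{1/2} and q^{-1/2} of the formulas for E and F whenever the second
index shifts. -/
theorem sqrt_tval_succ (p : ℕ) :
    Real.sqrt (tval q a s (p + 1)) = (q : ℝ) * Real.sqrt (tval q a s p) := by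
  rw [sqrt_tval_eq, sqrt_tval_eq q a s p]
  ring

/-- The square root of the eigenvalue of `T` at `ξ_p`, as a complex number. -/
def rc (p : ℕ) : ℂ := ((Real.sqrt (tval q a s p) : ℝ) : ℂ)

theorem rc_succ (p : ℕ) : rc q a s (p + 1) = qc q * rc q a s p := by
  simp [rc, qc, sqrt_tval_succ]

theorem gns_eq (b : Podles q a) (m n : ℕ) :
    gns q a b (s, m, n) = rc q a s n * V.coord m (piRep q a s b (V.basis n)) := rfl

/-- The operator `A` on `W_±` and the operator `A'` on the Podleś sphere are adjoint with respect
to the GNS map. -/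
def GNSAdj (A : Module.End ℂ (V ⊗[ℂ] V)) (A' : Podles q a → Podles q a) : Prop :=
  ∀ η b, inner ℂ (inclW s (A η)) (gns q a b) = inner ℂ (inclW s η) (gns q a (A' b))

variable {q a s}

/-- Against ξ_m ⊗ ξ_n the right-hand side is one coordinate of Λ(A' b), so adjointness becomes an
identity between matrix coefficients. -/
theorem GNSAdj.of_basis {A : Module.End ℂ (V ⊗[ℂ] V)} {A' : Podles q a → Podles q a}
    (h : ∀ m n b, inner ℂ (inclW s (A (V.basis m ⊗ₜ V.basis n))) (gns q a b) =
      gns q a (A' b) (s, m, n)) : GNSAdj q a s A A' := fun η b =>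
  inner_inclW_ext (fun m n => by rw [h, inner_inclW_basis]) η

theorem coord_opX (m : ℕ) (v : V) : V.coord m (opX q a s v) = uc q a s (m + 1) * V.coord (m + 1) v := by
  have h : V.coord m ∘ₗ opX q a s = uc q a s (m + 1) • V.coord (m + 1) := V.hom_ext fun p => by
    cases p with
    | zero => simp [opX_basis, V.coord_basis, uc_zero]
    | succ p => by_cases e : p = m <;> simp [opX_basis, V.coord_basis, e]
  exact LinearMap.congr_fun h v

theorem coord_opZ (m : ℕ) (v : V) : V.coord m (opZ q a s v) = zc q a s m * V.coord m v := by
  have h : V.coord m ∘ₗ opZ q a s = zc q a s m • V.coord m := V.hom_ext fun p => by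
    by_cases e : p = m <;> simp [opZ_basis, V.coord_basis, e]
  exact LinearMap.congr_fun h v

theorem coord_opZinv (m : ℕ) (v : V) :
    V.coord m (opZinv q a s v) = (zc q a s m)⁻¹ * V.coord m v := by
  have h : V.coord m ∘ₗ opZinv q a s = (zc q a s m)⁻¹ • V.coord m := V.hom_ext fun p => by
    by_cases e : p = m <;> simp [opZinv_basis, V.coord_basis, e]
  exact LinearMap.congr_fun h v

theorem coord_opY (m : ℕ) (v : V) : V.coord m (opY q a s v) = uc q a s m * V.coord (m - 1) v := by
  have h : V.coord m ∘ₗ opY q a s = uc q a s m • V.coord (m - 1) := V.hom_ext fun p => by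
    -- For m = 0 the index m - 1 is truncated to 0, which is harmless because u_0 = 0.
    cases m with
    | zero => simp [opY_basis, V.coord_basis, uc_zero]
    | succ m => by_cases e : p = m <;> simp [opY_basis, V.coord_basis, e]
  exact LinearMap.congr_fun h v

namespace GNSAdj

variable {A B : Module.End ℂ (V ⊗[ℂ] V)} {A' B' : Module.End ℂ (Podles q a)}

theorem add (h : GNSAdj q a s A A') (k : GNSAdj q a s B B') :
    GNSAdj q a s (A + B) (A' + B' : Module.End ℂ (Podles q a)) := fun η b => by
  simp only [LinearMap.add_apply, map_add, inner_add_left, inner_add_right, h η b, k η b]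

theorem mul (h : GNSAdj q a s A A') (k : GNSAdj q a s B B') :
    GNSAdj q a s (A * B) (B' * A' : Module.End ℂ (Podles q a)) := fun η b => by
  rw [Module.End.mul_apply, h, k, Module.End.mul_apply]

theorem smul (c : ℂ) (h : GNSAdj q a s A A') :
    GNSAdj q a s (c • A) (star c • A' : Module.End ℂ (Podles q a)) := fun η b => by
  simp only [LinearMap.smul_apply, map_smul, inner_smul_left, inner_smul_right, h η b]
  rfl

theorem of_smul {c : ℂ} (hc : c ≠ 0)
    (h : GNSAdj q a s (c • A) (star c • A' : Module.End ℂ (Podles q a))) : GNSAdj q a s A A' := by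
  have := h.smul c⁻¹
  rwa [inv_smul_smul₀ hc, star_inv₀, inv_smul_smul₀ (star_ne_zero.2 hc)] at this

/-- The form used for E and F: both sides are scaled by the real number q⁻¹ - q, so that the
denominators in the representation and in the action disappear together. -/
theorem of_smul_basis {c : ℂ} (hc : c ≠ 0) (hr : star c = c)
    (h : ∀ m n b, inner ℂ (inclW s ((c • A) (V.basis m ⊗ₜ V.basis n))) (gns q a b) =
      c * gns q a (A' b) (s, m, n)) : GNSAdj q a s A A' := by
  refine of_smul hc (of_basis fun m n b => (h m n b).trans ?_)
  rw [hr, LinearMap.smul_apply, map_smul]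
  rfl

end GNSAdj

theorem conj_uc (p : ℕ) : (starRingEnd ℂ) (uc q a s p) = uc q a s p := Complex.conj_ofReal _

theorem conj_zc (p : ℕ) : (starRingEnd ℂ) (zc q a s p) = zc q a s p := Complex.conj_ofReal _

theorem starRingEnd_qh : (starRingEnd ℂ) (qh q) = qh q := Complex.conj_ofReal _

theorem tensorEnd_tmul (A B : Module.End ℂ V) (v w : V) :
    tensorEnd A B (v ⊗ₜ w) = A v ⊗ₜ B w := rfl

theorem inner_inclW_smul_tmul (c d : ℂ) (v w : V) (f : L2) :
    inner ℂ (inclW s ((c • v) ⊗ₜ[ℂ] (d • w))) f =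
      (starRingEnd ℂ) c * (starRingEnd ℂ) d * inner ℂ (inclW s (v ⊗ₜ w)) f := by
  rw [TensorProduct.smul_tmul_smul, map_smul, inner_smul_left, map_mul]

theorem inner_inclW_smul_left (c : ℂ) (v w : V) (f : L2) :
    inner ℂ (inclW s ((c • v) ⊗ₜ[ℂ] w)) f =
      (starRingEnd ℂ) c * inner ℂ (inclW s (v ⊗ₜ w)) f := by
  rw [← TensorProduct.smul_tmul', map_smul, inner_smul_left]

theorem inner_inclW_smul_right (d : ℂ) (v w : V) (f : L2) :
    inner ℂ (inclW s (v ⊗ₜ[ℂ] (d • w))) f =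
      (starRingEnd ℂ) d * inner ℂ (inclW s (v ⊗ₜ w)) f := by
  rw [TensorProduct.tmul_smul, map_smul, inner_smul_left]

/-- Λ(cb) = (π(c) ⊗ 1) Λ(b): multiplication in B on the left only touches the first index, and there
X* = Y and Z* = Z as matrices. -/
theorem gnsAdj_repB (b : Podles q a) : GNSAdj q a s (repB q a s b)
    (Heis.rep q a (Heis.ofB q a (star b))) := by
  induction b using Podles.induction with
  | hc c =>
    intro η b
    rw [AlgHom.commutes, Heis.rep_ofB, Podles.star_algebraMap, ← Algebra.smul_def,
      Module.algebraMap_end_apply]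
    simp only [map_smul, inner_smul_left, inner_smul_right]
    rfl
  | hX =>
    refine GNSAdj.of_basis fun m n b => ?_
    rw [repB_apply, tensorEnd_tmul, piRep_X, opX_basis, Module.End.one_apply, Podles.star_X,
      Heis.rep_ofB, gns_eq, map_mul, Module.End.mul_apply, piRep_Y, coord_opY,
      inner_inclW_smul_left, inner_inclW_basis, gns_eq, conj_uc]
    ring
  | hY =>
    refine GNSAdj.of_basis fun m n b => ?_
    rw [repB_apply, tensorEnd_tmul, piRep_Y, opY_basis, Module.End.one_apply, Podles.star_Y,
      Heis.rep_ofB, gns_eq, map_mul, Module.End.mul_apply, piRep_X, coord_opX,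
      inner_inclW_smul_left, inner_inclW_basis, gns_eq, conj_uc]
    ring
  | hZ =>
    refine GNSAdj.of_basis fun m n b => ?_
    rw [repB_apply, tensorEnd_tmul, piRep_Z, opZ_basis, Module.End.one_apply, Podles.star_Z,
      Heis.rep_ofB, gns_eq, map_mul, Module.End.mul_apply, piRep_Z, coord_opZ,
      inner_inclW_smul_left, inner_inclW_basis, gns_eq, conj_zc]
    ring
  | ha b c hb hc =>
    rw [star_add, map_add, map_add, map_add]
    exact hb.add hc
  | hm b c hb hc =>
    rw [star_mul, map_mul, map_mul, map_mul]
    exact hb.mul hc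

/-- Matrix coefficients of the commutator formula. Left multiplication by X shifts the row index m,
right multiplication shifts the column index n, which is the index of the second tensor leg. -/
theorem smul_gns_act_E (b : Podles q a) (m n : ℕ) :
    ((qc q)⁻¹ - qc q) * gns q a (Podles.act q a (Uq.E q) b) (s, m, n) =
      (qh q)⁻¹ * rc q a s n * ((zc q a s m)⁻¹ * (uc q a s (m + 1) *
        V.coord (m + 1) (piRep q a s b (V.basis n)) -
        uc q a s n * V.coord m (piRep q a s b (V.basis (n - 1))))) := by
  have h := congrArg (fun A => rc q a s n * V.coord m (A (V.basis n))) (smul_piRep_act_E q a s b)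
  simp only [LinearMap.smul_apply, Module.End.mul_apply, LinearMap.sub_apply, map_smul, map_sub,
    smul_eq_mul, coord_opZinv, coord_opX, opX_basis] at h
  rw [gns_eq]
  linear_combination h

theorem smul_gns_act_F (b : Podles q a) (m n : ℕ) :
    ((qc q)⁻¹ - qc q) * gns q a (Podles.act q a (Uq.F q) b) (s, m, n) =
      (qh q)⁻¹ * rc q a s n * ((zc q a s n)⁻¹ * (uc q a s m *
        V.coord (m - 1) (piRep q a s b (V.basis n)) -
        uc q a s (n + 1) * V.coord m (piRep q a s b (V.basis (n + 1))))) := by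
  have h := congrArg (fun A => rc q a s n * V.coord m (A (V.basis n))) (smul_piRep_act_F q a s b)
  simp only [LinearMap.smul_apply, Module.End.mul_apply, LinearMap.sub_apply, map_smul, map_sub,
    smul_eq_mul, coord_opY, opY_basis, opZinv_basis] at h
  rw [gns_eq]
  linear_combination h

theorem coord_piRep_act_K (b : Podles q a) (m n : ℕ) :
    V.coord m (piRep q a s (Podles.act q a (Uq.K q) b) (V.basis n)) =
      (zc q a s m)⁻¹ * zc q a s n * V.coord m (piRep q a s b (V.basis n)) := by
  rw [piRep_act_K]
  simp only [Module.End.mul_apply, coord_opZinv, opZ_basis, map_smul, smul_eq_mul]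
  ring

theorem coord_piRep_act_Ki (b : Podles q a) (m n : ℕ) :
    V.coord m (piRep q a s (Podles.act q a (Uq.Ki q) b) (V.basis n)) =
      zc q a s m * (zc q a s n)⁻¹ * V.coord m (piRep q a s b (V.basis n)) := by
  rw [piRep_act_Ki]
  simp only [Module.End.mul_apply, coord_opZ, opZinv_basis, map_smul, smul_eq_mul]
  ring

/-- For E and F, the two products in the commutator match the two summands of the operator, one
shifting the first index and one the second. When the second index shifts, the weight of ξ_T changes
by q, and for E the K in E* = FK adds a factor q²; these balance the powers q^{±1/2}. -/
theorem gnsAdj_repU (x : Uq q) : GNSAdj q a s (repU q a s x)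
    (Heis.rep q a (Heis.ofU q a (star x))) := by
  have hd := inv_qc_sub_ne q
  have h0 := qc_ne q
  have h1 := qh_ne q
  have h2 := qh_sq q
  induction x using Uq.induction with
  | hc c =>
    intro η b
    rw [AlgHom.commutes, Heis.rep_ofU, Module.algebraMap_end_apply,
      Algebra.algebraMap_eq_smul_one (A := Uq q), star_smul, star_one, ← Podles.actHom_apply, map_smul,
      map_smul, map_one (Podles.actHom q a)]
    simp only [LinearMap.smul_apply, Module.End.one_apply, map_smul, inner_smul_left,
      inner_smul_right]
    rfl
  | hK =>
    refine GNSAdj.of_basis fun m n b => ?_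
    rw [repU_K, tensorEnd_tmul, opZ_basis, opZinv_basis, inner_inclW_smul_tmul, map_inv₀, conj_zc,
      conj_zc, inner_inclW_basis, Uq.star_K, Heis.rep_ofU, gns_eq, gns_eq, coord_piRep_act_K]
    ring
  | hKi =>
    refine GNSAdj.of_basis fun m n b => ?_
    rw [repU_Ki, tensorEnd_tmul, opZ_basis, opZinv_basis, inner_inclW_smul_tmul, map_inv₀, conj_zc,
      conj_zc, inner_inclW_basis, Uq.star_Ki, Heis.rep_ofU, gns_eq, gns_eq, coord_piRep_act_Ki]
    ring
  | hE =>
    refine GNSAdj.of_smul_basis hd (star_inv_qc_sub q) fun m n b => ?_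
    rw [Heis.rep_ofU, Uq.star_E, Podles.act_mul_left,
      smul_gns_act_F, smul_repU_E, scaledE,
      LinearMap.sub_apply, LinearMap.smul_apply, LinearMap.smul_apply, tensorEnd_tmul,
      tensorEnd_tmul, Module.End.mul_apply, opX_basis, opY_basis, map_smul, opZinv_basis,
      opZinv_basis, smul_smul, Module.End.one_apply, map_sub, map_smul, map_smul, inner_sub_left,
      inner_smul_left, inner_smul_left, inner_inclW_smul_left, inner_inclW_smul_tmul,
      inner_inclW_basis, inner_inclW_basis, coord_piRep_act_K, coord_piRep_act_K, gns_eq, gns_eq,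
      rc_succ, zc_succ]
    have hm := zc_ne q a s m
    have hn := zc_ne q a s n
    simp only [map_mul, map_inv₀, conj_uc, conj_zc, starRingEnd_qh]
    -- Writing q as a square of q^{1/2} makes the remaining identity rational in a single quantity.
    rw [← h2]
    field_simp
  | hF =>
    refine GNSAdj.of_smul_basis hd (star_inv_qc_sub q) fun m n b => ?_
    have hm := zc_ne q a s m
    have hn := zc_ne q a s n
    -- In F* = K⁻¹E the outer K⁻¹ only multiplies the coefficient (m, n) by z_m / z_n, which exposes
    -- the coefficient of E ▷ b.
    have key : ((qc q)⁻¹ - qc q) * gns q a (Podles.act q a (Uq.Ki q)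
        (Podles.act q a (Uq.E q) b)) (s, m, n) = zc q a s m * (zc q a s n)⁻¹ *
          (((qc q)⁻¹ - qc q) * gns q a (Podles.act q a (Uq.E q) b) (s, m, n)) := by
      rw [gns_eq, gns_eq, coord_piRep_act_Ki]
      ring
    rw [Heis.rep_ofU, Uq.star_F, Podles.act_mul_left,
      key, smul_gns_act_E, smul_repU_F,
      scaledF, LinearMap.sub_apply, LinearMap.smul_apply, LinearMap.smul_apply, tensorEnd_tmul,
      tensorEnd_tmul, Module.End.mul_apply, opY_basis, opZinv_basis, map_smul, opX_basis,
      smul_smul, Module.End.one_apply, map_sub, map_smul, map_smul, inner_sub_left,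
      inner_smul_left, inner_smul_left, inner_inclW_smul_right, inner_inclW_smul_right,
      inner_inclW_smul_left,
      inner_inclW_basis, inner_inclW_basis, gns_eq, gns_eq]
    simp only [map_mul, map_inv₀, conj_uc, conj_zc, starRingEnd_qh]
    -- The second summand of F lowers n. At n = 0 it vanishes through u_0 = 0; otherwise the
    -- recursion for the weights applies to n - 1 and n.
    cases n with
    | zero =>
      rw [uc_zero]
      field_simp
      ring
    | succ n =>
      rw [rc_succ, ← h2, Nat.add_sub_cancel]
      field_simp
  | ha x y hx hy =>
    rw [star_add, map_add, map_add, map_add]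
    exact hx.add hy
  | hm x y hx hy =>
    rw [star_mul, map_mul, map_mul, map_mul]
    exact hx.mul hy

theorem gnsAdj_repW (x : Heis q a) : GNSAdj q a s (repW q a s x) (Heis.rep q a (star x)) := by
  induction x using Heis.induction with
  | hB b => rw [repW_ofB, Heis.star_ofB]; exact gnsAdj_repB b
  | hU x => rw [repW_ofU, Heis.star_ofU]; exact gnsAdj_repU x
  | ha x y hx hy => rw [star_add, map_add, map_add]; exact hx.add hy
  | hm x y hx hy => rw [star_mul, map_mul, map_mul]; exact hx.mul hy

end GNSAdjoint

/-! ### Spanning B by the monomials Z^n X^m and Z^n Y^m. -/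

section Spanning

variable {q : Param} {a : ℝ}

theorem Podles.X_mul_Z_pow (n : ℕ) : Podles.X q a * Podles.Z q a ^ n =
    (qc q ^ 2) ^ n • (Podles.Z q a ^ n * Podles.X q a) := by
  induction n with
  | zero => simp
  | succ n ih =>
    rw [pow_succ, ← mul_assoc, ih, smul_mul_assoc, mul_assoc, Podles.X_mul_Z, mul_smul_comm,
      smul_smul, mul_assoc, ← pow_succ]

theorem Podles.Y_mul_Z_pow (n : ℕ) : Podles.Y q a * Podles.Z q a ^ n =
    ((qc q)⁻¹ ^ 2) ^ n • (Podles.Z q a ^ n * Podles.Y q a) := by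
  induction n with
  | zero => simp
  | succ n ih =>
    rw [pow_succ, ← mul_assoc, ih, smul_mul_assoc, mul_assoc, Podles.Y_mul_Z, mul_smul_comm,
      smul_smul, mul_assoc, ← pow_succ]

variable (q a) in
/-- The span of the monomials `Z ^ n X ^ m` and `Z ^ n Y ^ m`. -/
def monomialSpan : Submodule ℂ (Podles q a) :=
  Submodule.span ℂ (Set.range (fun i : ℕ × ℕ => Podles.Z q a ^ i.1 * Podles.X q a ^ i.2) ∪
    Set.range (fun i : ℕ × ℕ => Podles.Z q a ^ i.1 * Podles.Y q a ^ i.2))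

theorem Z_pow_mul_X_pow_mem (n m : ℕ) :
    Podles.Z q a ^ n * Podles.X q a ^ m ∈ monomialSpan q a :=
  Submodule.subset_span (Or.inl ⟨(n, m), rfl⟩)

theorem Z_pow_mul_Y_pow_mem (n m : ℕ) :
    Podles.Z q a ^ n * Podles.Y q a ^ m ∈ monomialSpan q a :=
  Submodule.subset_span (Or.inr ⟨(n, m), rfl⟩)

theorem mul_mem_monomialSpan {y : Podles q a}
    (hX : ∀ n m, y * (Podles.Z q a ^ n * Podles.X q a ^ m) ∈ monomialSpan q a)
    (hY : ∀ n m, y * (Podles.Z q a ^ n * Podles.Y q a ^ m) ∈ monomialSpan q a)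
    {b : Podles q a} (hb : b ∈ monomialSpan q a) : y * b ∈ monomialSpan q a := by
  induction hb using Submodule.span_induction with
  | mem b hb =>
    rcases hb with ⟨i, rfl⟩ | ⟨i, rfl⟩
    · exact hX i.1 i.2
    · exact hY i.1 i.2
  | zero => simp
  | add b c _ _ hb hc => rw [mul_add]; exact add_mem hb hc
  | smul c b _ hb => rw [mul_smul_comm]; exact Submodule.smul_mem _ c hb

/-- The span contains 1 and is stable under left multiplication by X, Y and Z: moving X or Y past
Z^n costs a scalar, and a resulting XY or YX is a polynomial in Z. -/
theorem mem_monomialSpan (b : Podles q a) : b ∈ monomialSpan q a := by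
  suffices h : ∀ y c : Podles q a, c ∈ monomialSpan q a → y * c ∈ monomialSpan q a by
    have := h b 1 (by simpa using Z_pow_mul_X_pow_mem (q := q) (a := a) 0 0)
    rwa [mul_one] at this
  intro y
  induction y using Podles.induction with
  | hc c =>
    intro b hb
    rw [← Algebra.smul_def]
    exact Submodule.smul_mem _ c hb
  | hX =>
    intro b hb
    refine mul_mem_monomialSpan (fun n m => ?_) (fun n m => ?_) hb
    · rw [← mul_assoc, Podles.X_mul_Z_pow, smul_mul_assoc, mul_assoc, ← pow_succ']
      exact Submodule.smul_mem _ _ (Z_pow_mul_X_pow_mem n (m + 1))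
    · rw [← mul_assoc, Podles.X_mul_Z_pow, smul_mul_assoc]
      refine Submodule.smul_mem _ _ ?_
      cases m with
      | zero => simpa using Z_pow_mul_X_pow_mem (q := q) (a := a) n 1
      | succ m =>
        have e : Podles.Z q a ^ n * Podles.X q a * Podles.Y q a ^ (m + 1) =
            Podles.Z q a ^ n * Podles.Y q a ^ m
              - (qc q * tc q a) • (Podles.Z q a ^ (n + 1) * Podles.Y q a ^ m)
              - qc q ^ 2 • (Podles.Z q a ^ (n + 2) * Podles.Y q a ^ m) := by
          rw [pow_succ' (Podles.Y q a), mul_assoc, ← mul_assoc (Podles.X q a), Podles.X_mul_Y]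
          simp only [sub_mul, mul_sub, smul_mul_assoc, mul_smul_comm, one_mul, mul_assoc, pow_succ]
        rw [e]
        exact sub_mem (sub_mem (Z_pow_mul_Y_pow_mem n m)
          (Submodule.smul_mem _ _ (Z_pow_mul_Y_pow_mem (n + 1) m)))
          (Submodule.smul_mem _ _ (Z_pow_mul_Y_pow_mem (n + 2) m))
  | hY =>
    intro b hb
    refine mul_mem_monomialSpan (fun n m => ?_) (fun n m => ?_) hb
    · rw [← mul_assoc, Podles.Y_mul_Z_pow, smul_mul_assoc]
      refine Submodule.smul_mem _ _ ?_
      cases m with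
      | zero => simpa using Z_pow_mul_Y_pow_mem (q := q) (a := a) n 1
      | succ m =>
        have e : Podles.Z q a ^ n * Podles.Y q a * Podles.X q a ^ (m + 1) =
            Podles.Z q a ^ n * Podles.X q a ^ m
              - ((qc q)⁻¹ * tc q a) • (Podles.Z q a ^ (n + 1) * Podles.X q a ^ m)
              - (qc q)⁻¹ ^ 2 • (Podles.Z q a ^ (n + 2) * Podles.X q a ^ m) := by
          rw [pow_succ' (Podles.X q a), mul_assoc, ← mul_assoc (Podles.Y q a), Podles.Y_mul_X]
          simp only [sub_mul, mul_sub, smul_mul_assoc, mul_smul_comm, one_mul, mul_assoc, pow_succ]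
        rw [e]
        exact sub_mem (sub_mem (Z_pow_mul_X_pow_mem n m)
          (Submodule.smul_mem _ _ (Z_pow_mul_X_pow_mem (n + 1) m)))
          (Submodule.smul_mem _ _ (Z_pow_mul_X_pow_mem (n + 2) m))
    · rw [← mul_assoc, Podles.Y_mul_Z_pow, smul_mul_assoc, mul_assoc, ← pow_succ']
      exact Submodule.smul_mem _ _ (Z_pow_mul_Y_pow_mem n (m + 1))
  | hZ =>
    intro b hb
    refine mul_mem_monomialSpan (fun n m => ?_) (fun n m => ?_) hb
    · rw [← mul_assoc, ← pow_succ']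
      exact Z_pow_mul_X_pow_mem (n + 1) m
    · rw [← mul_assoc, ← pow_succ']
      exact Z_pow_mul_Y_pow_mem (n + 1) m
  | ha y z hy hz => intro b hb; rw [add_mul]; exact add_mem (hy b hb) (hz b hb)
  | hm y z hy hz => intro b hb; rw [mul_assoc]; exact hy _ (hz b hb)

end Spanning

/-! ### Uniqueness of the invariant functional on B, and invariance of the Haar state. -/

section Invariant

variable {q : Param} {a : ℝ}

theorem act_K_pow (b : Podles q a) (n : ℕ) :
    Podles.act q a (Uq.K q) (b ^ n) = Podles.act q a (Uq.K q) b ^ n := by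
  induction n with
  | zero => simp [Podles.act_algebra_one, Uq.counit_K]
  | succ n ih => rw [pow_succ, Podles.act_K_mul, ih, pow_succ]

theorem act_Ki_Z_pow (n : ℕ) :
    Podles.act q a (Uq.Ki q) (Podles.Z q a ^ n) = Podles.Z q a ^ n := by
  induction n with
  | zero => simp [Podles.act_algebra_one, Uq.counit_Ki]
  | succ n ih => rw [pow_succ, Podles.act_Ki_mul, ih, Podles.act_Ki_Z]

/-- K⁻¹ fixes Z, so the twisted Leibniz rule lets F replace each factor Z in turn by a multiple of
Y; moving Y to the right past Z^k gives q^{-2k}, hence the geometric sum. -/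
theorem act_F_Z_pow (n : ℕ) :
    Podles.act q a (Uq.F q) (Podles.Z q a ^ (n + 1)) =
      (qh q * ∑ k ∈ Finset.range (n + 1), ((qc q)⁻¹ ^ 2) ^ k) •
        (Podles.Z q a ^ n * Podles.Y q a) := by
  induction n with
  | zero => simp [Podles.act_F_Z]
  | succ n ih =>
    rw [pow_succ' _ (n + 1), Podles.act_F_mul, ih, act_Ki_Z_pow, Podles.act_F_Z, smul_mul_assoc,
      Podles.Y_mul_Z_pow, Finset.sum_range_succ _ (n + 1), mul_smul_comm, ← mul_assoc, ← pow_succ']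
    module

theorem mul_neg_eq_neg {T : Type} [Ring T] {x y z : T} (h : x * y = z) : x * -y = -z := by
  rw [mul_neg, h]

/-- F lowers the K-weight back to that of Z: YX and F ▷ X are both polynomials in Z, so the result
involves only three consecutive powers of Z. -/
theorem act_F_Z_pow_mul_X (n : ℕ) :
    Podles.act q a (Uq.F q) (Podles.Z q a ^ (n + 1) * Podles.X q a) =
      (qh q * (∑ k ∈ Finset.range (n + 1), ((qc q)⁻¹ ^ 2) ^ k) * (qc q)⁻¹ ^ 2) •
        (Podles.Z q a ^ n - ((qc q)⁻¹ * tc q a) • Podles.Z q a ^ (n + 1)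
          - (qc q)⁻¹ ^ 2 • Podles.Z q a ^ (n + 2)) -
      (qh q)⁻¹ • (tc q a • Podles.Z q a ^ (n + 1) +
        (qc q + (qc q)⁻¹) • Podles.Z q a ^ (n + 2)) := by
  have e : Podles.Z q a ^ (n + 1) * Podles.act q a (Uq.F q) (Podles.X q a) =
      -((qh q)⁻¹ • (tc q a • Podles.Z q a ^ (n + 1) +
        (qc q + (qc q)⁻¹) • Podles.Z q a ^ (n + 2))) := by
    rw [Podles.act_F_X]
    refine mul_neg_eq_neg ?_
    rw [mul_smul_comm, mul_add, mul_smul_comm, mul_smul_comm, mul_one, ← pow_succ]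
  rw [Podles.act_F_mul, act_F_Z_pow, Podles.act_Ki_X, e, smul_mul_smul_comm,
    mul_assoc (Podles.Z q a ^ n), Podles.Y_mul_X, mul_sub, mul_sub, mul_one, mul_smul_comm,
    mul_smul_comm, ← pow_succ, ← mul_assoc, ← pow_succ, ← pow_succ]
  exact (sub_eq_add_neg _ _).symm

/-- This is minus the coefficient of Z^{n+1} in F ▷ (Z^n X). Its two contributions are real, the
first nonnegative and the second positive, so they cannot cancel. -/
theorem leading_coeff_ne (n : ℕ) :
    qh q * (∑ k ∈ Finset.range n, ((qc q)⁻¹ ^ 2) ^ k) * (qc q)⁻¹ ^ 2 * (qc q)⁻¹ ^ 2 +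
      (qh q)⁻¹ * (qc q + (qc q)⁻¹) ≠ 0 := by
  have h0 := q.2.1
  have h1 := Real.sqrt_pos.2 h0
  have h : (0 : ℝ) < √(q : ℝ) * (∑ k ∈ Finset.range n, ((q : ℝ)⁻¹ ^ 2) ^ k) * (q : ℝ)⁻¹ ^ 2 *
      (q : ℝ)⁻¹ ^ 2 + (√(q : ℝ))⁻¹ * (q + (q : ℝ)⁻¹) :=
    add_pos_of_nonneg_of_pos (by positivity) (by positivity)
  have h2 := Complex.ofReal_ne_zero.2 h.ne'
  simp only [qh, qc]
  exact_mod_cast h2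

/-- Since 0 < q < 1, no positive power of X or of Y has K-weight 1. -/
theorem qc_sq_pow_ne_one (n : ℕ) : (qc q ^ 2) ^ (n + 1) ≠ 1 := by
  have h0 := q.2.1
  have h : ((q : ℝ) ^ 2) ^ (n + 1) ≠ 1 :=
    (pow_lt_one₀ (by positivity) (pow_lt_one₀ h0.le q.2.2 two_ne_zero) n.succ_ne_zero).ne
  simp only [qc]
  exact_mod_cast h

/-- A functional on the Podleś sphere which vanishes at `1`, is invariant under `K` and kills
`F ▷ Z ^ n X` vanishes. -/
theorem eq_zero_of_invariant (f : Podles q a →ₗ[ℂ] ℂ) (h1 : f 1 = 0)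
    (hK : ∀ b, f (Podles.act q a (Uq.K q) b) = f b)
    (hF : ∀ n, f (Podles.act q a (Uq.F q) (Podles.Z q a ^ n * Podles.X q a)) = 0) : f = 0 := by
  -- The recursion has order two, so two consecutive values are carried along. It starts from f(1) =
  -- 0 and F ▷ X, which involves only 1 and Z.
  have hZ : ∀ n, f (Podles.Z q a ^ n) = 0 ∧ f (Podles.Z q a ^ (n + 1)) = 0 := by
    intro n
    induction n with
    | zero =>
      refine ⟨by simpa using h1, ?_⟩
      have e := hF 0
      have e2 := leading_coeff_ne (q := q) 0
      simp only [Finset.range_zero, Finset.sum_empty, mul_zero, zero_mul, zero_add] at e2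
      simp only [pow_zero, one_mul, Podles.act_F_X, map_neg, map_smul, map_add, h1,
        smul_eq_mul, mul_zero, zero_add] at e
      rw [← mul_assoc] at e
      rw [zero_add, pow_one]
      exact (mul_eq_zero.1 (neg_eq_zero.1 e)).resolve_left e2
    | succ n ih =>
      refine ⟨ih.2, ?_⟩
      have e := hF (n + 1)
      rw [act_F_Z_pow_mul_X] at e
      simp only [map_sub, map_smul, map_add, ih.1, ih.2, smul_eq_mul] at e
      refine (mul_eq_zero.1 ?_).resolve_left (leading_coeff_ne (q := q) (n + 1))
      linear_combination -e
  -- K-invariance gives c f(b) = f(b) for b of weight c. Among the spanning monomials only the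
  -- powers of Z have weight 1.
  have hweight : ∀ (c : ℂ) b, c ≠ 1 → Podles.act q a (Uq.K q) b = c • b → f b = 0 := by
    intro c b hc hb
    have e := hK b
    rw [hb, map_smul, smul_eq_mul] at e
    refine (mul_eq_zero.1 ?_).resolve_left (sub_ne_zero.2 hc)
    linear_combination e
  ext b
  have hb := mem_monomialSpan b
  induction hb using Submodule.span_induction with
  | mem b hb =>
    rcases hb with ⟨⟨n, m⟩, rfl⟩ | ⟨⟨n, m⟩, rfl⟩
    · cases m with
      | zero => simpa using (hZ n).1
      | succ m =>
        refine hweight ((qc q ^ 2) ^ (m + 1)) _ (qc_sq_pow_ne_one m) ?_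
        rw [Podles.act_K_mul, act_K_pow, act_K_pow, Podles.act_K_Z, Podles.act_K_X, smul_pow,
          mul_smul_comm]
    · cases m with
      | zero => simpa using (hZ n).1
      | succ m =>
        refine hweight (((qc q)⁻¹ ^ 2) ^ (m + 1)) _ ?_ ?_
        · rw [inv_pow, inv_pow, ne_eq, inv_eq_one]
          exact qc_sq_pow_ne_one m
        · rw [Podles.act_K_mul, act_K_pow, act_K_pow, Podles.act_K_Z, Podles.act_K_Y, smul_pow,
            mul_smul_comm]
  | zero => simp
  | add b c _ _ hb hc => rw [map_add, hb, hc, map_add]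
  | smul c b _ hb => rw [map_smul, hb, map_smul]

/-- The coaction is the restriction of Δ along j, so Φ(j(x ▷ b)) = τ(Φ(f₁) f₂, x) with f = j(b).
Left invariance turns this into Φ(f) τ(1, x) = Φ(f) ε(x). -/
theorem invariant_act (Φ : SUq q →ₗ[ℂ] ℂ) (hΦ : IsInvariantState q Φ) (x : Uq q) (b : Podles q a) :
    Φ (Podles.toSU q a (Podles.act q a x b)) =
      Coalgebra.counit (R := ℂ) x * Φ (Podles.toSU q a b) := by
  have h : ∀ w, Φ (Podles.toSU q a (Podles.slice q a x w)) =
      pair q (TensorProduct.lid ℂ (SUq q) (LinearMap.rTensor (SUq q) Φ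
        (Algebra.TensorProduct.map (Podles.toSU q a) (AlgHom.id ℂ (SUq q)) w))) x := fun w => by
    induction w using TensorProduct.induction_on with
    | zero => simp
    | tmul b f => simp [Podles.slice_tmul, mul_comm]
    | add u v hu hv => simp only [map_add, LinearMap.add_apply, hu, hv]
  rw [Podles.act_apply, h, ← Podles.comul_toSU, hΦ.left_inv, map_smul, LinearMap.smul_apply,
    pair_one, smul_eq_mul, mul_comm]

end Invariant

/-! ### The vector state of Λ(1) as a weighted trace, and its identification with the Haar state. -/

section Haar

variable (q : Param) (a : ℝ)

theorem tval_nonneg (s : Sgn) (p : ℕ) : 0 ≤ tval q a s p := by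
  have h0 := q.2.1
  have h1 : (0 : ℝ) ≤ (q : ℝ)⁻¹ - q := by
    have := (one_lt_inv₀ h0).2 q.2.2
    linarith [q.2.2]
  have h2 := Real.rpow_pos_of_pos h0 a
  have h3 := Real.rpow_pos_of_pos h0 (-a)
  unfold tval
  positivity

theorem rc_mul_self (s : Sgn) (p : ℕ) : rc q a s p * rc q a s p = ((tval q a s p : ℝ) : ℂ) := by
  rw [rc, ← Complex.ofReal_mul, Real.mul_self_sqrt (tval_nonneg q a s p)]

/-- The trace formula ⟨Λ(b), Λ(c)⟩ = Tr(T π(b* c)): for fixed sign and n, the sum over m is the n-th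
diagonal coefficient of π(b)* π(c), weighted by the square of the n-th coefficient of ξ_T. -/
theorem hasSum_inner_gns (b c : Podles q a) : HasSum (fun i : Sgn × ℕ =>
    ((tval q a i.1 i.2 : ℝ) : ℂ) * V.coord i.2 (piRep q a i.1 (star b * c) (V.basis i.2)))
    (inner ℂ (gns q a b) (gns q a c)) := by
  -- Reorders (s, m, n) as ((s, n), m), so that the fibrewise sums run over m. They are finite
  -- because π(c) ξ_n has finite support.
  let e : (Sgn × ℕ) × ℕ ≃ Sgn × ℕ × ℕ :=
    ((Equiv.prodAssoc Sgn ℕ ℕ).trans (Equiv.prodCongr (Equiv.refl Sgn) (Equiv.prodComm ℕ ℕ)))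
  refine (e.hasSum_iff.2 (lp.hasSum_inner (gns q a b) (gns q a c))).prod_fiberwise fun i => ?_
  obtain ⟨s, n⟩ := i
  have h := (vAdj_piRep q a s b).coord_eq_sum n (piRep q a s c (V.basis n))
  rw [map_mul, Module.End.mul_apply, h, Finset.mul_sum]
  have hterm : ∀ m, inner ℂ (gns q a b (s, m, n)) (gns q a c (s, m, n)) =
      ((tval q a s n : ℝ) : ℂ) * (star (V.coord m (piRep q a s b (V.basis n))) *
        V.coord m (piRep q a s c (V.basis n))) := fun m => by
    have hr : (starRingEnd ℂ) (rc q a s n) = rc q a s n := Complex.conj_ofReal _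
    rw [gns_eq, gns_eq, ← rc_mul_self, RCLike.inner_apply, map_mul, hr]
    simp only [starRingEnd_apply]
    ring
  have h2 : (fun m => inner ℂ (gns q a b (e ((s, n), m))) (gns q a c (e ((s, n), m)))) =
      fun m => ((tval q a s n : ℝ) : ℂ) * (star (V.coord m (piRep q a s b (V.basis n))) *
        V.coord m (piRep q a s c (V.basis n))) := funext hterm
  refine (congrArg (fun f => HasSum f _) h2).mpr (hasSum_sum_of_ne_finset_zero fun m hm => ?_)
  have h0 : V.coord m (piRep q a s c (V.basis n)) = 0 := Finsupp.notMem_support_iff.1 hm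
  rw [h0, mul_zero, mul_zero]

/-- The vector state of `Λ(1)` on the Podleś sphere. -/
def vectorState : Podles q a →ₗ[ℂ] ℂ := (innerSL ℂ (gns q a 1)).toLinearMap ∘ₗ gns q a

theorem hasSum_vectorState (b : Podles q a) : HasSum (fun i : Sgn × ℕ =>
    ((tval q a i.1 i.2 : ℝ) : ℂ) * V.coord i.2 (piRep q a i.1 b (V.basis i.2)))
    (vectorState q a b) := by
  have h := hasSum_inner_gns q a 1 b
  simp only [star_one, one_mul] at h
  exact h

theorem inner_gns (b c : Podles q a) :
    inner ℂ (gns q a b) (gns q a c) = vectorState q a (star b * c) :=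
  (hasSum_inner_gns q a b c).unique (hasSum_vectorState q a (star b * c))

/-- Conjugation by the diagonal operator Z leaves diagonal coefficients unchanged, and T only sees
the diagonal. -/
theorem vectorState_act_K (b : Podles q a) :
    vectorState q a (Podles.act q a (Uq.K q) b) = vectorState q a b := by
  refine (hasSum_vectorState q a _).unique ?_
  convert hasSum_vectorState q a b using 3 with i
  rw [coord_piRep_act_K, inv_mul_cancel₀ (zc_ne q a i.1 i.2), one_mul]

/-- The constant relating `T` to `|Z_t|`. -/
def tconst : ℝ := ((q : ℝ)⁻¹ - q) / ((q : ℝ) ^ a + (q : ℝ) ^ (-a))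

/-- Z is positive on H_+ and negative on H_-, so |Z| = ±Z. The explicit sign is what later makes the
two boundary terms cancel. -/
theorem tval_eq (s : Sgn) (p : ℕ) : tval q a s p = tconst q a * s.val * zval q a s p := by
  have h := Real.rpow_pos_of_pos q.2.1 (2 * (p : ℝ) - s.val * a + 1)
  have h2 : s.val * s.val = 1 := by cases s <;> simp [Sgn.val]
  have h3 : |s.val| = 1 := by cases s <;> simp [Sgn.val]
  rw [tval, tconst, zval, abs_mul, h3, abs_of_pos h]
  linear_combination (-((q : ℝ)⁻¹ - q) / ((q : ℝ) ^ a + (q : ℝ) ^ (-a)) *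
    (q : ℝ) ^ (2 * (p : ℝ) - s.val * a + 1)) * h2

theorem tval_eq_pow (s : Sgn) (p : ℕ) : tval q a s p = ((q : ℝ) ^ 2) ^ p * tval q a s 0 := by
  rw [tval_eq, tval_eq, zval_eq]
  ring

/-- The absolute values of Z at ξ_0 are q · q^{-a} and q · q^a. Their sum cancels the denominator
q^a + q^{-a} and leaves q (q⁻¹ - q). -/
theorem tval_zero_add : tval q a true 0 + tval q a false 0 = 1 - (q : ℝ) ^ 2 := by
  have h0 := q.2.1
  have h2 := Real.rpow_pos_of_pos h0 a
  simp only [tval_eq, tconst, zval, Sgn.val, Nat.cast_zero, mul_zero, zero_sub, one_mul, neg_mul,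
    neg_neg, Real.rpow_add h0, Real.rpow_neg h0.le, Real.rpow_one, mul_neg, mul_one]
  field_simp
  ring

/-- The trace of T is a sum of two geometric series of ratio q²; their leading terms add up to 1 -
q². -/
theorem vectorState_one : vectorState q a 1 = 1 := by
  have h0 := q.2.1
  have hq : (q : ℝ) ^ 2 < 1 := pow_lt_one₀ h0.le q.2.2 two_ne_zero
  have h := hasSum_vectorState q a 1
  have h1 : HasSum (fun i : Sgn × ℕ => ((tval q a i.1 i.2 : ℝ) : ℂ)) (vectorState q a 1) := by
    simpa [V.coord_basis] using h
  have h2 : ∀ s, HasSum (fun p => ((tval q a s p : ℝ) : ℂ))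
      (((1 - (q : ℝ) ^ 2)⁻¹ * tval q a s 0 : ℝ) : ℂ) := fun s => by
    rw [Complex.hasSum_ofReal]
    exact (congrArg (fun f => HasSum f _) (funext (tval_eq_pow q a s))).mpr
      ((hasSum_geometric_of_lt_one (by positivity) hq).mul_right (tval q a s 0))
  have h3 := (h1.prod_fiberwise h2).unique (hasSum_fintype _)
  rw [h3, Fintype.sum_bool, ← Complex.ofReal_add, ← mul_add, tval_zero_add,
    inv_mul_cancel₀ (sub_pos.2 hq).ne', Complex.ofReal_one]

theorem tendsto_zc (s : Sgn) : Filter.Tendsto (zc q a s) Filter.atTop (nhds 0) := by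
  have h0 := q.2.1
  have hq : (q : ℝ) ^ 2 < 1 := pow_lt_one₀ h0.le q.2.2 two_ne_zero
  have h : Filter.Tendsto (zval q a s) Filter.atTop (nhds 0) := by
    have := (tendsto_pow_atTop_nhds_zero_of_lt_one (by positivity) hq).mul_const (zval q a s 0)
    rw [zero_mul] at this
    exact this.congr fun p => (zval_eq q a s p).symm
  exact_mod_cast (Complex.continuous_ofReal.tendsto 0).comp h

theorem opZ_pow_basis (s : Sgn) (n p : ℕ) :
    (opZ q a s ^ n) (V.basis p) = zc q a s p ^ n • V.basis p := by
  induction n with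
  | zero => simp
  | succ n ih => rw [pow_succ', Module.End.mul_apply, ih, map_smul, opZ_basis, smul_smul, pow_succ]

/-- The diagonal coefficients of `Y_t Z_t ^ n X_t`. -/
def diagCoeff (s : Sgn) (n p : ℕ) : ℂ := uc q a s p ^ 2 * zc q a s (p - 1) ^ n

theorem diagCoeff_zero (s : Sgn) (n : ℕ) : diagCoeff q a s n 0 = 0 := by
  simp [diagCoeff, uc_zero]

/-- The eigenvalues of Z tend to 0 and u_p² tends to 1. The limit is therefore 1 for n = 0 and 0
otherwise, for either sign. -/
theorem tendsto_diagCoeff (s : Sgn) (n : ℕ) :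
    Filter.Tendsto (diagCoeff q a s n) Filter.atTop (nhds (0 ^ n)) := by
  -- Shifting by one avoids the truncated index p - 1 and expresses u_{p+1}² through z_p.
  rw [← Filter.tendsto_add_atTop_iff_nat 1]
  have h := tendsto_zc q a s
  have h2 := ((((tendsto_const_nhds (x := (1 : ℂ))).sub (h.const_mul (qc q * tc q a))).sub
    ((h.mul h).const_mul (qc q ^ 2))).mul (h.pow n))
  simp only [mul_zero, sub_zero, one_mul] at h2
  refine h2.congr fun p => ?_
  rw [diagCoeff, uc_succ_sq_eq, Nat.add_sub_cancel]

/-- The factor Z in T = const · (±Z) cancels the Z⁻¹ of [Y, b] Z⁻¹. With b = Z^n X, the diagonals of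
Y Z^n X and of Z^n X Y are the same sequence shifted by one, so the trace telescopes. -/
theorem smul_diag_act_F (s : Sgn) (n p : ℕ) :
    ((qc q)⁻¹ - qc q) * (((tval q a s p : ℝ) : ℂ) * V.coord p (piRep q a s
      (Podles.act q a (Uq.F q) (Podles.Z q a ^ n * Podles.X q a)) (V.basis p))) =
    (qh q)⁻¹ * (tconst q a : ℂ) * (s.val : ℂ) *
      (diagCoeff q a s n p - diagCoeff q a s n (p + 1)) := by
  have hz := zc_ne q a s p
  have h := congrArg (fun A => V.coord p (A (V.basis p)))
    (smul_piRep_act_F q a s (Podles.Z q a ^ n * Podles.X q a))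
  have ht : ((tval q a s p : ℝ) : ℂ) = (tconst q a : ℂ) * (s.val : ℂ) * zc q a s p := by
    rw [tval_eq, zc]
    push_cast
    ring
  simp only [LinearMap.smul_apply, Module.End.mul_apply, LinearMap.sub_apply, map_smul, map_sub,
    map_mul, map_pow, piRep_X, piRep_Z, smul_eq_mul, opY_basis, opX_basis,
    opZinv_basis, opZ_pow_basis, V.coord_basis, Nat.add_sub_cancel, if_true] at h
  have e : (qh q)⁻¹ * ((zc q a s p)⁻¹ * (diagCoeff q a s n p - diagCoeff q a s n (p + 1))) =
      ((qc q)⁻¹ - qc q) * V.coord p (piRep q a s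
      (Podles.act q a (Uq.F q) (Podles.Z q a ^ n * Podles.X q a)) (V.basis p)) := by
    rw [h, diagCoeff, diagCoeff, Nat.add_sub_cancel]
    -- At p = 0 the index p - 1 is truncated, and the term vanishes through u_0 = 0.
    cases p with
    | zero =>
      simp only [uc_zero]
      ring
    | succ p =>
      simp only [Nat.add_sub_cancel, if_true]
      ring
  rw [mul_left_comm, ← e, ht]
  field_simp

theorem vectorState_act_F (n : ℕ) :
    vectorState q a (Podles.act q a (Uq.F q) (Podles.Z q a ^ n * Podles.X q a)) = 0 := by
  have h := (hasSum_vectorState q a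
    (Podles.act q a (Uq.F q) (Podles.Z q a ^ n * Podles.X q a))).mul_left ((qc q)⁻¹ - qc q)
  simp only [smul_diag_act_F] at h
  -- Grouping both signs at each p makes the total a series over p, whose partial sums telescope.
  have h2 := ((Equiv.prodComm ℕ Sgn).hasSum_iff.2 h).prod_fiberwise fun p => hasSum_fintype _
  simp only [Function.comp_apply, Equiv.prodComm_apply, Prod.swap_prod_mk, Fintype.sum_bool] at h2
  have h3 := h2.tendsto_sum_nat
  simp only [Finset.sum_add_distrib, ← Finset.mul_sum, Finset.sum_range_sub', diagCoeff_zero,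
    Sgn.val, zero_sub] at h3
  -- The partial sums start from the diagonal coefficient at 0, which vanishes, so only the boundary
  -- term at infinity remains for each sign.
  have h4 := ((tendsto_diagCoeff q a true n).neg.const_mul
    ((qh q)⁻¹ * (tconst q a : ℂ) * ((1 : ℝ) : ℂ))).add
    ((tendsto_diagCoeff q a false n).neg.const_mul
    ((qh q)⁻¹ * (tconst q a : ℂ) * ((-1 : ℝ) : ℂ)))
  have h5 := tendsto_nhds_unique h3 h4
  -- The boundary terms are 0^n for both signs, with coefficients +1 and -1. For n = 0 each is
  -- nonzero, and both summands are needed for the cancellation.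
  refine (mul_eq_zero.1 (h5.trans ?_)).resolve_left (inv_qc_sub_ne q)
  push_cast
  ring

/-- The vector state of `Λ(1)` is the restriction of the Haar state. -/
theorem vectorState_eq (Φ : SUq q →ₗ[ℂ] ℂ) (hΦ : IsInvariantState q Φ) (b : Podles q a) :
    vectorState q a b = Φ (Podles.toSU q a b) := by
  -- Both functionals take the value 1 at 1, are unchanged by K and vanish on F ▷ (Z^n X), so the
  -- uniqueness statement applies to their difference.
  have h : vectorState q a - Φ ∘ₗ (Podles.toSU q a).toLinearMap = 0 := by
    refine eq_zero_of_invariant _ ?_ (fun b => ?_) fun n => ?_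
    · simp [vectorState_one, hΦ.map_one]
    · simp [vectorState_act_K, invariant_act Φ hΦ, Uq.counit_K]
    · simp [vectorState_act_F, invariant_act Φ hΦ, Uq.counit_F]
  exact sub_eq_zero.1 (LinearMap.congr_fun h b)

end Haar

end QuantumSphere

end

/-! ### Assembly of the theorem. -/

open QuantumSphere
theorem theorem5p1 (q : Param) (a : ℝ) :
    (∀ Φ : SUq q →ₗ[ℂ] ℂ, IsInvariantState q Φ → ∀ b c : Podles q a,
      inner ℂ (gns q a b) (gns q a c) = Φ (Podles.toSU q a (star b * c))) ∧
    ∀ s : Sgn, ∃ π : Heis q a →ₐ[ℂ] Module.End ℂ (V ⊗[ℂ] V),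
      (∀ (x : Heis q a) (η ζ : V ⊗[ℂ] V),
        inner ℂ (inclW s (π x η)) (inclW s ζ) = inner ℂ (inclW s η) (inclW s (π (star x) ζ))) ∧
      (∀ b : Podles q a, π (Heis.ofB q a b) = tensorEnd (piRep q a s b) 1) ∧
      π (Heis.ofU q a (Uq.K q)) =
        tensorEnd (opZinv q a s) (piRep q a s (Podles.Z q a)) ∧
      ((qc q)⁻¹ - qc q) • π (Heis.ofU q a (Uq.E q)) =
        (qh q)⁻¹ • tensorEnd (opZinv q a s * piRep q a s (Podles.X q a)) 1 -
          qh q • tensorEnd (opZinv q a s) (piRep q a s (Podles.Y q a)) ∧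
      ((qc q)⁻¹ - qc q) • π (Heis.ofU q a (Uq.F q)) =
        (qh q)⁻¹ • tensorEnd (piRep q a s (Podles.Y q a)) (opZinv q a s) -
          qh q • tensorEnd 1 (piRep q a s (Podles.X q a) * opZinv q a s) ∧
      ∀ (x : Heis q a) (η : V ⊗[ℂ] V) (b : Podles q a),
        inner ℂ (inclW s (π x η)) (gns q a b) =
          inner ℂ (inclW s η) (gns q a (Heis.rep q a (star x) b)) := by
  refine ⟨fun Φ hΦ b c => (inner_gns q a b c).trans (vectorState_eq q a Φ hΦ _), fun s =>
    ⟨repW q a s, wAdj_repW q a s, fun b => ?_, ?_, ?_, ?_, gnsAdj_repW⟩⟩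
  · rw [repW_ofB, repB_apply]
  · rw [repW_ofU, repU_K, piRep_Z]
  · rw [repW_ofU, smul_repU_E, scaledE, piRep_X, piRep_Y]
  · rw [repW_ofU, smul_repU_F, scaledF, piRep_X, piRep_Y]
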